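/- Let $G$ be a discrete group. Let $\mathrm{Orb}(G)$ be the category whose objects are the subgroups of $G$ and whose morphisms from $H$ to $K$ are the $G$-maps $G/H\to G/K$. For a $G$-CW-complex $X$ with $0$-skeleton $X^{(0)}$, let $\Pi_1(X;G)$ be the contravariant functor from $\mathrm{Orb}(G)$ to groupoids which sends $H$ to the full subgroupoid of the fundamental groupoid of the fixed point set $X^H$ on the objects $X^H\cap X^{(0)}$, and which sends a morphism $uH\mapsto ugK$ to the morphism of groupoids induced by $X^K\to X^H$, $x\mapsto gx$. A cellular $G$-map $\varphi\colon Y\to X$ induces a natural transformation $\varphi_\#\colon\Pi_1(Y;G)\to\Pi_1(X;G)$ through the maps $\varphi^H\colon Y^H\to X^H$. Let $\Pi$ be a contravariant functor from $\mathrm{Orb}(G)$ to groupoids. A universal space for $\Pi$ is a $G$-CW-complex $B\Pi$ together with a natural isomorphism $\Pi_1(B\Pi;G)\cong\Pi$ such that $\pi_j(B\Pi^H,x)=0$ for all $j\ge 2$, all subgroups $H$ of $G$ and all $x\in B\Pi^H$. (1) A universal space for $\Pi$ exists if and only if there is a $G$-set $S$ such that the set-valued functors $H\mapsto \mathrm{Ob}\,\Pi(H)$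 and $H\mapsto S^H$ on $\mathrm{Orb}(G)$ are naturally isomorphic. (2) Let $B\Pi$ be any universal space for $\Pi$. For every $G$-CW-complex $Y$ and every natural transformation $\Phi\colon\Pi_1(Y;G)\to\Pi$ there is a cellular $G$-map $\varphi\colon Y\to B\Pi$ such that $\varphi_\#=\Phi$ under the identification $\Pi_1(B\Pi;G)\cong\Pi$. Any two cellular $G$-maps $\varphi,\varphi'\colon Y\to B\Pi$ with $\varphi_\#=\Phi=\varphi'_\#$ are $G$-homotopic. -/

import Mathlib

open CategoryTheory MulAction

universe u

noncomputable section

namespace EquivariantUniversalSpace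

/-! ### The orbit category of a discrete group -/

/-- The orbit category `Orb(G)` for the family of all subgroups: an object is a subgroup `H` of `G`,
a morphism from `H` to `K` is a `G`-map `G/H → G/K`. -/
structure Orb (G : Type u) [Group G] where
  /-- the subgroup -/
  sub : Subgroup G

instance Orb.category (G : Type u) [Group G] : Category.{u} (Orb G) where
  Hom H K := (G ⧸ H.sub) →[G] (G ⧸ K.sub)
  id H := MulActionHom.id G
  comp α β := MulActionHom.comp β α

section FixedPoints

variable {G : Type u} [Group G] {X : Type u} [MulAction G X]

/-- For a coset `gK` and a `K`-fixed point `x`, the well-defined point `g • x`. -/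
def cosetSMul {K : Subgroup G} (c : G ⧸ K) (x : fixedPoints K X) : X :=
  Quotient.liftOn' c (fun g => g • (x : X)) (by
    intro a b hab
    rw [QuotientGroup.leftRel_apply] at hab
    have h : (a⁻¹ * b) • (x : X) = x := x.2 ⟨a⁻¹ * b, hab⟩
    rw [mul_smul, inv_smul_eq_iff] at h
    exact h.symm)

theorem cosetSMul_mk {K : Subgroup G} (g : G) (x : fixedPoints K X) :
    cosetSMul (g : G ⧸ K) x = g • (x : X) := rfl

theorem cosetSMul_smul {K : Subgroup G} (g : G) (c : G ⧸ K) (x : fixedPoints K X) :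
    cosetSMul (g • c) x = g • cosetSMul c x := by
  induction c using QuotientGroup.induction_on with
  | H a => exact mul_smul g a (x : X)

/-- The base coset of `G/H`. -/
def baseCoset (H : Subgroup G) : G ⧸ H := ((1 : G) : G ⧸ H)

theorem smul_baseCoset {H : Subgroup G} (h : H) : (h : G) • baseCoset H = baseCoset H := by
  change (((h : G) * 1 : G) : G ⧸ H) = ((1 : G) : G ⧸ H)
  rw [QuotientGroup.eq]
  simp

/-- The map `X^K → X^H`, `x ↦ g x`, associated with the morphism `α : G/H → G/K`, `uH ↦ ugK`;
here `gK` is the image of the base coset under `α`. -/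
def translate {H K : Orb G} (α : H ⟶ K) (x : fixedPoints K.sub X) : fixedPoints H.sub X :=
  ⟨cosetSMul (MulActionHom.toFun α (baseCoset H.sub)) x, by
    intro h
    have e : (h : G) • MulActionHom.toFun α (baseCoset H.sub)
        = MulActionHom.toFun α (baseCoset H.sub) := by
      have := MulActionHom.map_smul' α (h : G) (baseCoset H.sub)
      rw [smul_baseCoset] at this
      exact this.symm
    change (h : G) • cosetSMul (MulActionHom.toFun α (baseCoset H.sub)) x
      = cosetSMul (MulActionHom.toFun α (baseCoset H.sub)) x
    rw [← cosetSMul_smul, e]⟩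

theorem translate_id (H : Orb G) (x : fixedPoints H.sub X) : translate (𝟙 H) x = x :=
  Subtype.ext (show (1 : G) • (x : X) = x from one_smul G (x : X))

theorem translate_comp {H K L : Orb G} (α : H ⟶ K) (β : K ⟶ L) (x : fixedPoints L.sub X) :
    translate (α ≫ β) x = translate α (translate β x) := by
  apply Subtype.ext
  change cosetSMul (MulActionHom.toFun β (MulActionHom.toFun α (baseCoset H.sub))) x
    = cosetSMul (MulActionHom.toFun α (baseCoset H.sub)) (translate β x)
  generalize MulActionHom.toFun α (baseCoset H.sub) = c
  induction c using QuotientGroup.induction_on with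
  | H a =>
    have e : (a : G ⧸ K.sub) = a • baseCoset K.sub := by
      change _ = ((a * 1 : G) : G ⧸ K.sub)
      rw [mul_one]
    have := MulActionHom.map_smul' β a (baseCoset K.sub)
    rw [e, this, id, cosetSMul_smul, ← e]
    rfl

theorem continuous_translate [TopologicalSpace X] [ContinuousConstSMul G X] {H K : Orb G}
    (α : H ⟶ K) : Continuous (translate α : fixedPoints K.sub X → fixedPoints H.sub X) := by
  refine Continuous.subtype_mk ?_ _
  generalize MulActionHom.toFun α (baseCoset H.sub) = c
  induction c using QuotientGroup.induction_on with
  | H a => exact continuous_subtype_val.const_smul a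

end FixedPoints

/-- The contravariant functor `H ↦ S^H` on the orbit category, for a `G`-set `S`. -/
def fixedPointFunctor (G : Type u) [Group G] (S : Type u) [MulAction G S] :
    (Orb G)ᵒᵖ ⥤ Type u where
  obj H := fixedPoints H.unop.sub S
  map α := ↾(translate α.unop)
  map_id H := by
    ext x
    exact congrArg Subtype.val (translate_id H.unop x)
  map_comp α β := by
    ext x
    exact congrArg Subtype.val (translate_comp β.unop α.unop x)

/-! ### `G`-CW-complexes -/

/-- The closed unit disk `D^n`; its boundary sphere `S^{n-1}` is given by `‖v‖ = 1`. -/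
abbrev Disk (n : ℕ) : Type := Metric.closedBall (0 : EuclideanSpace ℝ (Fin n)) 1

/-- The structure of a `G`-CW-complex on a `G`-space `X`. The index of the filtration is shifted:
`filt n` is the skeleton `X^(n-1)`, in particular `filt 0 = X^(-1)` is empty.
The fields `char_boundary`, `char_interior` and `isClosed_succ` say that `X^(n)` is the pushout of
`X^(n-1) ← ⨆ᵢ G/Hᵢ × S^(n-1) → ⨆ᵢ G/Hᵢ × D^n`; `isClosed_iff` is the colimit topology.
The orbits `G/Hᵢ` are discrete. -/
structure GCWComplex (G : Type u) [Group G] (X : Type u) [TopologicalSpace X] [MulAction G X] where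
  /-- the filtration, `filt n = X^(n-1)` -/
  filt : ℕ → Set X
  filt_zero : filt 0 = ∅
  filt_mono : Monotone filt
  filt_smul : ∀ (n : ℕ) (g : G), ∀ x ∈ filt n, g • x ∈ filt n
  iUnion_filt : ⋃ n, filt n = Set.univ
  isClosed_iff : ∀ A : Set X, IsClosed A ↔ ∀ n, IsClosed ((↑) ⁻¹' A : Set (filt n))
  /-- the index set of the equivariant `n`-cells -/
  cell : ℕ → Type u
  /-- the isotropy group `Hᵢ` of the cell `G/Hᵢ × D^n` -/
  stab : ∀ n, cell n → Subgroup G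
  /-- the characteristic map `G/Hᵢ × D^n → X` -/
  char : ∀ (n : ℕ) (i : cell n), G ⧸ stab n i → Disk n → X
  char_smul : ∀ (n : ℕ) (i : cell n) (g : G) (c : G ⧸ stab n i) (v : Disk n),
    char n i (g • c) v = g • char n i c v
  char_continuous : ∀ (n : ℕ) (i : cell n) (c : G ⧸ stab n i), Continuous (char n i c)
  char_boundary : ∀ (n : ℕ) (i : cell n) (c : G ⧸ stab n i) (v : Disk n),
    ‖(v : EuclideanSpace ℝ (Fin n))‖ = 1 → char n i c v ∈ filt n
  char_interior : ∀ n : ℕ,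
    Set.BijOn (fun p : (i : cell n) × ((G ⧸ stab n i) × Disk n) => char n p.1 p.2.1 p.2.2)
      {p | ‖(p.2.2 : EuclideanSpace ℝ (Fin n))‖ < 1} (filt (n + 1) \ filt n)
  isClosed_succ : ∀ (n : ℕ) (A : Set X),
    IsClosed ((↑) ⁻¹' A : Set (filt (n + 1))) ↔
      IsClosed ((↑) ⁻¹' A : Set (filt n)) ∧
        ∀ (i : cell n) (c : G ⧸ stab n i), IsClosed (char n i c ⁻¹' A)

/-- The `n`-skeleton `X^(n)`. -/
def GCWComplex.skel {G : Type u} [Group G] {X : Type u} [TopologicalSpace X] [MulAction G X]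
    (K : GCWComplex G X) (n : ℕ) : Set X := K.filt (n + 1)

/-! ### The fundamental groupoid restricted to a set of base points -/

/-- The full subgroupoid of the fundamental groupoid of `Z` on the points of `S`. -/
abbrev RestrictedGroupoid (Z : Type u) [TopologicalSpace Z] (S : Set Z) : Type u :=
  InducedCategory (FundamentalGroupoid Z) (fun s : S => FundamentalGroupoid.mk (s : Z))

section Restricted

variable {Z W V : Type u} [TopologicalSpace Z] [TopologicalSpace W] [TopologicalSpace V]

/-- The morphism of restricted fundamental groupoids induced by a continuous map. -/
def restrictedMap {S : Set Z} {T : Set W} (f : C(Z, W)) (hf : Set.MapsTo f S T) :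
    RestrictedGroupoid Z S ⥤ RestrictedGroupoid W T where
  obj s := (⟨f s.1, hf s.2⟩ : T)
  map p := InducedCategory.homMk ((FundamentalGroupoid.map f).map p.hom)
  map_id s := by
    apply InducedCategory.hom_ext
    exact (FundamentalGroupoid.map f).map_id _
  map_comp p q := by
    apply InducedCategory.hom_ext
    exact (FundamentalGroupoid.map f).map_comp _ _

theorem restrictedMap_congr {S : Set Z} {T : Set W} {f g : C(Z, W)} (hf : Set.MapsTo f S T)
    (hg : Set.MapsTo g S T) (h : f = g) : restrictedMap f hf = restrictedMap g hg := by
  subst h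
  rfl

theorem restrictedMap_id {S : Set Z} (h : Set.MapsTo (ContinuousMap.id Z) S S) :
    restrictedMap (ContinuousMap.id Z) h = 𝟭 (RestrictedGroupoid Z S) := by
  refine CategoryTheory.Functor.hext (fun _ => rfl) ?_
  rintro s t ⟨⟨p⟩⟩
  exact heq_of_eq rfl

theorem restrictedMap_comp {S : Set Z} {T : Set W} {U : Set V} (f : C(Z, W)) (g : C(W, V))
    (hf : Set.MapsTo f S T) (hg : Set.MapsTo g T U) (h : Set.MapsTo (g.comp f) S U) :
    restrictedMap (g.comp f) h = restrictedMap f hf ⋙ restrictedMap g hg := by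
  refine CategoryTheory.Functor.hext (fun _ => rfl) ?_
  rintro s t ⟨⟨p⟩⟩
  exact heq_of_eq rfl

end Restricted

/-! ### The fundamental groupoid functor of a `G`-CW-complex -/

section FundamentalGroupoidFunctor

variable {G : Type u} [Group G] {X : Type u} [TopologicalSpace X] [MulAction G X]

/-- The `0`-skeleton of the fixed point set `X^H`. -/
def GCWComplex.zeroSkel (K : GCWComplex G X) (H : Subgroup G) : Set (fixedPoints H X) :=
  {x | (x : X) ∈ K.skel 0}

/-- The continuous map `X^K → X^H` associated with `α : G/H → G/K`. -/
def translateMap [ContinuousConstSMul G X] {H K : Orb G} (α : H ⟶ K) :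
    C(fixedPoints K.sub X, fixedPoints H.sub X) :=
  ⟨translate α, continuous_translate α⟩

theorem GCWComplex.translate_mapsTo [ContinuousConstSMul G X] (C : GCWComplex G X) {H K : Orb G}
    (α : H ⟶ K) : Set.MapsTo (translateMap α) (C.zeroSkel K.sub) (C.zeroSkel H.sub) := by
  intro x hx
  change cosetSMul (MulActionHom.toFun α (baseCoset H.sub)) x ∈ C.skel 0
  generalize MulActionHom.toFun α (baseCoset H.sub) = c
  induction c using QuotientGroup.induction_on with
  | H a => exact C.filt_smul 1 a _ hx

/-- The fundamental groupoid functor `Π₁(X;G)`: it sends `H` to the fundamental groupoid of `X^H`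
restricted to the `0`-skeleton of `X^H`, which is the empty groupoid if `X^H` is empty. -/
def GCWComplex.fundamentalGroupoidFunctor [ContinuousConstSMul G X] (C : GCWComplex G X) :
    (Orb G)ᵒᵖ ⥤ Grpd.{u, u} where
  obj H := Grpd.of (RestrictedGroupoid (fixedPoints H.unop.sub X) (C.zeroSkel H.unop.sub))
  map α := restrictedMap (translateMap α.unop) (C.translate_mapsTo α.unop)
  map_id H := by
    have e : (translateMap (𝟙 H.unop) : C(fixedPoints H.unop.sub X, fixedPoints H.unop.sub X))
        = ContinuousMap.id _ := ContinuousMap.ext (translate_id H.unop)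
    refine (restrictedMap_congr (C.translate_mapsTo _) (Set.mapsTo_id _) e).trans ?_
    exact restrictedMap_id _
  map_comp {H K L} α β := by
    have e : (translateMap (β.unop ≫ α.unop) : C(fixedPoints H.unop.sub X, fixedPoints L.unop.sub X))
        = (translateMap β.unop).comp (translateMap α.unop) :=
      ContinuousMap.ext (translate_comp β.unop α.unop)
    refine (restrictedMap_congr (C.translate_mapsTo _)
      (g := (translateMap β.unop).comp (translateMap α.unop))
      (fun _ hx => C.translate_mapsTo β.unop (C.translate_mapsTo α.unop hx)) e).trans ?_
    exact restrictedMap_comp (translateMap α.unop) (translateMap β.unop)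
      (C.translate_mapsTo α.unop) (C.translate_mapsTo β.unop) _

end FundamentalGroupoidFunctor

/-! ### Cellular `G`-maps -/

section Maps

variable {G : Type u} [Group G]
  {Y : Type u} [TopologicalSpace Y] [MulAction G Y]
  {X : Type u} [TopologicalSpace X] [MulAction G X]

/-- A cellular `G`-map between `G`-CW-complexes. -/
structure CellularGMap (D : GCWComplex G Y) (C : GCWComplex G X) where
  /-- the underlying continuous map -/
  toMap : C(Y, X)
  equivariant : ∀ (g : G) (y : Y), toMap (g • y) = g • toMap y
  cellular : ∀ n : ℕ, Set.MapsTo toMap (D.skel n) (C.skel n)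

/-- Two equivariant continuous maps are `G`-homotopic: there is a homotopy between them through
equivariant maps. -/
def GHomotopic (G : Type u) [Group G] [MulAction G Y] [MulAction G X] (f₀ f₁ : C(Y, X)) : Prop :=
  ∃ F : ContinuousMap.Homotopy f₀ f₁, ∀ (t : unitInterval) (g : G) (y : Y),
    F (t, g • y) = g • F (t, y)

namespace CellularGMap

variable {D : GCWComplex G Y} {C : GCWComplex G X}

/-- The restriction `φ^H : Y^H → X^H`. -/
def onFixedPoints (φ : CellularGMap D C) (H : Subgroup G) :
    C(fixedPoints H Y, fixedPoints H X) where
  toFun y := ⟨φ.toMap y, fun h => by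
    change (h : G) • φ.toMap y = φ.toMap y
    rw [← φ.equivariant]
    exact congrArg φ.toMap (y.2 h)⟩
  continuous_toFun := by fun_prop

theorem onFixedPoints_mapsTo (φ : CellularGMap D C) (H : Subgroup G) :
    Set.MapsTo (φ.onFixedPoints H) (D.zeroSkel H) (C.zeroSkel H) :=
  fun _ hy => φ.cellular 0 hy

theorem onFixedPoints_translate (φ : CellularGMap D C) {H K : Orb G} (α : H ⟶ K)
    (y : fixedPoints K.sub Y) :
    φ.onFixedPoints H.sub (translate α y) = translate α (φ.onFixedPoints K.sub y) := by
  apply Subtype.ext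
  change φ.toMap (cosetSMul (MulActionHom.toFun α (baseCoset H.sub)) y)
    = cosetSMul (MulActionHom.toFun α (baseCoset H.sub)) (φ.onFixedPoints K.sub y)
  generalize MulActionHom.toFun α (baseCoset H.sub) = c
  induction c using QuotientGroup.induction_on with
  | H a => exact φ.equivariant a y

/-- The natural transformation `φ_# : Π₁(Y;G) → Π₁(X;G)` whose component at `H` is induced by
`φ^H : Y^H → X^H`. -/
def sharp [ContinuousConstSMul G Y] [ContinuousConstSMul G X] (φ : CellularGMap D C) :
    D.fundamentalGroupoidFunctor ⟶ C.fundamentalGroupoidFunctor where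
  app H := restrictedMap (φ.onFixedPoints H.unop.sub) (φ.onFixedPoints_mapsTo H.unop.sub)
  naturality {K H} α := by
    have e : (φ.onFixedPoints H.unop.sub).comp (translateMap α.unop)
        = (translateMap α.unop).comp (φ.onFixedPoints K.unop.sub) :=
      ContinuousMap.ext (φ.onFixedPoints_translate α.unop)
    have h₁ : Set.MapsTo ((φ.onFixedPoints H.unop.sub).comp (translateMap α.unop))
        (D.zeroSkel K.unop.sub) (C.zeroSkel H.unop.sub) :=
      fun _ hy => φ.onFixedPoints_mapsTo H.unop.sub (D.translate_mapsTo α.unop hy)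
    have h₂ : Set.MapsTo ((translateMap α.unop).comp (φ.onFixedPoints K.unop.sub))
        (D.zeroSkel K.unop.sub) (C.zeroSkel H.unop.sub) :=
      fun _ hy => C.translate_mapsTo α.unop (φ.onFixedPoints_mapsTo K.unop.sub hy)
    exact (restrictedMap_comp _ _ (D.translate_mapsTo α.unop)
      (φ.onFixedPoints_mapsTo H.unop.sub) h₁).symm.trans
        ((restrictedMap_congr h₁ h₂ e).trans
          (restrictedMap_comp _ _ (φ.onFixedPoints_mapsTo K.unop.sub)
            (C.translate_mapsTo α.unop) h₂))

end CellularGMap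

end Maps

/-! ### Universal spaces -/

/-- A `G`-CW-structure on `B` together with an identification `Π₁(B;G) = Π`, such that the higher
homotopy groups of all fixed point sets vanish: `B` is a universal space `BΠ`. -/
structure UniversalSpace {G : Type u} [Group G] (P : (Orb G)ᵒᵖ ⥤ Grpd.{u, u})
    (B : Type u) [TopologicalSpace B] [MulAction G B] [ContinuousConstSMul G B] where
  /-- the `G`-CW-structure -/
  cw : GCWComplex G B
  /-- the identification `Π₁(B;G) = Π` -/
  ident : cw.fundamentalGroupoidFunctor ≅ P
  aspherical : ∀ (H : Subgroup G) (j : ℕ), 2 ≤ j → ∀ x : fixedPoints H B,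
    Subsingleton (HomotopyGroup.Pi j (fixedPoints H B) x)

/-- The object sets of `Π` are the fixed point sets of a `G`-set: the functor `H ↦ Ob Π(H)` is
naturally isomorphic to `H ↦ S^H` for some `G`-set `S`. -/
def ObjectsAreFixedPoints {G : Type u} [Group G] (P : (Orb G)ᵒᵖ ⥤ Grpd.{u, u}) : Prop :=
  ∃ (S : Type u) (_ : MulAction G S), Nonempty (P ⋙ Grpd.objects ≅ fixedPointFunctor G S)

end EquivariantUniversalSpace

end

/-! Part (2) is equivariant obstruction theory. An equivariant map out of a G-CW-complex Y is built
one cell G/H × D^n at a time, and the choice to be made for a cell is a disk in the H-fixed points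
of the target (`GCWComplex.exists_of_cells`). To realise Φ, a vertex goes where Φ sends it and an
edge goes to a path that represents Φ of its class. The boundary loop of a 2-cell with isotropy
group H is null in Y^H, so the functor Φ(H) kills its class and the image loop bounds a disk. From
dimension 3 on, the vanishing homotopy groups of the fixed point sets fill the spheres.

The 2-cell step must know that the map on the 1-skeleton induces Φ on all path classes of fixed
points, not only on edges. This follows because the edges generate the fundamental groupoid of the
graph of H-fixed points (`GCWComplex.EdgeClosed.all`, `GCWComplex.basedMap_graph_eq`). Cellular
approximation through homotopies that respect all fixed point sets
(`GCWComplex.exists_cellular_approx`) makes every chosen disk cellular. It also shows that each path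
class of Y^H between vertices comes from the 1-skeleton, whence φ_# = Φ. A G-homotopy is an
equivariant map from Y to the path space C(I, BΠ), so the same induction gives uniqueness: constant
paths on vertices, the equality of φ_# and φ'_# on edges, asphericity for the boundary spheres of
cylinders above.

In part (1), necessity holds because the vertices of BΠ form a G-set whose H-fixed points are the
objects at H. For sufficiency, each groupoid A receives a strictly functorial classifying space. The
functions from [0,1) to the morphisms out of an object a, with the outer measure of the set of
disagreement as distance, form a contractible space, on which A acts freely by composition. The
disjoint union over a covers its quotient (`ClassifyingSpace.isCoveringMap_proj`), so the quotient
has no higher homotopy, and its fundamental groupoid on base points indexed by the objects is A.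

Applied to Π this gives a diagram of spaces on the orbit category, which is then approximated by a
G-CW-complex. Its 0-cells are the orbits of S, and for n ≥ 1 every compatible pair of an attaching
map into X^H and a disk in the space at H is attached as an n-cell of type G/H. Hence disks in the
space at H lift to X^H as soon as their boundary lifts to the right skeleton
(`GCWComplex.HasDiskLifts`). This lifting property makes the comparison of fundamental groupoids
fully faithful and passes asphericity to X^H. -/

noncomputable section

namespace EquivariantUniversalSpace

open unitInterval Topology

/-! ### Maps out of disks and spheres -/

/-- The unit sphere `S^{n-1}` in `ℝ^n`. -/
abbrev UnitSphere (n : ℕ) : Type := Metric.sphere (0 : EuclideanSpace ℝ (Fin n)) 1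

/-- The inclusion of the sphere into the disk. -/
def sphereIncl (n : ℕ) : C(UnitSphere n, Disk n) where
  toFun v := ⟨v, Metric.sphere_subset_closedBall v.2⟩
  continuous_toFun := by fun_prop

/-- The scaling map of the disk. -/
def diskScale (n : ℕ) : C(I × Disk n, Disk n) where
  toFun p := ⟨(p.1 : ℝ) • (p.2 : EuclideanSpace ℝ (Fin n)), by
    have h1 := p.2.2
    rw [mem_closedBall_zero_iff] at h1 ⊢
    rw [norm_smul, Real.norm_of_nonneg p.1.2.1]
    exact mul_le_one₀ p.1.2.2 (norm_nonneg _) h1⟩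
  continuous_toFun := by fun_prop

theorem norm_disk_le {n : ℕ} (v : Disk n) : ‖(v : EuclideanSpace ℝ (Fin n))‖ ≤ 1 :=
  mem_closedBall_zero_iff.1 v.2

theorem norm_sphereIncl {n : ℕ} (v : UnitSphere n) :
    ‖(sphereIncl n v : EuclideanSpace ℝ (Fin n))‖ = 1 := mem_sphere_zero_iff_norm.1 v.2

theorem exists_sphereIncl {n : ℕ} {v : Disk n} (hv : ‖(v : EuclideanSpace ℝ (Fin n))‖ = 1) :
    ∃ w, sphereIncl n w = v := ⟨⟨v, mem_sphere_zero_iff_norm.2 hv⟩, rfl⟩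

/-- A map from a sphere extends over the disk. -/
def ExtendsToDisk {Z : Type*} [TopologicalSpace Z] {n : ℕ} (f : C(UnitSphere n, Z)) : Prop :=
  ∃ F : C(Disk n, Z), ∀ v, F (sphereIncl n v) = f v

/-- A continuous surjection from a compact to a Hausdorff space is closed, hence a quotient map. All
the gluings on disks and spheres below are instances. -/
theorem exists_factor {K L Z : Type*} [TopologicalSpace K] [TopologicalSpace L]
    [TopologicalSpace Z] [CompactSpace K] [T2Space L] (q : C(K, L))
    (hq : Function.Surjective q) (g : C(K, Z)) (h : ∀ x y, q x = q y → g x = g y) :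
    ∃ f : C(L, Z), ∀ x, f (q x) = g x := by
  have hqm : IsQuotientMap q := (q.continuous.isClosedMap).isQuotientMap q.continuous hq
  refine ⟨hqm.lift g (fun x y e => h x y e), fun x => ?_⟩
  exact congrArg (fun φ : C(K, Z) => φ x) (hqm.lift_comp g (fun x y e => h x y e))

/-- The disk is the cone on its boundary sphere: scaling I × S^n → D^{n+1} is a quotient map that
only collapses the end 0. The shift to `n + 1` excludes the empty sphere. -/
theorem extendsToDisk_iff_nullhomotopic {Z : Type*} [TopologicalSpace Z] {n : ℕ}
    (f : C(UnitSphere (n + 1), Z)) : ExtendsToDisk f ↔ f.Nullhomotopic := by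
  constructor
  · rintro ⟨F, hF⟩
    refine ⟨F ⟨0, by simp⟩, ⟨⟨F.comp ((diskScale (n + 1)).comp
      (ContinuousMap.prodMap ⟨unitInterval.symm, by fun_prop⟩ (sphereIncl (n + 1)))),
      fun v => ?_, fun v => ?_⟩⟩⟩
    · rw [← hF]
      change F _ = F _
      congr 1
      ext1
      simp [diskScale]
    · change F _ = F _
      congr 1
      ext1
      simp [diskScale]
  · rintro ⟨z, ⟨H⟩⟩
    have hsurj : Function.Surjective ((diskScale (n + 1)).comp
        (ContinuousMap.prodMap (.id I) (sphereIncl (n + 1)))) := by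
      rintro ⟨v, hv⟩
      rw [mem_closedBall_zero_iff] at hv
      by_cases h0 : v = 0
      · refine ⟨(0, ⟨EuclideanSpace.single 0 1, by simp⟩), ?_⟩
        ext1
        simp [diskScale, h0]
      · refine ⟨(⟨‖v‖, norm_nonneg _, hv⟩, ⟨‖v‖⁻¹ • v, by simp [norm_smul, h0]⟩), ?_⟩
        ext1
        simp [diskScale, sphereIncl, smul_smul, h0]
    obtain ⟨F, hF⟩ := exists_factor _ hsurj
      ((H : C(I × UnitSphere (n + 1), Z)).comp
        (ContinuousMap.prodMap ⟨unitInterval.symm, by fun_prop⟩ (.id _))) (by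
      rintro ⟨s, v⟩ ⟨t, w⟩ h
      have h1 : (s : ℝ) • (v : EuclideanSpace ℝ (Fin (n + 1))) = (t : ℝ) • (w : _) :=
        congrArg Subtype.val h
      have hv : ‖(v : EuclideanSpace ℝ (Fin (n + 1)))‖ = 1 := norm_sphereIncl v
      have hw : ‖(w : EuclideanSpace ℝ (Fin (n + 1)))‖ = 1 := norm_sphereIncl w
      have h2 : (s : ℝ) = t := by
        have := congrArg norm h1
        rwa [norm_smul, norm_smul, hv, hw, mul_one, mul_one, Real.norm_of_nonneg s.2.1,
          Real.norm_of_nonneg t.2.1] at this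
      obtain rfl : s = t := Subtype.ext h2
      by_cases h0 : s = 0
      · subst h0
        simp
      · have h0' : (s : ℝ) ≠ 0 := fun e => h0 (Subtype.ext e)
        have : v = w := Subtype.ext (smul_right_injective _ h0' h1)
        rw [this])
    refine ⟨F, fun v => ?_⟩
    have := hF (1, v)
    simp only [ContinuousMap.comp_apply, ContinuousMap.prodMap_apply, Prod.map] at this
    have e : (diskScale (n + 1)) ((ContinuousMap.id I) 1, (sphereIncl (n + 1)) v)
        = sphereIncl (n + 1) v := by
      ext1; simp [diskScale]
    rw [e] at this
    rw [this]
    simp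

theorem ExtendsToDisk.of_homotopic {Z : Type*} [TopologicalSpace Z] {n : ℕ}
    {f g : C(UnitSphere (n + 1), Z)} (hg : ExtendsToDisk g) (h : f.Homotopic g) :
    ExtendsToDisk f := by
  rw [extendsToDisk_iff_nullhomotopic] at hg ⊢
  obtain ⟨z, hz⟩ := hg
  exact ⟨z, h.trans hz⟩

/-! ### Collapsing the boundary of a disk -/

/-- The underlying vector of `collapse`. -/
def collapseVec {n : ℕ} (v : EuclideanSpace ℝ (Fin n)) : EuclideanSpace ℝ (Fin (n + 1)) :=
  WithLp.toLp 2 (Fin.cons (2 * ‖v‖ ^ 2 - 1) (fun i => 2 * √(1 - ‖v‖ ^ 2) * v i))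

/-- With r = ‖v‖ the squared norm is (2r² − 1)² + 4(1 − r²)r² = 1. -/
theorem norm_collapseVec {n : ℕ} {v : EuclideanSpace ℝ (Fin n)} (hv : ‖v‖ ≤ 1) :
    ‖collapseVec v‖ = 1 := by
  have h0 : 0 ≤ 1 - ‖v‖ ^ 2 := by nlinarith [norm_nonneg v]
  rw [EuclideanSpace.norm_eq, Real.sqrt_eq_one, Fin.sum_univ_succ]
  simp only [collapseVec, Fin.cons_zero, Fin.cons_succ, Real.norm_eq_abs, sq_abs, mul_pow,
    Real.sq_sqrt h0, ← Finset.mul_sum]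
  have : ∑ i, v i ^ 2 = ‖v‖ ^ 2 := by
    rw [EuclideanSpace.norm_sq_eq]; simp
  rw [this]
  ring

theorem continuous_collapseVec {n : ℕ} :
    Continuous (collapseVec : EuclideanSpace ℝ (Fin n) → _) := by
  unfold collapseVec
  refine (PiLp.continuous_toLp 2 _).comp (continuous_pi fun i => ?_)
  refine Fin.cases ?_ (fun j => ?_) i
  · simp only [Fin.cons_zero]; fun_prop
  · simp only [Fin.cons_succ]; fun_prop

/-- The map `D^n → S^n` which collapses the boundary to a point. -/
def collapse (n : ℕ) : C(Disk n, UnitSphere (n + 1)) where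
  toFun v := ⟨collapseVec v, mem_sphere_zero_iff_norm.2 (norm_collapseVec (norm_disk_le v))⟩
  continuous_toFun := by
    have := continuous_collapseVec (n := n)
    fun_prop

/-- The first coordinate determines the norm of v. If that norm is less than 1, the factor of the
other coordinates is nonzero and they determine v. -/
theorem collapse_eq {n : ℕ} {v w : Disk n} (h : collapse n v = collapse n w) :
    v = w ∨ (‖(v : EuclideanSpace ℝ (Fin n))‖ = 1 ∧ ‖(w : EuclideanSpace ℝ (Fin n))‖ = 1) := by
  have h1 : collapseVec (v : EuclideanSpace ℝ (Fin n)) = collapseVec w := congrArg Subtype.val h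
  have h2 := congrArg (fun z : EuclideanSpace ℝ (Fin (n + 1)) => z 0) h1
  simp only [collapseVec, Fin.cons_zero] at h2
  have h3 : ‖(v : EuclideanSpace ℝ (Fin n))‖ = ‖(w : EuclideanSpace ℝ (Fin n))‖ := by
    have : ‖(v : EuclideanSpace ℝ (Fin n))‖ ^ 2 = ‖(w : EuclideanSpace ℝ (Fin n))‖ ^ 2 := by
      linarith
    exact (sq_eq_sq₀ (norm_nonneg _) (norm_nonneg _)).1 this
  by_cases h4 : ‖(w : EuclideanSpace ℝ (Fin n))‖ = 1
  · exact Or.inr ⟨h3.trans h4, h4⟩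
  · left
    have h5 : 0 < 1 - ‖(w : EuclideanSpace ℝ (Fin n))‖ ^ 2 := by
      have := lt_of_le_of_ne (norm_disk_le w) h4
      nlinarith [norm_nonneg (w : EuclideanSpace ℝ (Fin n))]
    have h6 := Real.sqrt_pos.2 h5
    ext i
    have h7 := congrArg (fun z : EuclideanSpace ℝ (Fin (n + 1)) => z i.succ) h1
    simp only [collapseVec, Fin.cons_succ, h3] at h7
    have h8 : 2 * √(1 - ‖(w : EuclideanSpace ℝ (Fin n))‖ ^ 2) ≠ 0 := by positivity
    exact mul_left_cancel₀ h8 h7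

theorem collapse_boundary {n : ℕ} {v w : Disk n} (hv : ‖(v : EuclideanSpace ℝ (Fin n))‖ = 1)
    (hw : ‖(w : EuclideanSpace ℝ (Fin n))‖ = 1) : collapse n v = collapse n w := by
  ext i
  refine Fin.cases ?_ (fun j => ?_) i <;> simp [collapse, collapseVec, hv, hw]

theorem collapse_surjective (n : ℕ) : Function.Surjective (collapse (n + 1)) := by
  rintro ⟨z, hz⟩
  rw [mem_sphere_zero_iff_norm] at hz
  have hz2 : z 0 ^ 2 + ∑ i : Fin (n + 1), z i.succ ^ 2 = 1 := by
    have := EuclideanSpace.norm_sq_eq z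
    rw [hz, Fin.sum_univ_succ] at this
    simpa using this.symm
  have hs : 0 ≤ ∑ i : Fin (n + 1), z i.succ ^ 2 := Finset.sum_nonneg fun _ _ => sq_nonneg _
  -- The pole with first coordinate 1 is the image of the boundary; a boundary point exists because
  -- the disk has positive dimension.
  by_cases h1 : z 0 = 1
  · refine ⟨⟨EuclideanSpace.single 0 1, by simp⟩, ?_⟩
    have h0 : ∀ i : Fin (n + 1), z i.succ = 0 := by
      rw [h1] at hz2
      have : ∑ i : Fin (n + 1), z i.succ ^ 2 = 0 := by linarith
      rw [Finset.sum_eq_zero_iff_of_nonneg (fun _ _ => sq_nonneg _)] at this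
      intro i
      exact pow_eq_zero_iff two_ne_zero |>.1 (this i (Finset.mem_univ _))
    ext i
    refine Fin.cases ?_ (fun j => ?_) i
    · simp [collapse, collapseVec, h1]; try norm_num
    · simp [collapse, collapseVec, h0]
  · have h2 : z 0 < 1 := by
      rcases lt_or_gt_of_ne h1 with h | h
      · exact h
      · nlinarith
    have h3 : -1 ≤ z 0 := by nlinarith
    -- A preimage w must satisfy z 0 = 2‖w‖² − 1, so a is the value of √(1 − ‖w‖²), and w is the
    -- rest of z divided by 2a.
    set a : ℝ := √((1 - z 0) / 2) with ha
    have ha0 : 0 < a := Real.sqrt_pos.2 (by linarith)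
    have ha2 : a ^ 2 = (1 - z 0) / 2 := Real.sq_sqrt (by linarith)
    let w : EuclideanSpace ℝ (Fin (n + 1)) := WithLp.toLp 2 (fun i => z i.succ / (2 * a))
    have hw : ‖w‖ ^ 2 = (1 + z 0) / 2 := by
      rw [EuclideanSpace.norm_sq_eq]
      simp only [w, Real.norm_eq_abs, sq_abs, div_pow, ← Finset.sum_div]
      have : ∑ i : Fin (n + 1), z i.succ ^ 2 = (1 - z 0) * (1 + z 0) := by linarith
      rw [this, mul_pow, ha2]
      have : 1 - z 0 ≠ 0 := by linarith
      field_simp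
    have hw1 : ‖w‖ ≤ 1 := by
      have : ‖w‖ ^ 2 ≤ 1 := by rw [hw]; linarith
      nlinarith [norm_nonneg w]
    refine ⟨⟨w, mem_closedBall_zero_iff.2 hw1⟩, ?_⟩
    have e : 1 - ‖w‖ ^ 2 = (1 - z 0) / 2 := by rw [hw]; ring
    ext i
    refine Fin.cases ?_ (fun j => ?_) i
    · simp only [collapse, collapseVec, ContinuousMap.coe_mk, Fin.cons_zero, hw]; ring
    · simp only [collapse, collapseVec, ContinuousMap.coe_mk, Fin.cons_succ, e, ← ha, w]
      field_simp

/-- The boundary of a disk as a set. -/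
def diskBoundary (n : ℕ) : Set (Disk n) := {v | ‖(v : EuclideanSpace ℝ (Fin n))‖ = 1}

theorem exists_comp_collapse {Z : Type*} [TopologicalSpace Z] {n : ℕ} (g : C(Disk (n + 1), Z))
    (hg : ∀ v ∈ diskBoundary (n + 1), ∀ w ∈ diskBoundary (n + 1), g v = g w) :
    ∃ f : C(UnitSphere (n + 2), Z), ∀ v, f (collapse (n + 1) v) = g v := by
  refine exists_factor _ (collapse_surjective n) g fun v w h => ?_
  rcases collapse_eq h with h | h
  · rw [h]
  · exact hg v h.1 w h.2

/-- A boundary point of a disk. -/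
def diskPole (n : ℕ) : Disk (n + 1) := ⟨EuclideanSpace.single 0 1, by simp⟩

theorem diskPole_mem (n : ℕ) : diskPole n ∈ diskBoundary (n + 1) := by
  simp [diskBoundary, diskPole]

/-- Passes from free fillings to homotopies relative to the boundary. A filling is contracted along
straight segments to the image of the pole, which keeps that point fixed. Conversely, a homotopy
that is constant on the boundary factors through I × sphere. -/
theorem extendsToDisk_iff_homotopicRel {Z : Type*} [TopologicalSpace Z] {n : ℕ}
    (f : C(UnitSphere (n + 2), Z)) :
    ExtendsToDisk f ↔ (f.comp (collapse (n + 1))).HomotopicRel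
      (ContinuousMap.const _ (f (collapse (n + 1) (diskPole n)))) (diskBoundary (n + 1)) := by
  constructor
  · rintro ⟨F, hF⟩
    let p : Disk (n + 2) := sphereIncl _ (collapse (n + 1) (diskPole n))
    let m : C(I × Disk (n + 1), Disk (n + 2)) :=
      { toFun := fun x => ⟨(1 - (x.1 : ℝ)) • (collapse (n + 1) x.2 : EuclideanSpace ℝ (Fin (n + 2)))
            + (x.1 : ℝ) • (p : EuclideanSpace ℝ (Fin (n + 2))),
          (convex_closedBall _ _) (Metric.sphere_subset_closedBall (collapse (n + 1) x.2).2) p.2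
            (sub_nonneg.2 x.1.2.2) x.1.2.1 (by ring)⟩
        continuous_toFun := by
          refine Continuous.subtype_mk ?_ _
          have h2 : Continuous fun x : I × Disk (n + 1) =>
              (collapse (n + 1) x.2 : EuclideanSpace ℝ (Fin (n + 2))) :=
            continuous_subtype_val.comp ((collapse (n + 1)).continuous.comp continuous_snd)
          fun_prop }
    refine ⟨⟨⟨F.comp m, fun v => ?_, fun v => ?_⟩, fun t v hv => ?_⟩⟩
    · change F _ = _
      rw [ContinuousMap.comp_apply, ← hF]
      congr 1
      ext1
      simp [m, sphereIncl]
    · change F _ = f _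
      rw [← hF]
      congr 1
      ext1
      simp [m, p, sphereIncl]
    · change F _ = f _
      rw [← hF, collapse_boundary hv (diskPole_mem n)]
      congr 1
      ext1
      simp only [m, ContinuousMap.coe_mk, collapse_boundary hv (diskPole_mem n), p]
      change (1 - (t : ℝ)) • (collapse (n + 1) (diskPole n) : EuclideanSpace ℝ (Fin (n + 2)))
        + (t : ℝ) • (collapse (n + 1) (diskPole n) : EuclideanSpace ℝ (Fin (n + 2))) = _
      rw [← add_smul, sub_add_cancel, one_smul]
      rfl
  · rintro ⟨H⟩
    rw [extendsToDisk_iff_nullhomotopic]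
    obtain ⟨K, hK⟩ := exists_factor
      (ContinuousMap.prodMap (.id I) (collapse (n + 1)))
      (Function.Surjective.prodMap Function.surjective_id (collapse_surjective n))
      H.toContinuousMap (by
        rintro ⟨s, v⟩ ⟨t, w⟩ h
        obtain ⟨h1, h2⟩ := Prod.ext_iff.1 h
        obtain rfl : s = t := h1
        rcases collapse_eq h2 with h | h
        · rw [h]
        · have e1 := H.eq_fst s (x := v) h.1
          have e2 := H.eq_fst s (x := w) h.2
          change H (s, v) = H (s, w)
          rw [e1, e2]
          exact congrArg f (collapse_boundary h.1 h.2))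
    refine ⟨f (collapse (n + 1) (diskPole n)), ⟨⟨K, fun v => ?_, fun v => ?_⟩⟩⟩
    · obtain ⟨v, rfl⟩ := collapse_surjective n v
      exact (hK (0, v)).trans (H.apply_zero v)
    · obtain ⟨v, rfl⟩ := collapse_surjective n v
      exact (hK (1, v)).trans (H.apply_one v)

/-! ### Convex bodies -/

/-- After a linear identification with Euclidean space, a compact convex set with interior points is
carried to the unit ball, frontier to sphere. This treats cubes, intervals and cylinders uniformly.
-/
theorem exists_homeomorph_disk {V : Type*} [NormedAddCommGroup V] [NormedSpace ℝ V]
    [FiniteDimensional ℝ V] {n : ℕ} (hn : Module.finrank ℝ V = n) {s : Set V} (hc : Convex ℝ s)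
    (hs : IsCompact s) (hi : (interior s).Nonempty) :
    ∃ e : s ≃ₜ Disk n, ∀ x : s, e x ∈ diskBoundary n ↔ (x : V) ∈ frontier s := by
  let L : V ≃L[ℝ] EuclideanSpace ℝ (Fin n) :=
    ContinuousLinearEquiv.ofFinrankEq (by rw [hn, finrank_euclideanSpace_fin])
  have hLs : Convex ℝ (L '' s) := hc.linear_image (L : V →ₗ[ℝ] EuclideanSpace ℝ (Fin n))
  have hLi : (interior (L '' s)).Nonempty := by
    have := L.toHomeomorph.image_interior s
    change (interior (L.toHomeomorph '' s)).Nonempty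
    rw [← this]
    exact hi.image _
  have hcpt : IsCompact (L '' s) := hs.image L.continuous
  obtain ⟨h, -, h2, h3⟩ := exists_homeomorph_image_interior_closure_frontier_eq_unitBall hLs hLi
    hcpt.isBounded
  rw [hcpt.isClosed.closure_eq] at h2
  let e := L.toHomeomorph.trans h
  have he : e '' s = Metric.closedBall 0 1 := by
    rw [← h2, Set.image_image]
    rfl
  have hf : e '' frontier s = Metric.sphere 0 1 := by
    have h4 : L '' frontier s = frontier (L '' s) := L.toHomeomorph.image_frontier s
    rw [← h3, ← h4, Set.image_image]
    rfl
  refine ⟨(e.image s).trans (Homeomorph.setCongr he), fun x => ?_⟩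
  change ‖e x‖ = 1 ↔ _
  rw [← mem_sphere_zero_iff_norm, ← hf, e.injective.mem_set_image]

/-- Transport of `extendsToDisk_iff_homotopicRel` along a homeomorphism with the disk. -/
theorem homotopicRel_comp_homeomorph {K L Z : Type*} [TopologicalSpace K] [TopologicalSpace L]
    [TopologicalSpace Z] (e : K ≃ₜ L) {A : Set K} {B : Set L} (h : ∀ x, e x ∈ B ↔ x ∈ A)
    {f g : C(L, Z)} :
    (f.comp (e : C(K, L))).HomotopicRel (g.comp (e : C(K, L))) A ↔ f.HomotopicRel g B := by
  constructor
  · rintro ⟨H⟩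
    refine ⟨⟨⟨H.toContinuousMap.comp (ContinuousMap.prodMap (.id I) (e.symm : C(L, K))),
      fun v => ?_, fun v => ?_⟩, fun t v hv => ?_⟩⟩
    · have := H.apply_zero (e.symm v)
      simp at this ⊢
    · have := H.apply_one (e.symm v)
      simp at this ⊢
    · have := H.eq_fst t (x := e.symm v) ((h _).1 (by simpa using hv))
      simpa using this
  · rintro ⟨H⟩
    refine ⟨⟨⟨H.toContinuousMap.comp (ContinuousMap.prodMap (.id I) (e : C(K, L))),
      fun v => ?_, fun v => ?_⟩, fun t v hv => ?_⟩⟩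
    · exact H.apply_zero (e v)
    · exact H.apply_one (e v)
    · exact H.eq_fst t (x := e v) ((h _).2 hv)

theorem exists_cube_homeomorph (n : ℕ) :
    ∃ e : (Fin n → I) ≃ₜ Disk n, ∀ x, e x ∈ diskBoundary n ↔ x ∈ Cube.boundary (Fin n) := by
  let s : Set (Fin n → ℝ) := Set.pi Set.univ (fun _ => Set.Icc 0 1)
  have hint : interior s = Set.pi Set.univ (fun _ => Set.Ioo 0 1) := by
    rw [interior_pi_set Set.finite_univ]
    simp only [interior_Icc]
  obtain ⟨e, he⟩ := exists_homeomorph_disk (n := n) (by simp) (s := s)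
    (convex_pi fun _ _ => convex_Icc _ _) (isCompact_univ_pi fun _ => isCompact_Icc)
    (by rw [hint]; exact ⟨fun _ => 1 / 2, fun _ _ => by norm_num⟩)
  let k : (Fin n → I) ≃ₜ s :=
    { toFun := fun x => ⟨fun i => x i, fun i _ => (x i).2⟩
      invFun := fun y i => ⟨y.1 i, y.2 i trivial⟩
      left_inv := fun x => rfl
      right_inv := fun y => rfl
      continuous_toFun := by fun_prop
      continuous_invFun := continuous_pi fun i =>
        Continuous.subtype_mk ((continuous_apply i).comp continuous_subtype_val) _ }
  refine ⟨k.trans e, fun x => ?_⟩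
  rw [Homeomorph.trans_apply, he, frontier, IsClosed.closure_eq
    (isClosed_set_pi fun _ _ => isClosed_Icc), hint]
  simp only [Set.mem_sdiff, Set.mem_pi, Set.mem_univ, true_implies, Cube.boundary, Set.mem_ofPred_eq]
  constructor
  · rintro ⟨h1, h2⟩
    push Not at h2
    obtain ⟨i, hi⟩ := h2
    refine ⟨i, ?_⟩
    by_contra hc
    push Not at hc
    apply hi
    have h3 := (x i).2
    exact ⟨lt_of_le_of_ne h3.1 fun h => hc.1 (Subtype.ext h.symm),
      lt_of_le_of_ne h3.2 fun h => hc.2 (Subtype.ext h)⟩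
  · rintro ⟨i, hi⟩
    refine ⟨fun j => (x j).2, fun h => ?_⟩
    have h3 := h i
    change (x i : ℝ) ∈ _ at h3
    rcases hi with hi | hi <;> simp [hi] at h3

theorem exists_interval_homeomorph :
    ∃ e : I ≃ₜ Disk 1, ∀ x, e x ∈ diskBoundary 1 ↔ x ∈ ({0, 1} : Set I) := by
  obtain ⟨e, he⟩ := exists_homeomorph_disk (n := 1) (V := ℝ) (by simp) (s := Set.Icc 0 1)
    (convex_Icc _ _) isCompact_Icc (by rw [interior_Icc]; exact ⟨1 / 2, by norm_num⟩)
  refine ⟨e, fun x => ?_⟩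
  rw [he, frontier_Icc zero_le_one, Set.mem_insert_iff, Set.mem_singleton_iff,
    Set.mem_insert_iff, Set.mem_singleton_iff]
  exact or_congr (Subtype.ext_iff (a2 := (0 : I))).symm (Subtype.ext_iff (a2 := (1 : I))).symm

theorem exists_cylinder_homeomorph (n : ℕ) :
    ∃ e : (I × Disk n) ≃ₜ Disk (n + 1), ∀ x, e x ∈ diskBoundary (n + 1) ↔
      (x.1 = 0 ∨ x.1 = 1 ∨ x.2 ∈ diskBoundary n) := by
  let s : Set (ℝ × EuclideanSpace ℝ (Fin n)) := Set.Icc 0 1 ×ˢ Metric.closedBall 0 1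
  have hint : interior s = Set.Ioo 0 1 ×ˢ Metric.ball 0 1 := by
    simp [s, interior_prod_eq, interior_closedBall]
  obtain ⟨e, he⟩ := exists_homeomorph_disk (n := n + 1) (by simp [add_comm]) (s := s)
    ((convex_Icc _ _).prod (convex_closedBall _ _))
    (isCompact_Icc.prod (isCompact_closedBall _ _))
    (by rw [hint]; exact ⟨(1 / 2, 0), by norm_num, by simp⟩)
  let k : (I × Disk n) ≃ₜ s :=
    { toFun := fun x => ⟨(x.1, x.2), x.1.2, x.2.2⟩
      invFun := fun y => (⟨y.1.1, y.2.1⟩, ⟨y.1.2, y.2.2⟩)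
      left_inv := fun x => rfl
      right_inv := fun y => rfl
      continuous_toFun := by fun_prop
      continuous_invFun := by fun_prop }
  refine ⟨k.trans e, fun x => ?_⟩
  rw [Homeomorph.trans_apply, he, frontier, IsClosed.closure_eq
    (isClosed_Icc.prod Metric.isClosed_closedBall), hint]
  have h1 := x.1.2
  have h2 := norm_disk_le x.2
  have hk : (k x : ℝ × EuclideanSpace ℝ (Fin n)) = ((x.1 : ℝ), (x.2 : EuclideanSpace ℝ (Fin n))) := rfl
  rw [hk, Set.mem_sdiff, Set.mem_prod, Set.mem_prod, mem_closedBall_zero_iff, mem_ball_zero_iff]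
  simp only [diskBoundary, Set.mem_ofPred_eq, Subtype.ext_iff, Set.mem_Icc, Set.mem_Ioo,
    Set.Icc.coe_zero, Set.Icc.coe_one]
  constructor
  · rintro ⟨-, h⟩
    by_contra hc
    push Not at hc
    exact h ⟨⟨lt_of_le_of_ne h1.1 (Ne.symm hc.1), lt_of_le_of_ne h1.2 hc.2.1⟩,
      lt_of_le_of_ne h2 hc.2.2⟩
  · intro h
    refine ⟨⟨h1, h2⟩, fun hc => ?_⟩
    rcases h with h | h | h <;> linarith [hc.1.1, hc.1.2, hc.2]

/-! ### Homotopy groups and extension of maps from spheres -/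

/-- A cube relative to its boundary is a disk relative to its boundary, hence a sphere after
collapsing. Because the base point ranges over all of Z, based triviality of the homotopy groups is
the same as free extension of maps from the sphere S^{n+1} = `UnitSphere (n + 2)`. -/
theorem forall_subsingleton_pi_iff {Z : Type*} [TopologicalSpace Z] (n : ℕ) :
    (∀ x : Z, Subsingleton (HomotopyGroup.Pi (n + 1) Z x)) ↔
      ∀ f : C(UnitSphere (n + 2), Z), ExtendsToDisk f := by
  obtain ⟨e, he⟩ := exists_cube_homeomorph (n + 1)
  constructor
  · intro h f
    rw [extendsToDisk_iff_homotopicRel, ← homotopicRel_comp_homeomorph e he]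
    let z := f (collapse (n + 1) (diskPole n))
    let g : GenLoop (Fin (n + 1)) Z z := ⟨(f.comp (collapse (n + 1))).comp e, fun y hy =>
      congrArg f (collapse_boundary ((he y).2 hy) (diskPole_mem n))⟩
    have := @Subsingleton.elim _ (h z) (Quotient.mk _ g : HomotopyGroup (Fin (n + 1)) Z z)
      (Quotient.mk _ GenLoop.const)
    exact Quotient.exact this
  · intro h x
    have key : ∀ g : GenLoop (Fin (n + 1)) Z x, GenLoop.Homotopic g GenLoop.const := by
      intro g
      obtain ⟨f, hf⟩ := exists_comp_collapse ((g : C(Fin (n + 1) → I, Z)).comp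
        (e.symm : C(Disk (n + 1), Fin (n + 1) → I))) (fun v hv w hw => by
          have hv' := g.2 (e.symm v) ((he _).1 (by simpa using hv))
          have hw' := g.2 (e.symm w) ((he _).1 (by simpa using hw))
          exact hv'.trans hw'.symm)
      have h1 := (extendsToDisk_iff_homotopicRel f).1 (h f)
      rw [← homotopicRel_comp_homeomorph e he] at h1
      have hx : f (collapse (n + 1) (diskPole n)) = x := by
        rw [hf]
        exact g.2 _ ((he _).1 (by simpa using diskPole_mem n))
      rw [hx] at h1
      have h2 : (f.comp (collapse (n + 1))).comp (e : C(Fin (n + 1) → I, Disk (n + 1))) = g := by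
        ext y
        simp [hf]
      rw [h2] at h1
      exact h1
    refine ⟨fun a b => ?_⟩
    induction a using Quotient.inductionOn with | h a => 
    induction b using Quotient.inductionOn with | h b =>
    exact Quotient.sound ((key a).trans (key b).symm)

/-- A parametrisation of the circle which identifies the end points of the interval. -/
theorem exists_circle_param : ∃ (p : UnitSphere 2) (c : Path p p),
    (∀ (Z : Type u) [TopologicalSpace Z] (f : C(UnitSphere 2, Z)),
      ExtendsToDisk f ↔ (c.map f.continuous).Homotopic (Path.refl (f p))) ∧
    (∀ (Z : Type u) [TopologicalSpace Z] (x : Z) (γ : Path x x),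
      ∃ f : C(UnitSphere 2, Z), ∀ t, f (c t) = γ t) := by
  obtain ⟨e, he⟩ := exists_interval_homeomorph
  have h0 : e 0 ∈ diskBoundary 1 := (he 0).2 (by simp)
  have h1 : e 1 ∈ diskBoundary 1 := (he 1).2 (by simp)
  refine ⟨collapse 1 (diskPole 0), ⟨(collapse 1).comp (e : C(I, Disk 1)),
    collapse_boundary h0 (diskPole_mem 0), collapse_boundary h1 (diskPole_mem 0)⟩, ?_, ?_⟩
  · intro Z _ f
    rw [extendsToDisk_iff_homotopicRel, ← homotopicRel_comp_homeomorph e he]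
    rfl
  · intro Z _ x γ
    obtain ⟨f, hf⟩ := exists_comp_collapse ((γ : C(I, Z)).comp (e.symm : C(Disk 1, I)))
      (fun v hv w hw => by
        have key : ∀ v ∈ diskBoundary 1, γ (e.symm v) = x := by
          intro v hv
          have : e.symm v ∈ ({0, 1} : Set I) := (he _).1 (by simpa using hv)
          rcases this with h | h
          · rw [h, γ.source]
          · rw [h, γ.target]
        exact (key v hv).trans (key w hw).symm)
    refine ⟨f, fun t => ?_⟩
    refine (hf (e t)).trans ?_
    simp

/-- The boundary of I × D^n is a sphere S^n, covered by the two ends and the side. The three maps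
agree on the overlaps, so they glue to a map of this sphere, which then extends. -/
theorem exists_cylinder_extension {Z : Type*} [TopologicalSpace Z] {n : ℕ}
    (hZ : ∀ f : C(UnitSphere (n + 1), Z), ExtendsToDisk f) (g₀ g₁ : C(Disk n, Z))
    (k : C(I × UnitSphere n, Z)) (h₀ : ∀ v, k (0, v) = g₀ (sphereIncl n v))
    (h₁ : ∀ v, k (1, v) = g₁ (sphereIncl n v)) :
    ∃ F : C(I × Disk n, Z), (∀ v, F (0, v) = g₀ v) ∧ (∀ v, F (1, v) = g₁ v) ∧
      ∀ t v, F (t, sphereIncl n v) = k (t, v) := by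
  obtain ⟨e, he⟩ := exists_cylinder_homeomorph n
  let m : C((Disk n ⊕ Disk n) ⊕ (I × UnitSphere n), I × Disk n) :=
    ⟨Sum.elim (Sum.elim (fun v => (0, v)) (fun v => (1, v))) (fun x => (x.1, sphereIncl n x.2)),
      by
        refine Continuous.sumElim (Continuous.sumElim ?_ ?_) ?_ <;> fun_prop⟩
  have hm : ∀ x, ‖(e (m x) : EuclideanSpace ℝ (Fin (n + 1)))‖ = 1 := by
    intro x
    refine (he (m x)).2 ?_
    rcases x with (v | v) | ⟨t, v⟩
    · exact Or.inl rfl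
    · exact Or.inr (Or.inl rfl)
    · exact Or.inr (Or.inr (norm_sphereIncl v))
  let q : C((Disk n ⊕ Disk n) ⊕ (I × UnitSphere n), UnitSphere (n + 1)) :=
    ⟨fun x => ⟨e (m x), mem_sphere_zero_iff_norm.2 (hm x)⟩, by fun_prop⟩
  let g : C((Disk n ⊕ Disk n) ⊕ (I × UnitSphere n), Z) :=
    ⟨Sum.elim (Sum.elim g₀ g₁) k, by
      refine Continuous.sumElim (Continuous.sumElim ?_ ?_) ?_ <;> fun_prop⟩
  have hq : Function.Surjective q := by
    intro z
    obtain ⟨⟨t, v⟩, hx⟩ := e.surjective (sphereIncl _ z)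
    have hb : e (t, v) ∈ diskBoundary (n + 1) := by rw [hx]; exact norm_sphereIncl z
    have key : ∀ y, m y = (t, v) → q y = z := by
      intro y hy
      apply Subtype.ext
      change (e (m y) : EuclideanSpace ℝ (Fin (n + 1))) = z
      rw [hy, hx]
      rfl
    rcases (he _).1 hb with h | h | h
    · exact ⟨Sum.inl (Sum.inl v), key _ (Prod.ext h.symm rfl)⟩
    · exact ⟨Sum.inl (Sum.inr v), key _ (Prod.ext h.symm rfl)⟩
    · obtain ⟨w, hw⟩ := exists_sphereIncl h
      exact ⟨Sum.inr (t, w), key _ (Prod.ext rfl hw)⟩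
  have hinj : ∀ v w, sphereIncl n v = sphereIncl n w → v = w := fun v w h =>
    Subtype.ext (congrArg (fun x : Disk n => (x : EuclideanSpace ℝ (Fin n))) h)
  obtain ⟨f, hf⟩ := exists_factor q hq g (by
    intro x y hxy
    have h : m x = m y := e.injective (Subtype.ext
      (congrArg (fun x : UnitSphere (n + 1) => (x : EuclideanSpace ℝ (Fin (n + 1)))) hxy))
    rcases x with (v | v) | ⟨t, v⟩ <;> rcases y with (w | w) | ⟨s, w⟩ <;>
      simp only [m, ContinuousMap.coe_mk, Sum.elim_inl, Sum.elim_inr, Prod.mk.injEq] at h <;>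
      obtain ⟨ha, hb⟩ := h <;>
      simp only [g, ContinuousMap.coe_mk, Sum.elim_inl, Sum.elim_inr]
    · rw [hb]
    · exact absurd ha zero_ne_one
    · rw [hb, ← ha, h₀]
    · exact absurd ha one_ne_zero
    · rw [hb]
    · rw [hb, ← ha, h₁]
    · rw [← hb, ha, h₀]
    · rw [← hb, ha, h₁]
    · rw [ha, hinj v w hb])
  obtain ⟨F, hF⟩ := hZ f
  have key : ∀ y, F (e (m y)) = g y := by
    intro y
    rw [← hf y, ← hF]
    rfl
  exact ⟨F.comp (e : C(I × Disk n, Disk (n + 1))), fun v => key (Sum.inl (Sum.inl v)),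
    fun v => key (Sum.inl (Sum.inr v)), fun t v => key (Sum.inr (t, v))⟩

namespace GCWComplex

/-! ### Elementary properties of `G`-CW-complexes -/

variable {G : Type u} [Group G] {X : Type u} [TopologicalSpace X] [MulAction G X]
  (C : GCWComplex G X)

theorem exists_char {n : ℕ} {x : X} (h : x ∈ C.filt (n + 1)) (h' : x ∉ C.filt n) :
    ∃ (i : C.cell n) (c : G ⧸ C.stab n i) (v : Disk n),
      ‖(v : EuclideanSpace ℝ (Fin n))‖ < 1 ∧ C.char n i c v = x := by
  obtain ⟨⟨i, c, v⟩, hv, hx⟩ := (C.char_interior n).surjOn ⟨h, h'⟩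
  exact ⟨i, c, v, hv, hx⟩

theorem char_mem_of_lt {n : ℕ} {i : C.cell n} {c : G ⧸ C.stab n i} {v : Disk n}
    (hv : ‖(v : EuclideanSpace ℝ (Fin n))‖ < 1) :
    C.char n i c v ∈ C.filt (n + 1) \ C.filt n :=
  (C.char_interior n).mapsTo (show (⟨i, c, v⟩ : (i : C.cell n) × ((G ⧸ C.stab n i) × Disk n)) ∈
    {p : (i : C.cell n) × ((G ⧸ C.stab n i) × Disk n) |
      ‖(p.2.2 : EuclideanSpace ℝ (Fin n))‖ < 1} from hv)

theorem char_mem {n : ℕ} (i : C.cell n) (c : G ⧸ C.stab n i) (v : Disk n) :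
    C.char n i c v ∈ C.filt (n + 1) := by
  rcases (norm_disk_le v).lt_or_eq with h | h
  · exact (C.char_mem_of_lt h).1
  · exact C.filt_mono n.le_succ (C.char_boundary n i c v h)

theorem char_mem_filt_iff {n : ℕ} {i : C.cell n} {c : G ⧸ C.stab n i} {v : Disk n} :
    C.char n i c v ∈ C.filt n ↔ ‖(v : EuclideanSpace ℝ (Fin n))‖ = 1 := by
  refine ⟨fun h => ?_, C.char_boundary n i c v⟩
  by_contra h1
  exact (C.char_mem_of_lt (lt_of_le_of_ne (norm_disk_le v) h1)).2 h

theorem char_inj_sigma {n : ℕ} {i j : C.cell n} {c : G ⧸ C.stab n i} {d : G ⧸ C.stab n j}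
    {v w : Disk n} (hv : ‖(v : EuclideanSpace ℝ (Fin n))‖ < 1)
    (h : C.char n i c v = C.char n j d w) :
    (⟨i, c, v⟩ : (i : C.cell n) × ((G ⧸ C.stab n i) × Disk n)) = ⟨j, d, w⟩ := by
  have hw : ‖(w : EuclideanSpace ℝ (Fin n))‖ < 1 := by
    refine lt_of_le_of_ne (norm_disk_le w) fun hw => ?_
    have h1 := C.char_boundary n j d w hw
    rw [← h] at h1
    exact (C.char_mem_of_lt hv).2 h1
  have key := (C.char_interior n).injOn
  exact @key ⟨i, c, v⟩ hv ⟨j, d, w⟩ hw h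

theorem char_inj {n : ℕ} {i : C.cell n} {c d : G ⧸ C.stab n i}
    {v w : Disk n} (hv : ‖(v : EuclideanSpace ℝ (Fin n))‖ < 1)
    (h : C.char n i c v = C.char n i d w) : c = d ∧ v = w := by
  have := C.char_inj_sigma hv h
  simpa using this

theorem exists_char_of_mem {n : ℕ} {x : X} (h : x ∈ C.filt n) :
    ∃ m < n, ∃ (i : C.cell m) (c : G ⧸ C.stab m i) (v : Disk m),
      ‖(v : EuclideanSpace ℝ (Fin m))‖ < 1 ∧ C.char m i c v = x := by
  induction n with
  | zero => simp [C.filt_zero] at h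
  | succ n ih =>
    by_cases h' : x ∈ C.filt n
    · obtain ⟨m, hm, r⟩ := ih h'
      exact ⟨m, by omega, r⟩
    · exact ⟨n, by omega, C.exists_char h h'⟩

theorem exists_mem_filt (x : X) : ∃ n, x ∈ C.filt n := by
  have : x ∈ ⋃ n, C.filt n := by rw [C.iUnion_filt]; trivial
  exact Set.mem_iUnion.1 this

/-- A coset is fixed by a subgroup. -/
def CosetFixed (H : Subgroup G) {K : Subgroup G} (c : G ⧸ K) : Prop := ∀ h ∈ H, h • c = c

variable {C} in
theorem char_mem_fixedPoints {n : ℕ} {i : C.cell n} {c : G ⧸ C.stab n i} {H : Subgroup G}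
    (hc : CosetFixed H c) (v : Disk n) : C.char n i c v ∈ fixedPoints H X := by
  intro h
  change (h : G) • C.char n i c v = _
  rw [← C.char_smul, hc h h.2]

-- The translates of an open cell by different cosets are disjoint. So one H-fixed interior point
-- forces the coset to be H-fixed, and then the whole closed cell lies in X^H.
variable {C} in
theorem cosetFixed_of_char_mem {n : ℕ} {i : C.cell n} {c : G ⧸ C.stab n i} {H : Subgroup G}
    {v : Disk n} (hv : ‖(v : EuclideanSpace ℝ (Fin n))‖ < 1)
    (h : C.char n i c v ∈ fixedPoints H X) : CosetFixed H c := by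
  intro g hg
  have h1 : g • C.char n i c v = C.char n i c v := h ⟨g, hg⟩
  rw [← C.char_smul] at h1
  exact (C.char_inj hv h1.symm).1.symm

theorem cosetFixed_baseCoset (K : Subgroup G) : CosetFixed K (baseCoset K) :=
  fun h hh => smul_baseCoset (⟨h, hh⟩ : K)

theorem continuous_char_filt {n m : ℕ} (hm : m < n) (i : C.cell m) (c : G ⧸ C.stab m i) :
    Continuous fun v => (⟨C.char m i c v, C.filt_mono hm (C.char_mem i c v)⟩ : C.filt n) :=
  (C.char_continuous m i c).subtype_mk _

/-! ### Continuous maps defined on skeleta -/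

section Maps

variable {Z : Type u} [TopologicalSpace Z]

/-- The inclusion of a smaller skeleton into a larger one. -/
def filtIncl {m n : ℕ} (h : m ≤ n) : C(C.filt m, C.filt n) :=
  ⟨Set.inclusion (C.filt_mono h), continuous_inclusion _⟩

/-- The characteristic map of a cell as a map to a skeleton. -/
def charFilt {m n : ℕ} (h : m < n) (i : C.cell m) (c : G ⧸ C.stab m i) : C(Disk m, C.filt n) :=
  ⟨fun v => ⟨C.char m i c v, C.filt_mono h (C.char_mem i c v)⟩, C.continuous_char_filt h i c⟩

theorem isClosed_filt_succ {n : ℕ} {A : Set (C.filt (n + 1))}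
    (h : IsClosed (C.filtIncl n.le_succ ⁻¹' A))
    (h' : ∀ i c, IsClosed (C.charFilt n.lt_succ_self i c ⁻¹' A)) : IsClosed A := by
  have e : ((↑) ⁻¹' (Subtype.val '' A) : Set (C.filt (n + 1))) = A :=
    Set.preimage_image_eq _ Subtype.val_injective
  rw [← e, C.isClosed_succ]
  refine ⟨?_, fun i c => ?_⟩
  · convert h using 1
    ext x
    simp only [Set.mem_preimage, Set.mem_image, Subtype.exists, exists_and_right, exists_eq_right]
    exact ⟨fun ⟨_, hx⟩ => hx, fun hx => ⟨C.filt_mono n.le_succ x.2, hx⟩⟩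
  · convert h' i c using 1
    ext v
    simp only [Set.mem_preimage, Set.mem_image, Subtype.exists, exists_and_right, exists_eq_right]
    exact ⟨fun ⟨_, hx⟩ => hx, fun hx => ⟨C.char_mem i c v, hx⟩⟩

theorem continuous_filt_succ {n : ℕ} {f : C.filt (n + 1) → Z}
    (h : Continuous (f ∘ C.filtIncl n.le_succ))
    (h' : ∀ i c, Continuous (f ∘ C.charFilt n.lt_succ_self i c)) : Continuous f := by
  rw [continuous_iff_isClosed]
  intro B hB
  exact C.isClosed_filt_succ (hB.preimage h) fun i c => hB.preimage (h' i c)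

theorem filt_succ_cases {n : ℕ} {p : C.filt (n + 1) → Prop}
    (h : ∀ x, p (C.filtIncl n.le_succ x))
    (h' : ∀ i c (v : Disk n), ‖(v : EuclideanSpace ℝ (Fin n))‖ < 1 → p (C.charFilt n.lt_succ_self i c v))
    (x) : p x := by
  obtain ⟨x, hx⟩ := x
  by_cases hx' : x ∈ C.filt n
  · exact h ⟨x, hx'⟩
  · obtain ⟨i, c, v, hv, rfl⟩ := C.exists_char hx hx'
    exact h' i c v hv

theorem exists_glue {n : ℕ} (f : C(C.filt n, Z)) (e : ∀ i, G ⧸ C.stab n i → C(Disk n, Z))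
    (h : ∀ i c (v : Disk n) (hv : ‖(v : EuclideanSpace ℝ (Fin n))‖ = 1),
      e i c v = f ⟨C.char n i c v, C.char_boundary n i c v hv⟩) :
    ∃ F : C(C.filt (n + 1), Z), (∀ x, F (C.filtIncl n.le_succ x) = f x) ∧
      ∀ i c v, F (C.charFilt n.lt_succ_self i c v) = e i c v := by
  classical
  have key : ∀ x : C.filt (n + 1), ∃ z : Z, (∀ hx : (x : X) ∈ C.filt n, z = f ⟨x, hx⟩) ∧
      ∀ i c v, C.char n i c v = x → z = e i c v := by
    refine C.filt_succ_cases (fun x => ⟨f x, fun _ => rfl, fun i c v hx => ?_⟩)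
      (fun i c v hv => ⟨e i c v, fun hx => absurd hx (C.char_mem_of_lt hv).2,
        fun j d w hw => ?_⟩)
    · have hv : ‖(v : EuclideanSpace ℝ (Fin n))‖ = 1 := C.char_mem_filt_iff.1 (hx ▸ x.2)
      rw [h i c v hv]
      congr 1
      exact Subtype.ext hx.symm
    · have := C.char_inj_sigma hv hw.symm
      cases this
      rfl
  choose F hF1 hF2 using key
  have h1 : ∀ x, F (C.filtIncl n.le_succ x) = f x := fun x => hF1 _ x.2
  have h2 : ∀ i c v, F (C.charFilt n.lt_succ_self i c v) = e i c v := fun i c v => hF2 _ i c v rfl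
  refine ⟨⟨F, C.continuous_filt_succ ?_ fun i c => ?_⟩, h1, h2⟩
  · exact f.continuous.congr fun x => (h1 x).symm
  · exact (e i c).continuous.congr fun v => (h2 i c v).symm

theorem exists_glue_all (f : ∀ n, C(C.filt n, Z))
    (h : ∀ n x, f (n + 1) (C.filtIncl n.le_succ x) = f n x) :
    ∃ F : C(X, Z), ∀ n (x : C.filt n), F x = f n x := by
  have hle : ∀ m n (hmn : m ≤ n) x, f n (C.filtIncl hmn x) = f m x := by
    intro m n hmn
    induction n, hmn using Nat.le_induction with
    | base => intro x; rfl
    | succ n hmn ih =>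
      intro x
      rw [← ih x]
      exact h n (C.filtIncl hmn x)
  choose N hN using C.exists_mem_filt
  have key : ∀ n (x : C.filt n), f (N x) ⟨x, hN x⟩ = f n x := by
    intro n x
    rcases le_total n (N x) with h1 | h1
    · exact hle n (N x) h1 x
    · exact (hle (N x) n h1 ⟨x, hN x⟩).symm
  refine ⟨⟨fun x => f (N x) ⟨x, hN x⟩, ?_⟩, key⟩
  rw [continuous_iff_isClosed]
  intro B hB
  rw [C.isClosed_iff]
  intro n
  convert hB.preimage (f n).continuous using 1
  ext x
  simp only [Set.mem_preimage, key]

/-- Equivariance of a map on a skeleton. -/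
def FiltEquivariant [MulAction G Z] {n : ℕ} (f : C(C.filt n, Z)) : Prop :=
  ∀ (g : G) (x : C.filt n), f ⟨g • (x : X), C.filt_smul n g x x.2⟩ = g • f x

/-- Only the base copy of each cell G/Hᵢ × D^n is prescribed. Equivariance forces the value g • e on
the copy gHᵢ, and this is well defined because e takes Hᵢ-fixed values. -/
theorem exists_equivariant_glue [MulAction G Z] [ContinuousConstSMul G Z] {n : ℕ}
    (f : C(C.filt n, Z)) (hf : C.FiltEquivariant f) (e : C.cell n → C(Disk n, Z))
    (he : ∀ i v, e i v ∈ fixedPoints (C.stab n i) Z)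
    (h : ∀ i (v : Disk n) (hv : ‖(v : EuclideanSpace ℝ (Fin n))‖ = 1),
      e i v = f ⟨C.char n i (baseCoset _) v, C.char_boundary n i _ v hv⟩) :
    ∃ F : C(C.filt (n + 1), Z), C.FiltEquivariant F ∧
      (∀ x, F (C.filtIncl n.le_succ x) = f x) ∧
      ∀ i, F.comp (C.charFilt n.lt_succ_self i (baseCoset _)) = e i := by
  have hcont : ∀ i (c : G ⧸ C.stab n i),
      Continuous fun v => cosetSMul c (⟨e i v, he i v⟩ : fixedPoints (C.stab n i) Z) := by
    intro i c
    induction c using QuotientGroup.induction_on with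
    | H a => exact (e i).continuous.const_smul a
  have hsmul : ∀ i (g : G), (g : G ⧸ C.stab n i) = g • baseCoset _ := fun i g => by
    change _ = ((g * 1 : G) : G ⧸ C.stab n i)
    rw [mul_one]
  obtain ⟨F, h1, h2⟩ := C.exists_glue f (fun i c => ⟨_, hcont i c⟩) (by
    intro i c v hv
    induction c using QuotientGroup.induction_on with
    | H a =>
      change a • e i v = _
      rw [h i v hv, ← hf]
      congr 1
      apply Subtype.ext
      change a • C.char n i (baseCoset _) v = _
      rw [← C.char_smul, ← hsmul])
  refine ⟨F, ?_, h1, fun i => ?_⟩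
  · intro g
    refine C.filt_succ_cases (fun x => ?_) (fun i c v hv => ?_)
    · rw [h1, ← hf, ← h1]
      rfl
    · rw [h2]
      have : (⟨g • (C.charFilt n.lt_succ_self i c v : X), C.filt_smul (n + 1) g _
          (C.charFilt n.lt_succ_self i c v).2⟩ : C.filt (n + 1))
          = C.charFilt n.lt_succ_self i (g • c) v :=
        Subtype.ext (C.char_smul n i g c v).symm
      rw [this, h2]
      exact cosetSMul_smul g c _
  · ext v
    refine (h2 i _ v).trans ?_
    exact one_smul G (e i v)

/-- Construction of equivariant maps cell by cell: a map satisfying the condition `ok` on every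
cell exists, provided a map satisfying it on all lower cells can be extended over every cell. -/
theorem exists_of_cells [MulAction G Z] [ContinuousConstSMul G Z]
    (ok : ∀ n, C.cell n → C(Disk n, Z) → Prop)
    (h : ∀ n (f : C(C.filt n, Z)), C.FiltEquivariant f →
      (∀ m (hm : m < n) i, ok m i (f.comp (C.charFilt hm i (baseCoset _)))) →
      ∀ i, ∃ e : C(Disk n, Z), (∀ v, e v ∈ fixedPoints (C.stab n i) Z) ∧
        (∀ (v : Disk n) (hv : ‖(v : EuclideanSpace ℝ (Fin n))‖ = 1),
          e v = f ⟨C.char n i (baseCoset _) v, C.char_boundary n i _ v hv⟩) ∧ ok n i e) :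
    ∃ F : C(X, Z), (∀ (g : G) (x : X), F (g • x) = g • F x) ∧
      ∀ n i, ok n i (F.comp ⟨C.char n i (baseCoset _), C.char_continuous n i _⟩) := by
  -- The condition on all lower cells travels with the partial map, since extending over the next
  -- cells depends on it.
  let State (n : ℕ) := {f : C(C.filt n, Z) // C.FiltEquivariant f ∧
    ∀ m (hm : m < n) i, ok m i (f.comp (C.charFilt hm i (baseCoset _)))}
  have step : ∀ n (s : State n), ∃ t : State (n + 1),
      ∀ x, t.1 (C.filtIncl n.le_succ x) = s.1 x := by
    rintro n ⟨f, hf, hok⟩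
    choose e he1 he2 he3 using h n f hf hok
    obtain ⟨F, hF, h1, h2⟩ := C.exists_equivariant_glue f hf e he1 he2
    refine ⟨⟨F, hF, fun m hm i => ?_⟩, h1⟩
    rcases Nat.lt_succ_iff_lt_or_eq.1 hm with hm' | rfl
    · convert hok m hm' i using 1
      ext v
      exact h1 (C.charFilt hm' i (baseCoset _) v)
    · rw [h2]
      exact he3 i
  choose next hnext using step
  have hempty : IsEmpty (C.filt 0) := by rw [C.filt_zero]; infer_instance
  let s₀ : State 0 := ⟨⟨fun x => hempty.elim x, continuous_of_discreteTopology⟩,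
    fun _ x => hempty.elim x, fun m hm => absurd hm m.not_lt_zero⟩
  let s : ∀ n, State n := fun n => Nat.rec s₀ next n
  obtain ⟨F, hF⟩ := C.exists_glue_all (fun n => (s n).1) (fun n x => hnext n (s n) x)
  refine ⟨F, fun g x => ?_, fun n i => ?_⟩
  · obtain ⟨n, hn⟩ := C.exists_mem_filt x
    have h1 := (s n).2.1 g ⟨x, hn⟩
    rw [← hF n ⟨x, hn⟩, ← hF n] at h1
    exact h1
  · convert (s (n + 1)).2.2 n n.lt_succ_self i using 1
    ext v
    exact hF (n + 1) (C.charFilt n.lt_succ_self i (baseCoset _) v)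

end Maps

/-! ### Closed sets and compact sets -/

/-- In a closed n-cell the preimage of x either lies in the boundary sphere, where the induction
hypothesis applies, or has at most one point. -/
theorem isClosed_singleton_filt (x : X) (n : ℕ) : IsClosed {y : C.filt n | (y : X) = x} := by
  induction n with
  | zero =>
    convert isClosed_empty
    ext y
    have := y.2
    simp [C.filt_zero] at this
  | succ n ih =>
    refine C.isClosed_filt_succ ih fun i c => ?_
    have : IsClosed {v : Disk n | C.char n i c v = x} := by
      by_cases hx : x ∈ C.filt n
      · have hs : IsClosed {v : Disk n | ‖(v : EuclideanSpace ℝ (Fin n))‖ = 1} :=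
          isClosed_eq (by fun_prop) continuous_const
        let k : {v : Disk n | ‖(v : EuclideanSpace ℝ (Fin n))‖ = 1} → C.filt n :=
          fun v => ⟨C.char n i c v.1, C.char_boundary n i c v.1 v.2⟩
        have hk : Continuous k := ((C.char_continuous n i c).comp continuous_subtype_val).subtype_mk _
        convert hs.isClosedMap_subtype_val _ (ih.preimage hk) using 1
        ext v
        simp only [Set.mem_preimage, Set.mem_image, Subtype.exists, Set.mem_ofPred_eq,
          exists_and_right, exists_eq_right]
        exact ⟨fun h => ⟨C.char_mem_filt_iff.1 (h ▸ hx), h⟩, fun ⟨_, h⟩ => h⟩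
      · refine Set.Subsingleton.isClosed ?_
        intro v hv w hw
        have h1 : ‖(v : EuclideanSpace ℝ (Fin n))‖ < 1 := by
          refine lt_of_le_of_ne (norm_disk_le v) fun h => hx ?_
          rw [← show C.char n i c v = x from hv]
          exact C.char_boundary n i c v h
        exact (C.char_inj h1 ((show C.char n i c v = x from hv).trans
          (show C.char n i c w = x from hw).symm)).2
    exact this

theorem isClosed_of_finite_inter (A : Set X) (h : ∀ n, (A ∩ C.filt n).Finite) : IsClosed A := by
  rw [C.isClosed_iff]
  intro n
  have : ((↑) ⁻¹' A : Set (C.filt n)) = ⋃ x ∈ A ∩ C.filt n, {y : C.filt n | (y : X) = x} := by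
    ext y
    simp only [Set.mem_preimage, Set.mem_iUnion, Set.mem_ofPred_eq, exists_prop]
    exact ⟨fun hy => ⟨y, ⟨hy, y.2⟩, rfl⟩, fun ⟨x, hx, e⟩ => e ▸ hx.1⟩
  rw [this]
  exact (h n).isClosed_biUnion fun x _ => C.isClosed_singleton_filt x n

/-- Otherwise K contains points x n outside the n-th step. Every tail of this sequence meets each
step in a finite set, so it is closed and compact. The nested tails then have a common point, but a
point of the N-th step is not in the N-th tail. No separation axiom on X is needed. -/
theorem exists_subset_filt {K : Set X} (hK : IsCompact K) : ∃ n, K ⊆ C.filt n := by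
  by_contra! hc
  have hc' : ∀ n, ∃ x ∈ K, x ∉ C.filt n := fun n => Set.not_subset.1 (hc n)
  choose x hxK hx using hc'
  let Q : ℕ → Set X := fun n => x '' Set.Ici n
  have hQ : ∀ n, IsClosed (Q n) := by
    intro n
    refine C.isClosed_of_finite_inter _ fun k => ?_
    refine ((Set.finite_lt_nat k).image x).subset ?_
    rintro _ ⟨⟨m, -, rfl⟩, hm⟩
    refine ⟨m, ?_, rfl⟩
    by_contra hkm
    exact hx m (C.filt_mono (not_lt.1 hkm) hm)
  have hsub : ∀ n, Q n ⊆ K := by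
    rintro n _ ⟨m, -, rfl⟩
    exact hxK m
  obtain ⟨y, hy⟩ := IsCompact.nonempty_iInter_of_sequence_nonempty_isCompact_isClosed Q
    (fun n => Set.image_mono (Set.Ici_subset_Ici.2 n.le_succ))
    (fun n => ⟨x n, n, Set.self_mem_Ici, rfl⟩) (hK.of_isClosed_subset (hQ 0) (hsub 0)) hQ
  obtain ⟨N, hN⟩ := C.exists_mem_filt y
  obtain ⟨m, hm, rfl⟩ := Set.mem_iInter.1 hy N
  exact hx m (C.filt_mono hm hN)

/-- A set of points of the open cells of dimension `n` is open in the `n`-skeleton if its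
preimages in the cells are open. -/
theorem isOpen_filt_succ {n : ℕ} {A : Set (C.filt (n + 1))}
    (h : IsOpen (C.filtIncl n.le_succ ⁻¹' A))
    (h' : ∀ i c, IsOpen (C.charFilt n.lt_succ_self i c ⁻¹' A)) : IsOpen A := by
  rw [← isClosed_compl_iff]
  exact C.isClosed_filt_succ (isClosed_compl_iff.2 h) fun i c => isClosed_compl_iff.2 (h' i c)

/-- The open disk. -/
def openDisk (n : ℕ) : Set (Disk n) := {v | ‖(v : EuclideanSpace ℝ (Fin n))‖ < 1}

theorem isOpen_openDisk (n : ℕ) : IsOpen (openDisk n) :=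
  isOpen_lt (by fun_prop) continuous_const

/-- The characteristic map restricted to the open disk. -/
theorem isOpenEmbedding_char {n : ℕ} (i : C.cell n) (c : G ⧸ C.stab n i) :
    IsOpenEmbedding fun v : openDisk n => C.charFilt n.lt_succ_self i c v.1 := by
  refine IsOpenEmbedding.of_continuous_injective_isOpenMap (by fun_prop) ?_ ?_
  · intro v w h
    exact Subtype.ext (C.char_inj v.2 (congrArg Subtype.val h)).2
  · intro O hO
    have hO' : IsOpen (Subtype.val '' O : Set (Disk n)) := (isOpen_openDisk n).isOpenMap_subtype_val _ hO
    refine C.isOpen_filt_succ ?_ fun j d => ?_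
    · convert isOpen_empty
      rw [Set.eq_empty_iff_forall_notMem]
      rintro x ⟨v, hv, h⟩
      apply (C.char_mem_of_lt (i := i) (c := c) v.2).2
      rw [show C.char n i c v.1 = x from congrArg Subtype.val h]
      exact x.2
    · by_cases hij : (⟨i, c⟩ : (i : C.cell n) × (G ⧸ C.stab n i)) = ⟨j, d⟩
      · cases hij
        convert hO' using 1
        ext w
        constructor
        · rintro ⟨v, hv, h⟩
          rw [← (C.char_inj v.2 (congrArg Subtype.val h)).2]
          exact ⟨v, hv, rfl⟩
        · rintro ⟨v, hv, rfl⟩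
          exact ⟨v, hv, rfl⟩
      · convert isOpen_empty
        rw [Set.eq_empty_iff_forall_notMem]
        rintro w ⟨v, hv, h⟩
        apply hij
        have := C.char_inj_sigma v.2 (congrArg Subtype.val h)
        cases this
        rfl

/-- Open cells are disjoint, so the preimage in every closed n-cell is the concentric ball of radius
r, while the lower skeleton is missed because r < 1. -/
theorem isClosed_iUnion_char_closedBall {n : ℕ} {r : ℝ} (hr : r < 1) :
    IsClosed {x : C.filt (n + 1) | ∃ i c, ∃ v : Disk n,
      ‖(v : EuclideanSpace ℝ (Fin n))‖ ≤ r ∧ C.char n i c v = x} := by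
  refine C.isClosed_filt_succ ?_ fun j d => ?_
  · convert isClosed_empty
    rw [Set.eq_empty_iff_forall_notMem]
    rintro x ⟨i, c, v, hv, h⟩
    apply (C.char_mem_of_lt (i := i) (c := c) (hv.trans_lt hr)).2
    rw [h]
    exact x.2
  · have : IsClosed {v : Disk n | ‖(v : EuclideanSpace ℝ (Fin n))‖ ≤ r} :=
      isClosed_le (by fun_prop) continuous_const
    convert this using 1
    ext w
    constructor
    · rintro ⟨i, c, v, hv, h⟩
      have := C.char_inj_sigma (hv.trans_lt hr) h
      cases this
      exact hv
    · intro hw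
      exact ⟨j, d, w, hw, rfl⟩

theorem isClosed_char_closedBall {n : ℕ} (i : C.cell n) (c : G ⧸ C.stab n i) {r : ℝ}
    (hr : r < 1) : IsClosed {x : C.filt (n + 1) | ∃ v : Disk n,
      ‖(v : EuclideanSpace ℝ (Fin n))‖ ≤ r ∧ C.char n i c v = x} := by
  refine C.isClosed_filt_succ ?_ fun j d => ?_
  · convert isClosed_empty
    rw [Set.eq_empty_iff_forall_notMem]
    rintro x ⟨v, hv, h⟩
    apply (C.char_mem_of_lt (i := i) (c := c) (hv.trans_lt hr)).2
    rw [h]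
    exact x.2
  · have h1 : IsClosed {v : Disk n | ‖(v : EuclideanSpace ℝ (Fin n))‖ ≤ r} :=
      isClosed_le (by fun_prop) continuous_const
    by_cases hij : (⟨i, c⟩ : (i : C.cell n) × (G ⧸ C.stab n i)) = ⟨j, d⟩
    · cases hij
      convert h1 using 1
      ext w
      constructor
      · rintro ⟨v, hv, h⟩
        rw [← (C.char_inj (hv.trans_lt hr) h).2]
        exact hv
      · intro hw
        exact ⟨w, hw, rfl⟩
    · convert isClosed_empty
      rw [Set.eq_empty_iff_forall_notMem]
      rintro w ⟨v, hv, h⟩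
      apply hij
      have := C.char_inj_sigma (hv.trans_lt hr) h
      cases this
      rfl

end GCWComplex

/-! ### Smooth approximation -/

/-- The general position argument. Extend g from B by Tietze and approximate it by a smooth p within
ε/2. A C¹ map does not raise Hausdorff dimension, so the image of K has dimension less than m and
its complement is dense. Subtracting a small vector q outside the image removes the zeros. -/
theorem exists_approx_ne_zero {N m : ℕ} {K : Set (EuclideanSpace ℝ (Fin N))} (hK : IsCompact K)
    (hd : dimH K < m) {B : Set K} (hB : IsClosed B) {g : K → EuclideanSpace ℝ (Fin m)}
    (hg : ContinuousOn g B) {ε : ℝ} (hε : 0 < ε) :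
    ∃ p : C(EuclideanSpace ℝ (Fin N), EuclideanSpace ℝ (Fin m)),
      (∀ x : K, x ∈ B → ‖p x - g x‖ ≤ ε) ∧ ∀ x ∈ K, p x ≠ 0 := by
  have hemb : IsClosedEmbedding fun x : B => ((x : K) : EuclideanSpace ℝ (Fin N)) :=
    (hK.isClosed.isClosedEmbedding_subtypeVal).comp hB.isClosedEmbedding_subtypeVal
  have : TietzeExtension.{0, 0} (EuclideanSpace ℝ (Fin m)) := TietzeExtension.of_tvs ℝ
  obtain ⟨h, hh⟩ := ContinuousMap.exists_extension hemb
    (⟨B.domRestrict g, continuousOn_iff_continuous_domRestrict.1 hg⟩ : C(B, EuclideanSpace ℝ (Fin m)))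
  have hh' : ∀ x : K, x ∈ B → h x = g x := fun x hx =>
    congrArg (fun φ : C(B, EuclideanSpace ℝ (Fin m)) => φ ⟨x, hx⟩) hh
  have hopen : IsOpen {p : C(EuclideanSpace ℝ (Fin N), EuclideanSpace ℝ (Fin m)) |
      Set.MapsTo (p - h) K (Metric.ball 0 (ε / 2))} :=
    (ContinuousMap.isOpen_setOfPred_mapsTo hK Metric.isOpen_ball).preimage
      (continuous_id.sub continuous_const)
  obtain ⟨p, hp, hps⟩ := ContinuousMap.dense_setOfPred_contDiff.inter_open_nonempty _ hopen
    ⟨h, fun x _ => by simp [hε]⟩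
  have hps₀ : ContDiff ℝ ((⊤ : ℕ∞) : WithTop ℕ∞) p := hps
  have hps' : ContDiff ℝ 1 p := hps₀.of_le (by exact_mod_cast le_top)
  have hdim : dimH (p '' K) < Module.finrank ℝ (EuclideanSpace ℝ (Fin m)) := by
    rw [finrank_euclideanSpace_fin]
    exact (hps'.contDiffOn.dimH_image_le convex_univ (Set.subset_univ K)).trans_lt hd
  obtain ⟨q, hq1, hq2⟩ := (dense_compl_of_dimH_lt_finrank hdim).inter_open_nonempty
    (Metric.ball 0 (ε / 2)) Metric.isOpen_ball ⟨0, by simp [hε]⟩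
  refine ⟨p - ContinuousMap.const _ q, fun x hx => ?_, fun x hx h0 => ?_⟩
  · have h1 : ‖p x - h x‖ < ε / 2 := by
      have := hp x.2
      rwa [mem_ball_zero_iff] at this
    rw [mem_ball_zero_iff] at hq1
    rw [← hh' x hx]
    have : (p - ContinuousMap.const (EuclideanSpace ℝ (Fin N)) q) (x : EuclideanSpace ℝ (Fin N)) - h x = (p x - h x) - q := by
      simp only [ContinuousMap.sub_apply, ContinuousMap.const_apply]
      abel
    rw [this]
    linarith [norm_sub_le (p x - h x) q]
  · refine hq2 ⟨x, hx, ?_⟩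
    exact sub_eq_zero.1 h0

/-- Radial projection to the disk. -/
def diskProj (m : ℕ) : C(EuclideanSpace ℝ (Fin m), Disk m) where
  toFun z := ⟨(max 1 ‖z‖)⁻¹ • z, by
    have h : 0 < max 1 ‖z‖ := lt_max_of_lt_left one_pos
    rw [mem_closedBall_zero_iff, norm_smul, norm_inv, Real.norm_of_nonneg h.le,
      inv_mul_le_one₀ h]
    exact le_max_right _ _⟩
  continuous_toFun := by
    have h1 : Continuous fun z : EuclideanSpace ℝ (Fin m) => max 1 ‖z‖ := by fun_prop
    have h2 := h1.inv₀ fun z => (lt_max_of_lt_left one_pos).ne'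
    exact (h2.smul continuous_id).subtype_mk _

theorem diskProj_coe {m : ℕ} (v : Disk m) : diskProj m v = v := by
  ext1
  simp [diskProj, max_eq_left (norm_disk_le v)]

theorem diskProj_ne_zero {m : ℕ} {z : EuclideanSpace ℝ (Fin m)} (hz : z ≠ 0) :
    (diskProj m z : EuclideanSpace ℝ (Fin m)) ≠ 0 := by
  have h : max 1 ‖z‖ ≠ 0 := (lt_max_of_lt_left one_pos).ne'
  simp [diskProj, hz, h]

/-- A cutoff function. -/
def cutoff (r : ℝ) : ℝ := max 0 (min 1 (2 - 3 * r))

theorem continuous_cutoff : Continuous cutoff := by unfold cutoff; fun_prop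

theorem cutoff_nonneg (r : ℝ) : 0 ≤ cutoff r := le_max_left _ _

theorem cutoff_le_one (r : ℝ) : cutoff r ≤ 1 := max_le zero_le_one (min_le_left _ _)

theorem cutoff_eq_zero {r : ℝ} (h : 2 / 3 ≤ r) : cutoff r = 0 :=
  max_eq_left ((min_le_right _ _).trans (by linarith))

theorem cutoff_eq_one {r : ℝ} (h : r ≤ 1 / 3) : cutoff r = 1 := by
  rw [cutoff, min_eq_left (by linarith), max_eq_right zero_le_one]

/-- The radial expansion of the disk which moves the vectors of norm at least `δ` to the
boundary. -/
def radial (m : ℕ) {δ : ℝ} (hδ : 0 < δ) : C(Disk m × I, Disk m) where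
  toFun x := ⟨((1 - (x.2 : ℝ)) + x.2 * (max δ ‖(x.1 : EuclideanSpace ℝ (Fin m))‖)⁻¹) •
      (x.1 : EuclideanSpace ℝ (Fin m)), by
    have h : 0 < max δ ‖(x.1 : EuclideanSpace ℝ (Fin m))‖ := lt_max_of_lt_left hδ
    have h1 : (max δ ‖(x.1 : EuclideanSpace ℝ (Fin m))‖)⁻¹ * ‖(x.1 : EuclideanSpace ℝ (Fin m))‖ ≤ 1 := by
      rw [inv_mul_le_one₀ h]
      exact le_max_right _ _
    have h2 := norm_disk_le x.1
    have h3 := x.2.2.1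
    have h4 := x.2.2.2
    rw [mem_closedBall_zero_iff, norm_smul, Real.norm_of_nonneg (by
      have := inv_pos.2 h
      have := mul_nonneg h3 this.le
      linarith), add_mul, mul_assoc]
    nlinarith [mul_le_mul_of_nonneg_left h1 h3, mul_le_mul_of_nonneg_left h2 (sub_nonneg.2 h4)]⟩
  continuous_toFun := by
    have h1 : Continuous fun x : Disk m × I => max δ ‖(x.1 : EuclideanSpace ℝ (Fin m))‖ := by
      fun_prop
    have h2 := h1.inv₀ fun z => (lt_max_of_lt_left hδ).ne'
    have h3 : Continuous fun x : Disk m × I => (x.2 : ℝ) := by fun_prop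
    have h4 : Continuous fun x : Disk m × I => (x.1 : EuclideanSpace ℝ (Fin m)) := by fun_prop
    exact (((continuous_const.sub h3).add (h3.mul h2)).smul h4).subtype_mk _

theorem radial_zero {m : ℕ} {δ : ℝ} (hδ : 0 < δ) (v : Disk m) : radial m hδ (v, 0) = v := by
  ext1; simp [radial]

theorem radial_boundary {m : ℕ} {δ : ℝ} (hδ : 0 < δ) (hδ' : δ ≤ 1) {v : Disk m}
    (hv : ‖(v : EuclideanSpace ℝ (Fin m))‖ = 1) (t : I) : radial m hδ (v, t) = v := by
  ext1; simp [radial, hv, max_eq_right hδ']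

theorem norm_radial_one {m : ℕ} {δ : ℝ} (hδ : 0 < δ) {v : Disk m}
    (hv : δ ≤ ‖(v : EuclideanSpace ℝ (Fin m))‖) :
    ‖(radial m hδ (v, 1) : EuclideanSpace ℝ (Fin m))‖ = 1 := by
  have h : 0 < ‖(v : EuclideanSpace ℝ (Fin m))‖ := hδ.trans_le hv
  simp [radial, max_eq_right hv, norm_smul, h.ne']

/-! ### Cellular approximation preserving fixed point sets -/

namespace GCWComplex

variable {G : Type u} [Group G] {X : Type u} [TopologicalSpace X] [MulAction G X]
  (C : GCWComplex G X)

theorem exists_coordinate {K : Type*} [TopologicalSpace K] {m : ℕ} (f : C(K, C.filt (m + 1)))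
    (i : C.cell m) (c : G ⧸ C.stab m i) :
    IsOpen {x | ∃ v : Disk m, ‖(v : EuclideanSpace ℝ (Fin m))‖ < 1 ∧ C.char m i c v = f x} ∧
    ∃ W : K → Disk m, ContinuousOn W
      {x | ∃ v : Disk m, ‖(v : EuclideanSpace ℝ (Fin m))‖ < 1 ∧ C.char m i c v = f x} ∧
      ∀ (x : K) (v : Disk m), ‖(v : EuclideanSpace ℝ (Fin m))‖ < 1 → C.char m i c v = f x →
        W x = v := by
  classical
  have hφ := C.isOpenEmbedding_char i c
  set φ : openDisk m → C.filt (m + 1) := fun v => C.charFilt m.lt_succ_self i c v.1 with hφd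
  have hset : {x | ∃ v : Disk m, ‖(v : EuclideanSpace ℝ (Fin m))‖ < 1 ∧ C.char m i c v = f x}
      = f ⁻¹' (Set.range φ) := by
    ext x
    constructor
    · rintro ⟨v, hv, h⟩
      exact ⟨⟨v, hv⟩, Subtype.ext h⟩
    · rintro ⟨v, h⟩
      exact ⟨v.1, v.2, congrArg Subtype.val h⟩
  rw [hset]
  refine ⟨hφ.isOpen_range.preimage f.continuous, ?_⟩
  let e := hφ.toIsEmbedding.toHomeomorph
  refine ⟨fun x => if h : f x ∈ Set.range φ then (e.symm ⟨f x, h⟩).1 else ⟨0, by simp⟩, ?_, ?_⟩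
  · rw [continuousOn_iff_continuous_domRestrict]
    have : Continuous fun x : f ⁻¹' (Set.range φ) => (e.symm ⟨f x, x.2⟩).1 := by fun_prop
    refine this.congr fun x => ?_
    have hx : f x ∈ Set.range φ := x.2
    simp only [Set.domRestrict_apply, hx, dif_pos]
  · intro x v hv h
    have hx : f x = φ ⟨v, hv⟩ := Subtype.ext h.symm
    have hx' : f x ∈ Set.range φ := ⟨_, hx.symm⟩
    simp only [hx', dif_pos]
    have : (⟨f x, hx'⟩ : Set.range φ) = e ⟨v, hv⟩ := Subtype.ext hx
    rw [this, e.symm_apply_apply]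

/-- The homotopies considered for cellular approximation: stationary where the map already
takes values in the `k`-th step of the filtration, and preserving fixed point sets. -/
def Controlled {K : Type} [TopologicalSpace K] (k : ℕ) (f g : C(K, X)) : Prop :=
  (∀ x, f x ∈ C.filt k → g x = f x) ∧
    ∀ (H : Subgroup G) (x : K), f x ∈ fixedPoints H X → g x ∈ fixedPoints H X

/-- In every m-cell the coordinate of f is moved linearly towards a nowhere vanishing approximation,
weighted by a cutoff that vanishes near the boundary of the cell. The approximations are chosen
independently in all cells and no equivariance is asked for. Fixed points are preserved since each
point stays in its closed cell. -/
theorem exists_avoid_centers {N m : ℕ} {K : Set (EuclideanSpace ℝ (Fin N))} (hK : IsCompact K)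
    (hd : dimH K < m) (f : C(K, C.filt (m + 1))) :
    ∃ F : C(I × K, C.filt (m + 1)), (∀ x, F (0, x) = f x) ∧
      (∀ t x, (f x : X) ∈ C.filt m → F (t, x) = f x) ∧
      (∀ i c x (v : Disk m), (v : EuclideanSpace ℝ (Fin m)) = 0 → C.char m i c v ≠ F (1, x)) ∧
      ∀ (H : Subgroup G) (x : K), (f x : X) ∈ fixedPoints H X → ∀ t,
        (F (t, x) : X) ∈ fixedPoints H X := by
  have hcoord := fun i c => C.exists_coordinate f i c
  choose hU W hW hWv using hcoord
  have happ : ∀ (i : C.cell m) (c : G ⧸ C.stab m i),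
      ∃ p : C(EuclideanSpace ℝ (Fin N), EuclideanSpace ℝ (Fin m)),
      (∀ (x : K) (v : Disk m), ‖(v : EuclideanSpace ℝ (Fin m))‖ ≤ 2 / 3 → C.char m i c v = f x →
        ‖p x - (v : EuclideanSpace ℝ (Fin m))‖ ≤ 1 / 6) ∧ ∀ x ∈ K, p x ≠ 0 := by
    intro i c
    obtain ⟨p, hp1, hp2⟩ := exists_approx_ne_zero hK hd
      (B := {x : K | ∃ v : Disk m, ‖(v : EuclideanSpace ℝ (Fin m))‖ ≤ 2 / 3 ∧
        C.char m i c v = f x})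
      ((C.isClosed_char_closedBall i c (by norm_num)).preimage f.continuous)
      (g := fun x => (W i c x : EuclideanSpace ℝ (Fin m)))
      (continuous_subtype_val.comp_continuousOn ((hW i c).mono (by
        rintro x ⟨v, hv, h⟩
        exact ⟨v, by linarith, h⟩))) (ε := 1 / 6) (by norm_num)
    refine ⟨p, fun x v hv h => ?_, hp2⟩
    have := hp1 x ⟨v, hv, h⟩
    rwa [hWv i c x v (by linarith) h] at this
  choose p hp hp0 using happ
  -- The point with coordinate v at time t moves to v + t·cutoff(‖v‖)·(p(x) − v), projected back to
  -- the disk.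
  let μ : ∀ (i : C.cell m) (c : G ⧸ C.stab m i), C(I × K × Disk m, Disk m) := fun i c =>
    (diskProj m).comp ⟨fun y => (y.2.2 : EuclideanSpace ℝ (Fin m)) +
      ((y.1 : ℝ) * cutoff ‖(y.2.2 : EuclideanSpace ℝ (Fin m))‖) •
        (p i c (y.2.1 : EuclideanSpace ℝ (Fin N)) - (y.2.2 : EuclideanSpace ℝ (Fin m))), by
      have := continuous_cutoff
      fun_prop⟩
  have key : ∀ y : I × K, ∃ z : C.filt (m + 1), ((f y.2 : X) ∈ C.filt m → z = f y.2) ∧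
      ∀ i c (v : Disk m), ‖(v : EuclideanSpace ℝ (Fin m))‖ < 1 → C.char m i c v = f y.2 →
        z = C.charFilt m.lt_succ_self i c (μ i c (y.1, y.2, v)) := by
    intro y
    by_cases h : (f y.2 : X) ∈ C.filt m
    · refine ⟨f y.2, fun _ => rfl, fun i c v hv hx => ?_⟩
      exact absurd (hx ▸ h) (C.char_mem_of_lt hv).2
    · obtain ⟨i, c, v, hv, hx⟩ := C.exists_char (f y.2).2 h
      refine ⟨C.charFilt m.lt_succ_self i c (μ i c (y.1, y.2, v)), fun h' => absurd h' h,
        fun j d w hw hx' => ?_⟩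
      have := C.char_inj_sigma hv (hx.trans hx'.symm)
      cases this
      rfl
  choose F hF1 hF2 using key
  have hstat : ∀ y : I × K, (∀ i c (v : Disk m), ‖(v : EuclideanSpace ℝ (Fin m))‖ ≤ 2 / 3 →
      C.char m i c v ≠ f y.2) → F y = f y.2 := by
    intro y hy
    by_cases h : (f y.2 : X) ∈ C.filt m
    · exact hF1 y h
    · obtain ⟨i, c, v, hv, hx⟩ := C.exists_char (f y.2).2 h
      have hv' : 2 / 3 < ‖(v : EuclideanSpace ℝ (Fin m))‖ := by
        by_contra hc
        exact hy i c v (not_lt.1 hc) hx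
      rw [hF2 y i c v hv hx]
      apply Subtype.ext
      refine Eq.trans ?_ hx
      change C.char m i c _ = _
      congr 1
      simp only [μ, ContinuousMap.comp_apply, ContinuousMap.coe_mk, cutoff_eq_zero hv'.le,
        mul_zero, zero_smul, add_zero]
      exact diskProj_coe v
  have hcont : Continuous F := by
    rw [continuous_iff_continuousAt]
    rintro ⟨t, x⟩
    by_cases h : (f x : X) ∈ C.filt m
    -- Near a point sent to the lower skeleton no coordinate of f has norm at most 2/3, so the
    -- cutoff vanishes and F agrees locally with f.
    · have hO : IsOpen {y : I × K | ¬ ∃ i c, ∃ v : Disk m,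
          ‖(v : EuclideanSpace ℝ (Fin m))‖ ≤ 2 / 3 ∧ C.char m i c v = f y.2} :=
        ((C.isClosed_iUnion_char_closedBall (n := m) (r := 2 / 3) (by norm_num)).preimage
          (f.continuous.comp continuous_snd)).isOpen_compl
      have hmem : (t, x) ∈ {y : I × K | ¬ ∃ i c, ∃ v : Disk m,
          ‖(v : EuclideanSpace ℝ (Fin m))‖ ≤ 2 / 3 ∧ C.char m i c v = f y.2} := by
        rintro ⟨i, c, v, hv, hx⟩
        exact (C.char_mem_of_lt (i := i) (c := c) (v := v) (by linarith)).2 (hx ▸ h)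
      refine ContinuousAt.congr (f := fun y : I × K => f y.2) (by fun_prop) ?_
      filter_upwards [hO.mem_nhds hmem] with y hy
      exact (hstat y fun i c v hv hx => hy ⟨i, c, v, hv, hx⟩).symm
    · obtain ⟨i, c, v, hv, hx⟩ := C.exists_char (f x).2 h
      have hO := hU i c
      have hcon : ContinuousOn (fun y : I × K =>
          C.charFilt m.lt_succ_self i c (μ i c (y.1, y.2, W i c y.2)))
          (Prod.snd ⁻¹' {x | ∃ v : Disk m, ‖(v : EuclideanSpace ℝ (Fin m))‖ < 1 ∧
            C.char m i c v = f x}) := by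
        refine (ContinuousMap.continuous _).comp_continuousOn
          ((ContinuousMap.continuous _).comp_continuousOn ?_)
        refine continuous_fst.continuousOn.prodMk (continuous_snd.continuousOn.prodMk ?_)
        exact (hW i c).comp continuous_snd.continuousOn fun y hy => hy
      have hmem := (hO.preimage (continuous_snd (X := I))).mem_nhds
        (show (t, x) ∈ _ from ⟨v, hv, hx⟩)
      refine ContinuousAt.congr (hcon.continuousAt hmem) ?_
      filter_upwards [hmem] with y hy
      obtain ⟨w, hw, hwx⟩ := hy
      rw [hF2 y i c w hw hwx, hWv i c y.2 w hw hwx]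
  refine ⟨⟨F, hcont⟩, fun x => ?_, fun t x hx => hF1 (t, x) hx, fun i c x v hv => ?_,
    fun H x hx t => ?_⟩
  · by_cases h : (f x : X) ∈ C.filt m
    · exact hF1 (0, x) h
    · obtain ⟨i, c, v, hv, hx⟩ := C.exists_char (f x).2 h
      refine (hF2 (0, x) i c v hv hx).trans (Subtype.ext (Eq.trans ?_ hx))
      change C.char m i c _ = _
      congr 1
      simp only [μ, ContinuousMap.comp_apply, ContinuousMap.coe_mk, Set.Icc.coe_zero, zero_mul,
        zero_smul, add_zero]
      exact diskProj_coe v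
  · have hv1 : ‖(v : EuclideanSpace ℝ (Fin m))‖ < 1 := by simp [hv]
    intro heq
    by_cases h : (f x : X) ∈ C.filt m
    · have h1 : F (1, x) = f x := hF1 (1, x) h
      apply (C.char_mem_of_lt (i := i) (c := c) hv1).2
      rw [heq]
      change (F (1, x) : X) ∈ _
      rwa [h1]
    · obtain ⟨j, d, w, hw, hx⟩ := C.exists_char (f x).2 h
      have h1 := hF2 (1, x) j d w hw hx
      have h2 : C.char m i c v = C.char m j d (μ j d (1, x, w)) :=
        heq.trans (congrArg Subtype.val h1)
      have h3 := C.char_inj_sigma hv1 h2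
      simp only [Sigma.mk.injEq] at h3
      obtain ⟨rfl, h3⟩ := h3
      have h4 := (Prod.ext_iff.1 (eq_of_heq h3)).2
      simp only at h4
      rw [h4] at hv
      revert hv
      refine diskProj_ne_zero ?_
      simp only [ContinuousMap.coe_mk, Set.Icc.coe_one, one_mul]
      -- For ‖w‖ ≤ 1/3 the end point is p(x) ≠ 0. For ‖w‖ ≥ 2/3 it is w itself. In between, w moves
      -- by at most 1/6 and has norm above 1/3, so it cannot reach 0.
      rcases le_or_gt ‖(w : EuclideanSpace ℝ (Fin m))‖ (1 / 3) with hw3 | hw3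
      · rw [cutoff_eq_one hw3, one_smul, add_sub_cancel]
        exact hp0 i d x x.2
      · rcases le_or_gt (2 / 3) ‖(w : EuclideanSpace ℝ (Fin m))‖ with hw2 | hw2
        · rw [cutoff_eq_zero hw2, zero_smul, add_zero]
          intro h0
          rw [h0, norm_zero] at hw3
          linarith
        · intro h0
          have h5 := hp i d x w hw2.le hx
          have h6 := congrArg norm (eq_neg_of_add_eq_zero_left h0)
          rw [norm_neg, norm_smul, Real.norm_of_nonneg (cutoff_nonneg _)] at h6
          have h7 := cutoff_le_one ‖(w : EuclideanSpace ℝ (Fin m))‖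
          nlinarith [norm_nonneg (p i d x - (w : EuclideanSpace ℝ (Fin m))),
            cutoff_nonneg ‖(w : EuclideanSpace ℝ (Fin m))‖]
  · by_cases h : (f x : X) ∈ C.filt m
    · change (F (t, x) : X) ∈ _
      rw [hF1 (t, x) h]
      exact hx
    · obtain ⟨i, c, v, hv, hvx⟩ := C.exists_char (f x).2 h
      change (F (t, x) : X) ∈ _
      rw [hF2 (t, x) i c v hv hvx]
      rw [← hvx] at hx
      exact char_mem_fixedPoints (cosetFixed_of_char_mem hv hx) _

/-- The map from a skeleton to the space of paths given by a radial expansion of all cells of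
top dimension. -/
theorem exists_radial {m : ℕ} (δ : ∀ i, G ⧸ C.stab m i → ℝ) (hδ : ∀ i c, 0 < δ i c)
    (hδ' : ∀ i c, δ i c ≤ 1) :
    ∃ r : C(C.filt (m + 1), C(I, X)), (∀ (x : C.filt (m + 1)) t, (x : X) ∈ C.filt m → r x t = x) ∧
      (∀ x, r x 0 = x) ∧
      ∀ i c v t, r (C.charFilt m.lt_succ_self i c v) t
        = C.char m i c (radial m (hδ i c) (v, t)) := by
  obtain ⟨r, hr1, hr2⟩ := C.exists_glue (Z := C(I, X))
    (ContinuousMap.const'.comp ⟨Subtype.val, continuous_subtype_val⟩)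
    (fun i c => (ContinuousMap.comp ⟨C.char m i c, C.char_continuous m i c⟩
      (radial m (hδ i c))).curry) (fun i c v hv => by
        ext t
        simp [radial_boundary (hδ i c) (hδ' i c) hv])
  have h2 : ∀ i c v t, r (C.charFilt m.lt_succ_self i c v) t
        = C.char m i c (radial m (hδ i c) (v, t)) := fun i c v t => by rw [hr2]; rfl
  have h1 : ∀ (x : C.filt (m + 1)) t, (x : X) ∈ C.filt m → r x t = x := fun x t hx => by
    rw [show x = C.filtIncl m.le_succ ⟨x, hx⟩ from rfl, hr1]
    rfl
  refine ⟨r, h1, ?_, h2⟩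
  refine C.filt_succ_cases (fun x => h1 _ _ x.2) fun i c v hv => ?_
  rw [h2, radial_zero]
  rfl

/-- Once the centres of the m-cells are avoided, compactness of K bounds the coordinates in each
cell away from 0 by some δ. The radial expansion that moves all vectors of norm at least δ to the
boundary then ends in the lower skeleton. -/
theorem exists_push {N m : ℕ} {K : Set (EuclideanSpace ℝ (Fin N))} (hK : IsCompact K)
    (hd : dimH K < m) (f : C(K, X)) (hf : ∀ x, f x ∈ C.filt (m + 1)) :
    ∃ g : C(K, X), f.HomotopicWith g (C.Controlled m f) ∧ ∀ x, g x ∈ C.filt m := by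
  have : CompactSpace K := isCompact_iff_compactSpace.1 hK
  let f' : C(K, C.filt (m + 1)) := ⟨fun x => ⟨f x, hf x⟩, by fun_prop⟩
  obtain ⟨F, hF0, hFm, hFc, hFH⟩ := C.exists_avoid_centers hK hd f'
  let f₁ : C(K, C.filt (m + 1)) := ⟨fun x => F (1, x), by fun_prop⟩
  have hδ : ∀ i c, ∃ δ : ℝ, 0 < δ ∧ δ ≤ 1 ∧ ∀ x (v : Disk m), C.char m i c v = f₁ x →
      δ ≤ ‖(v : EuclideanSpace ℝ (Fin m))‖ := by
    intro i c
    obtain ⟨hU, W, hW, hWv⟩ := C.exists_coordinate f₁ i c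
    let B : Set K := {x | ∃ v : Disk m, ‖(v : EuclideanSpace ℝ (Fin m))‖ ≤ 1 / 2 ∧
      C.char m i c v = f₁ x}
    have hB : IsCompact B := ((C.isClosed_char_closedBall i c (r := 1 / 2) (by norm_num)).preimage
      f₁.continuous).isCompact
    rcases B.eq_empty_or_nonempty with hBe | hBn
    -- If no coordinate in this cell has norm at most 1/2, then 1/2 is itself a lower bound.
    · refine ⟨1 / 2, by norm_num, by norm_num, fun x v hv => ?_⟩
      by_contra h
      have : x ∈ B := ⟨v, (not_le.1 h).le, hv⟩
      rw [hBe] at this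
      exact this
    · obtain ⟨x₀, ⟨v₀, hv₀, hx₀⟩, hmin⟩ := hB.exists_isMinOn hBn
        (f := fun x => ‖(W x : EuclideanSpace ℝ (Fin m))‖)
        ((continuous_norm.comp continuous_subtype_val).comp_continuousOn (hW.mono (by
          rintro x ⟨v, hv, h⟩
          exact ⟨v, by linarith, h⟩)))
      refine ⟨‖(v₀ : EuclideanSpace ℝ (Fin m))‖, ?_, by linarith, fun x v hv => ?_⟩
      · rw [norm_pos_iff]
        exact fun h => hFc i c x₀ v₀ h hx₀
      · by_contra h
        push Not at h
        have h1 : x ∈ B := ⟨v, h.le.trans hv₀, hv⟩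
        have h2 := hmin h1
        simp only [Set.mem_ofPred_eq] at h2
        rw [hWv x v (by linarith) hv, hWv x₀ v₀ (by linarith) hx₀] at h2
        linarith
  choose δ hδ0 hδ1 hδ2 using hδ
  obtain ⟨r, hr1, hr0, hr2⟩ := C.exists_radial δ hδ0 hδ1
  have hfm : ∀ x, f x ∈ C.filt m → (f₁ x : X) = f x := fun x hx =>
    congrArg Subtype.val (hFm 1 x hx)
  let R : C(I × K, X) := ⟨fun y => r (f₁ y.2) y.1, by fun_prop⟩
  let mid : C(K, X) := ⟨fun x => (f₁ x : X), by fun_prop⟩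
  let g : C(K, X) := ⟨fun x => R (1, x), by fun_prop⟩
  have h1 : f.HomotopicWith mid (C.Controlled m f) := by
    refine ⟨⟨⟨⟨fun y => (F y : X), by fun_prop⟩, fun x => ?_, fun x => rfl⟩, fun t => ⟨?_, ?_⟩⟩⟩
    · exact congrArg Subtype.val (hF0 x)
    · intro x hx
      exact congrArg Subtype.val (hFm t x hx)
    · intro H x hx
      exact hFH H x hx t
  have h2 : mid.HomotopicWith g (C.Controlled m f) := by
    refine ⟨⟨⟨R, fun x => hr0 (f₁ x), fun x => rfl⟩, fun t => ⟨?_, ?_⟩⟩⟩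
    · intro x hx
      refine (hr1 (f₁ x) t ?_).trans (hfm x hx)
      rw [hfm x hx]
      exact hx
    · intro H x hx
      have h3 : (f₁ x : X) ∈ fixedPoints H X := hFH H x hx 1
      change r (f₁ x) t ∈ _
      revert h3
      generalize f₁ x = y
      revert y
      refine C.filt_succ_cases (fun y h3 => ?_) (fun i c v hv h3 => ?_)
      · rw [hr1 _ _ y.2]
        exact h3
      · rw [hr2]
        exact char_mem_fixedPoints (cosetFixed_of_char_mem hv h3) _
  refine ⟨g, h1.trans h2, fun x => ?_⟩
  change r (f₁ x) 1 ∈ _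
  have h3 := fun i c v => hδ2 i c x v
  revert h3
  generalize f₁ x = y
  revert y
  refine C.filt_succ_cases (fun y h3 => ?_) (fun i c v hv h3 => ?_)
  · rw [hr1 _ _ y.2]
    exact y.2
  · rw [hr2]
    exact C.char_boundary _ _ _ _ (norm_radial_one (hδ0 i c) (h3 i c v rfl))

theorem Controlled.mono {K : Type} [TopologicalSpace K] {k m : ℕ} (h : k ≤ m) {f g : C(K, X)}
    (hg : C.Controlled m f g) : C.Controlled k f g :=
  ⟨fun x hx => hg.1 x (C.filt_mono h hx), hg.2⟩

/-- Cellular approximation. -/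
theorem exists_cellular_approx {N k : ℕ} {K : Set (EuclideanSpace ℝ (Fin N))} (hK : IsCompact K)
    (hd : dimH K < k) (f : C(K, X)) :
    ∃ g : C(K, X), f.HomotopicWith g (C.Controlled k f) ∧ ∀ x, g x ∈ C.filt k := by
  have : CompactSpace K := isCompact_iff_compactSpace.1 hK
  have key : ∀ n, k ≤ n → ∀ f : C(K, X), (∀ x, f x ∈ C.filt n) →
      ∃ g : C(K, X), f.HomotopicWith g (C.Controlled k f) ∧ ∀ x, g x ∈ C.filt k := by
    intro n hn
    induction n, hn using Nat.le_induction with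
    | base =>
      intro f hf
      exact ⟨f, ContinuousMap.HomotopicWith.refl f ⟨fun _ _ => rfl, fun _ _ h => h⟩, hf⟩
    | succ n hn ih =>
      intro f hf
      obtain ⟨g, ⟨hg⟩, hg'⟩ := C.exists_push hK (hd.trans_le (by exact_mod_cast hn)) f hf
      obtain ⟨g', ⟨hh⟩, hh'⟩ := ih g hg'
      have hg1 : C.Controlled k f g := by
        have := hg.prop' 1
        have e : (⟨fun x => hg.toFun (1, x), hg.continuous_toFun.comp (by fun_prop)⟩ : C(K, X)) = g := by
          ext x
          exact hg.apply_one x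
        rw [← e]
        exact (this.mono C hn)
      refine ⟨g', ContinuousMap.HomotopicWith.trans (g := g) ⟨⟨hg.toHomotopy, fun t => (hg.prop' t).mono C hn⟩⟩
        ⟨⟨hh.toHomotopy, fun t => ⟨fun x hx => ?_, fun H x hx => ?_⟩⟩⟩, hh'⟩
      · have h1 := (hh.prop' t).1 x (by rw [hg1.1 x hx]; exact hx)
        exact h1.trans (hg1.1 x hx)
      · exact (hh.prop' t).2 H x (hg1.2 H x hx)
  -- The compact image lies in a finite skeleton, so finitely many pushes suffice.
  obtain ⟨n, hn⟩ := C.exists_subset_filt (isCompact_range f.continuous)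
  exact key (max n k) (le_max_right _ _) f fun x =>
    C.filt_mono (le_max_left _ _) (hn (Set.mem_range_self x))

/-- A controlled homotopy never leaves X^H once it starts there, so the approximation takes place
inside X^H, without a separate cell structure on X^H. -/
theorem exists_cellular_approx_fixedPoints {N k : ℕ} {K : Set (EuclideanSpace ℝ (Fin N))}
    (hK : IsCompact K) (hd : dimH K < k) {H : Subgroup G} (f : C(K, fixedPoints H X)) :
    ∃ g : C(K, fixedPoints H X), f.HomotopicRel g {x | (f x : X) ∈ C.filt k} ∧
      ∀ x, (g x : X) ∈ C.filt k := by
  obtain ⟨g, ⟨F⟩, hg⟩ := C.exists_cellular_approx hK hd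
    ((⟨Subtype.val, continuous_subtype_val⟩ : C(fixedPoints H X, X)).comp f)
  have hF : ∀ y : I × K, F y ∈ fixedPoints H X := fun y => (F.prop' y.1).2 H y.2 (f y.2).2
  have hg1 : ∀ x, g x ∈ fixedPoints H X := fun x => by
    have := hF (1, x)
    rwa [F.apply_one] at this
  refine ⟨⟨fun x => ⟨g x, hg1 x⟩, by fun_prop⟩, ⟨⟨⟨⟨fun y => ⟨F y, hF y⟩, by fun_prop⟩,
    fun x => ?_, fun x => ?_⟩, fun t x hx => ?_⟩⟩, hg⟩
  · exact Subtype.ext (F.apply_zero x)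
  · exact Subtype.ext (F.apply_one x)
  · exact Subtype.ext ((F.prop' t).1 x hx)

end GCWComplex

/-! ### Dimension of disks and spheres -/

theorem dimH_disk_lt (n : ℕ) :
    dimH (Metric.closedBall (0 : EuclideanSpace ℝ (Fin n)) 1) < (n + 1 : ℕ) := by
  refine ((dimH_mono (Set.subset_univ _)).trans_eq (Real.dimH_univ_eq_finrank _)).trans_lt ?_
  rw [finrank_euclideanSpace_fin]
  exact_mod_cast n.lt_succ_self

/-- Apart from one point the sphere is the smooth image, under inverse stereographic projection, of
a hyperplane of dimension n. -/
theorem dimH_sphere_lt (n : ℕ) :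
    dimH (Metric.sphere (0 : EuclideanSpace ℝ (Fin (n + 1))) 1) < (n + 1 : ℕ) := by
  let v : EuclideanSpace ℝ (Fin (n + 1)) := EuclideanSpace.single 0 1
  have hv : ‖v‖ = 1 := by simp [v]
  let φ : (Submodule.span ℝ {v})ᗮ → EuclideanSpace ℝ (Fin (n + 1)) := fun w => stereoInvFunAux v w
  have hφ : ContDiff ℝ 1 φ := contDiff_stereoInvFunAux.comp (Submodule.subtypeL (Submodule.span ℝ {v})ᗮ).contDiff
  have hsub : Metric.sphere (0 : EuclideanSpace ℝ (Fin (n + 1))) 1 ⊆ Set.range φ ∪ {v} := by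
    intro x hx
    by_cases hxv : x = v
    · exact Or.inr hxv
    · left
      have := stereo_left_inv hv (x := ⟨x, hx⟩) (by simpa using hxv)
      exact ⟨_, congrArg Subtype.val this⟩
  have hfin : Fact (Module.finrank ℝ (EuclideanSpace ℝ (Fin (n + 1))) = n + 1) :=
    ⟨finrank_euclideanSpace_fin⟩
  refine (dimH_mono hsub).trans_lt ?_
  rw [dimH_union, dimH_singleton]
  refine max_lt ?_ (by exact_mod_cast n.succ_pos)
  refine hφ.dimH_range_le.trans_lt ?_
  rw [Submodule.finrank_orthogonal_span_singleton (n := n) (by rw [← norm_ne_zero_iff, hv]; exact one_ne_zero)]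
  exact_mod_cast n.lt_succ_self

/-! ### The fundamental groupoid of the `1`-skeleton is generated by the edges -/

instance diskContractible (n : ℕ) : ContractibleSpace (Disk n) :=
  (convex_closedBall _ _).contractibleSpace ⟨0, by simp⟩

instance unitIntervalContractible : ContractibleSpace I :=
  (convex_Icc (0 : ℝ) 1).contractibleSpace ⟨0, by simp⟩

theorem mk_path_const {Z : Type*} [TopologicalSpace Z] {z w : Z} (a : Path z w)
    (h : ∀ t, a t = z) (hz : FundamentalGroupoid.mk z = .mk w) :
    (FundamentalGroupoid.fromPath (Path.Homotopic.Quotient.mk a) :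
      FundamentalGroupoid.mk z ⟶ FundamentalGroupoid.mk w) = eqToHom hz := by
  obtain rfl : z = w := congrArg FundamentalGroupoid.as hz
  obtain rfl : a = Path.refl z := Path.ext (funext h)
  rfl

theorem mk_path_eq {Z : Type*} [TopologicalSpace Z] {z w z' w' : Z} (a : Path z w)
    (b : Path z' w') (h : ∀ t, a t = b t) (hz : FundamentalGroupoid.mk z = .mk z')
    (hw : FundamentalGroupoid.mk w' = .mk w) :
    (FundamentalGroupoid.fromPath (Path.Homotopic.Quotient.mk a) :
      FundamentalGroupoid.mk z ⟶ FundamentalGroupoid.mk w) =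
    eqToHom hz ≫ FundamentalGroupoid.fromPath (Path.Homotopic.Quotient.mk b) ≫ eqToHom hw := by
  obtain rfl : z = z' := congrArg FundamentalGroupoid.as hz
  obtain rfl : w' = w := congrArg FundamentalGroupoid.as hw
  obtain rfl : a = b := Path.ext (funext h)
  simp

/-- The homotopy class of paths between two points of a simply connected space. -/
def simplePath {Z : Type*} [TopologicalSpace Z] [SimplyConnectedSpace Z] (v w : Z) :
    FundamentalGroupoid.mk v ⟶ FundamentalGroupoid.mk w :=
  FundamentalGroupoid.fromPath (Path.Homotopic.Quotient.mk (PathConnectedSpace.somePath v w))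

instance {Z : Type*} [TopologicalSpace Z] [SimplyConnectedSpace Z] (v w : FundamentalGroupoid Z) :
    Subsingleton (v ⟶ w) :=
  inferInstanceAs (Subsingleton (Path.Homotopic.Quotient v.as w.as))

theorem inv_comp_eq_of_comp_eq {D : Type*} [Groupoid D] {a b c d : D} {p : a ⟶ b} {q : b ⟶ d}
    {r : a ⟶ c} {s : c ⟶ d} (h : p ≫ q = r ≫ s) : Groupoid.inv r ≫ p ≫ q = s := by
  rw [h]
  simp

namespace GCWComplex

variable {G : Type u} [Group G] {X : Type u} [TopologicalSpace X] [MulAction G X]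
  (C : GCWComplex G X)

theorem constant_of_forall_mem {f : C(I, X)} (hf : ∀ t, f t ∈ C.filt 1) (s t : I) :
    f s = f t := by
  have hdisc : DiscreteTopology (C.filt 1) := by
    rw [discreteTopology_iff_forall_isClosed]
    intro A
    refine C.isClosed_filt_succ (n := 0) ?_ fun i c => ?_
    · have : IsEmpty (C.filt 0) := by rw [C.filt_zero]; infer_instance
      convert isClosed_empty
      exact Set.eq_empty_of_isEmpty _
    · have : Subsingleton (Disk 0) := ⟨fun a b => Subtype.ext (Subsingleton.elim _ _)⟩
      exact isClosed_discrete _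
  have hc : Continuous fun t => (⟨f t, hf t⟩ : C.filt 1) := by fun_prop
  exact congrArg Subtype.val (PreconnectedSpace.constant inferInstance hc (x := s) (y := t))

/-- The fixed points in the `1`-skeleton. -/
abbrev FixedGraph (H : Subgroup G) : Type u := {z : fixedPoints H X // (z : X) ∈ C.filt 2}

/-- The characteristic map of a `1`-cell as a map to the fixed points of the `1`-skeleton. -/
def edge {H : Subgroup G} {i : C.cell 1} {c : G ⧸ C.stab 1 i} (hc : CosetFixed H c) :
    C(Disk 1, C.FixedGraph H) :=
  ⟨fun v => ⟨⟨C.char 1 i c v, char_mem_fixedPoints hc v⟩, C.char_mem i c v⟩,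
    ((C.char_continuous 1 i c).subtype_mk _).subtype_mk _⟩

/-- The class of the image of a path in a `1`-cell. -/
def edgeClass {H : Subgroup G} {i : C.cell 1} {c : G ⧸ C.stab 1 i} (hc : CosetFixed H c)
    (v w : Disk 1) : FundamentalGroupoid.mk (C.edge hc v) ⟶ FundamentalGroupoid.mk (C.edge hc w) :=
  (FundamentalGroupoid.map (C.edge hc)).map (simplePath v w)

section Generation

variable {H : Subgroup G}

/-- The object lies in the `0`-skeleton. -/
def IsVertex (x : FundamentalGroupoid (C.FixedGraph H)) : Prop := (x.as.1 : X) ∈ C.filt 1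

/-- A set of morphisms between vertices of the graph of fixed points in the `1`-skeleton which is
closed under the groupoid operations and contains the edges. -/
structure EdgeClosed (Q : ∀ {x y : FundamentalGroupoid (C.FixedGraph H)}, (x ⟶ y) → Prop) :
    Prop where
  id : ∀ x, C.IsVertex x → Q (𝟙 x)
  comp : ∀ {x y z} (p : x ⟶ y) (q : y ⟶ z), C.IsVertex x → C.IsVertex y → C.IsVertex z →
    Q p → Q q → Q (p ≫ q)
  inv : ∀ {x y} (p : x ⟶ y), C.IsVertex x → C.IsVertex y → Q p → Q (Groupoid.inv p)
  edge : ∀ (i : C.cell 1) (c : G ⧸ C.stab 1 i) (hc : CosetFixed H c) (v w : Disk 1),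
    v ∈ diskBoundary 1 → w ∈ diskBoundary 1 → Q (C.edgeClass hc v w)

/-- Paths from a point to a vertex inside a closed cell. -/
def Spoke {z b : FundamentalGroupoid (C.FixedGraph H)} (p : z ⟶ b) : Prop :=
  C.IsVertex b ∧ ((∃ h : z = b, p = eqToHom h) ∨
    ∃ (i : C.cell 1) (c : G ⧸ C.stab 1 i) (hc : CosetFixed H c) (v w : Disk 1)
      (_ : w ∈ diskBoundary 1) (hz : z = .mk (C.edge hc v)) (hb : FundamentalGroupoid.mk
        (C.edge hc w) = b), p = eqToHom hz ≫ C.edgeClass hc v w ≫ eqToHom hb)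

variable {C} {Q : ∀ {x y : FundamentalGroupoid (C.FixedGraph H)}, (x ⟶ y) → Prop}

theorem EdgeClosed.of_spoke (hQ : C.EdgeClosed Q) {z b : FundamentalGroupoid (C.FixedGraph H)}
    {p : z ⟶ b} (hz : C.IsVertex z) (hp : C.Spoke p) : Q p := by
  obtain ⟨hb, ⟨rfl, rfl⟩ | ⟨i, c, hc, v, w, hw, rfl, rfl, rfl⟩⟩ := hp
  · exact hQ.id z hz
  · simp only [eqToHom_refl, Category.id_comp, Category.comp_id]
    exact hQ.edge i c hc v w (C.char_mem_filt_iff.1 hz) hw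

theorem edgeClass_comp {i : C.cell 1} {c : G ⧸ C.stab 1 i} (hc : CosetFixed H c)
    (v w x : Disk 1) : C.edgeClass hc v w ≫ C.edgeClass hc w x = C.edgeClass hc v x := by
  refine ((FundamentalGroupoid.map (C.edge hc)).map_comp _ _).symm.trans ?_
  exact congrArg _ (Subsingleton.elim _ _)

theorem inv_edgeClass {i : C.cell 1} {c : G ⧸ C.stab 1 i} (hc : CosetFixed H c)
    (v w : Disk 1) : Groupoid.inv (C.edgeClass hc v w) = C.edgeClass hc w v := by
  rw [Groupoid.inv_eq_inv]
  refine ((FundamentalGroupoid.map (C.edge hc)).map_inv (simplePath v w)).symm.trans ?_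
  exact congrArg _ (Subsingleton.elim _ _)

/-- If z is not a vertex, its open edge and its coordinate there are unique. Both spokes then run in
the same edge and their difference is one edge class. -/
theorem EdgeClosed.of_spoke_spoke (hQ : C.EdgeClosed Q)
    {z b b' : FundamentalGroupoid (C.FixedGraph H)} {p : z ⟶ b} {p' : z ⟶ b'}
    (hp : C.Spoke p) (hp' : C.Spoke p') : Q (Groupoid.inv p ≫ p') := by
  by_cases hz : C.IsVertex z
  · exact hQ.comp _ _ hp.1 hz hp'.1 (hQ.inv _ hz hp.1 (hQ.of_spoke hz hp)) (hQ.of_spoke hz hp')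
  · obtain ⟨hb, ⟨rfl, rfl⟩ | ⟨i, c, hc, v, w, hw, rfl, rfl, rfl⟩⟩ := hp
    · exact absurd hb hz
    · obtain ⟨hb', ⟨rfl, rfl⟩ | ⟨i', c', hc', v', w', hw', hz', rfl, rfl⟩⟩ := hp'
      · exact absurd hb' hz
      · have hv : ‖(v : EuclideanSpace ℝ (Fin 1))‖ < 1 :=
          lt_of_le_of_ne (norm_disk_le v) fun h => hz (C.char_boundary 1 i c v h)
        have hh : C.char 1 i c v = C.char 1 i' c' v' :=
          congrArg (fun x : FundamentalGroupoid (C.FixedGraph H) => (x.as.1 : X)) hz'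
        have := C.char_inj_sigma hv hh
        cases this
        simp only [eqToHom_refl, Category.id_comp, Category.comp_id]
        rw [inv_edgeClass, edgeClass_comp]
        exact hQ.edge i c hc w w' hw hw'

/-- A morphism which belongs to `Q` after composition with spokes at its end points. -/
def Spoked (Q : ∀ {x y : FundamentalGroupoid (C.FixedGraph H)}, (x ⟶ y) → Prop)
    {z w : FundamentalGroupoid (C.FixedGraph H)} (p : z ⟶ w) : Prop :=
  ∃ (b b' : FundamentalGroupoid (C.FixedGraph H)) (q : z ⟶ b) (q' : w ⟶ b'),
    C.Spoke q ∧ C.Spoke q' ∧ Q (Groupoid.inv q ≫ p ≫ q')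

/-- The two factors may use different spokes at the middle point; the discrepancy belongs to Q by
`EdgeClosed.of_spoke_spoke`. -/
theorem EdgeClosed.spoked_comp (hQ : C.EdgeClosed Q)
    {x y z : FundamentalGroupoid (C.FixedGraph H)} {p : x ⟶ y} {p' : y ⟶ z}
    (hp : Spoked Q p) (hp' : Spoked Q p') : Spoked Q (p ≫ p') := by
  obtain ⟨b, b', q, q', hq, hq', h⟩ := hp
  obtain ⟨d, d', r, r', hr, hr', h'⟩ := hp'
  refine ⟨b, d', q, r', hq, hr', ?_⟩
  have e : Groupoid.inv q ≫ (p ≫ p') ≫ r' = (Groupoid.inv q ≫ p ≫ q') ≫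
      (Groupoid.inv q' ≫ r) ≫ (Groupoid.inv r ≫ p' ≫ r') := by simp
  rw [e]
  exact hQ.comp _ _ hq.1 hq'.1 hr'.1 h (hQ.comp _ _ hq'.1 hr.1 hr'.1
    (hQ.of_spoke_spoke hq' hr) h')

theorem EdgeClosed.spoked_inv (hQ : C.EdgeClosed Q)
    {x y : FundamentalGroupoid (C.FixedGraph H)} {p : x ⟶ y}
    (hp : Spoked Q p) : Spoked Q (Groupoid.inv p) := by
  obtain ⟨b, b', q, q', hq, hq', h⟩ := hp
  refine ⟨b', b, q', q, hq', hq, ?_⟩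
  have e : Groupoid.inv q' ≫ Groupoid.inv p ≫ q = Groupoid.inv (Groupoid.inv q ≫ p ≫ q') := by
    simp [Groupoid.inv_eq_inv]
  rw [e]
  exact hQ.inv _ hq.1 hq'.1 h

theorem EdgeClosed.of_spoked (hQ : C.EdgeClosed Q)
    {x y : FundamentalGroupoid (C.FixedGraph H)} (hx : C.IsVertex x) (hy : C.IsVertex y)
    {p : x ⟶ y} (hp : Spoked Q p) : Q p := by
  obtain ⟨b, b', q, q', hq, hq', h⟩ := hp
  have e : p = q ≫ (Groupoid.inv q ≫ p ≫ q') ≫ Groupoid.inv q' := by simp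
  rw [e]
  exact hQ.comp _ _ hx hq.1 hy (hQ.of_spoke hx hq)
    (hQ.comp _ _ hq.1 hq'.1 hy h (hQ.inv _ hy hq'.1 (hQ.of_spoke hy hq')))

theorem EdgeClosed.spoked_cell (hQ : C.EdgeClosed Q) {i : C.cell 1} {c : G ⧸ C.stab 1 i}
    (hc : CosetFixed H c) {v v' : Disk 1} {z w : FundamentalGroupoid (C.FixedGraph H)}
    (p : z ⟶ w) (hz : z = .mk (C.edge hc v)) (hw : FundamentalGroupoid.mk (C.edge hc v') = w)
    (q : FundamentalGroupoid.mk v ⟶ FundamentalGroupoid.mk v')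
    (hp : p = eqToHom hz ≫ (FundamentalGroupoid.map (C.edge hc)).map q ≫ eqToHom hw) :
    Spoked Q p := by
  subst hz hw hp
  have hb : C.IsVertex (.mk (C.edge hc (diskPole 0))) :=
    C.char_boundary 1 i c _ (diskPole_mem 0)
  refine ⟨_, _, C.edgeClass hc v (diskPole 0), C.edgeClass hc v' (diskPole 0),
    ⟨hb, Or.inr ⟨i, c, hc, v, _, diskPole_mem 0, rfl, rfl, by simp⟩⟩,
    ⟨hb, Or.inr ⟨i, c, hc, v', _, diskPole_mem 0, rfl, rfl, by simp⟩⟩, ?_⟩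
  have hq : q = simplePath v v' := Subsingleton.elim _ _
  rw [hq]
  change Q (_ ≫ (eqToHom rfl ≫ C.edgeClass hc v v' ≫ eqToHom rfl) ≫ _)
  simp only [eqToHom_refl, Category.id_comp, Category.comp_id]
  rw [inv_edgeClass, edgeClass_comp, edgeClass_comp]
  exact hQ.edge i c hc _ _ (diskPole_mem 0) (diskPole_mem 0)

variable (C H) in
/-- The radial homotopy of the graph. -/
theorem exists_graph_homotopy : ∃ (r : C(C.FixedGraph H, C.FixedGraph H))
    (F : ContinuousMap.Homotopy (.id _) r),
    (∀ z t, (z.1 : X) ∈ C.filt 1 → F (t, z) = z) ∧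
    ∀ (i : C.cell 1) (c : G ⧸ C.stab 1 i) (hc : CosetFixed H c) (v : Disk 1) (t : I),
      F (t, C.edge hc v) = C.edge hc (radial 1 one_half_pos (v, t)) := by
  obtain ⟨r, hr1, hr0, hr2⟩ := C.exists_radial (m := 1) (fun _ _ => 1 / 2)
    (fun _ _ => one_half_pos) (fun _ _ => by norm_num)
  have hmem : ∀ (z : C.FixedGraph H) (t : I), r ⟨z.1, z.2⟩ t ∈ fixedPoints H X ∧
      r ⟨z.1, z.2⟩ t ∈ C.filt 2 := by
    rintro ⟨⟨z, hz⟩, hz'⟩ t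
    have : ∀ y : C.filt 2, (y : X) ∈ fixedPoints H X → r y t ∈ fixedPoints H X ∧
        r y t ∈ C.filt 2 := by
      refine C.filt_succ_cases (fun y hy => ?_) (fun i c v hv hy => ?_)
      · rw [hr1 _ _ y.2]
        exact ⟨hy, C.filt_mono (Nat.le_succ _) y.2⟩
      · rw [hr2]
        exact ⟨char_mem_fixedPoints (cosetFixed_of_char_mem hv hy) _, C.char_mem _ _ _⟩
    exact this ⟨z, hz'⟩ hz
  let F : C(I × C.FixedGraph H, C.FixedGraph H) :=
    ⟨fun y => ⟨⟨r ⟨y.2.1, y.2.2⟩ y.1, (hmem y.2 y.1).1⟩, (hmem y.2 y.1).2⟩, by fun_prop⟩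
  refine ⟨⟨fun z => F (1, z), by fun_prop⟩, ⟨F, fun z => ?_, fun z => rfl⟩, fun z t hz => ?_,
    fun i c hc v t => ?_⟩
  · exact Subtype.ext (Subtype.ext (hr0 ⟨z.1, z.2⟩))
  · exact Subtype.ext (Subtype.ext (hr1 ⟨z.1, z.2⟩ t hz))
  · exact Subtype.ext (Subtype.ext (hr2 i c v t))

/-- The straight path between two points of the interval. -/
def straight (s t : I) : Path s t where
  toFun x := ⟨(1 - (x : ℝ)) * s + x * t, by
    have h1 := x.2.1
    have h2 := x.2.2
    have h3 := s.2.1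
    have h4 := s.2.2
    have h5 := t.2.1
    have h6 := t.2.2
    constructor <;> nlinarith [mul_nonneg (sub_nonneg.2 h2) h3, mul_nonneg h1 h5,
      mul_nonneg (sub_nonneg.2 h2) (sub_nonneg.2 h4), mul_nonneg h1 (sub_nonneg.2 h6)]⟩
  continuous_toFun := by fun_prop
  source' := by ext; simp
  target' := by ext; simp

theorem eventually_straight_mem {U : Set I} (hU : IsOpen U) {s : I} (hs : s ∈ U) :
    ∀ᶠ t in 𝓝 s, ∀ x, straight s t x ∈ U := by
  obtain ⟨ε, hε, hb⟩ := Metric.isOpen_iff.1 hU s hs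
  filter_upwards [Metric.ball_mem_nhds s hε] with t ht x
  apply hb
  rw [Metric.mem_ball, Subtype.dist_eq, Real.dist_eq] at ht ⊢
  have e : ((straight s t x : I) : ℝ) - s = x * (t - s) := by
    simp only [straight, Path.coe_mk_mk]
    ring
  rw [e, abs_mul, abs_of_nonneg x.2.1]
  nlinarith [x.2.2, abs_nonneg ((t : ℝ) - s), x.2.1]

/-- If γ(s) is inside an edge, a short piece of γ stays in that edge, which is simply connected. If
γ(s) is a vertex, a short piece avoids the inner half of every edge, so the radial homotopy carries
it into the discrete 0-skeleton, where it is constant. -/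
theorem EdgeClosed.spoked_local (hQ : C.EdgeClosed Q) (γ : C(I, C.FixedGraph H)) (s : I) :
    ∀ᶠ t in 𝓝 s, Spoked Q ((FundamentalGroupoid.map γ).map (simplePath s t)) := by
  have hstr : ∀ t, (FundamentalGroupoid.map γ).map (simplePath s t) =
      FundamentalGroupoid.fromPath (Path.Homotopic.Quotient.mk
        ((straight s t).map γ.continuous)) := by
    intro t
    have : simplePath s t = FundamentalGroupoid.fromPath
      (Path.Homotopic.Quotient.mk (straight s t)) := Subsingleton.elim _ _
    rw [this]
    rfl
  let γ' : C(I, C.filt 2) := ⟨fun t => ⟨(γ t).1, (γ t).2⟩, by fun_prop⟩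
  by_cases hs : ((γ s).1 : X) ∈ C.filt 1
  · obtain ⟨r, F, hF1, hF2⟩ := C.exists_graph_homotopy H
    have hspoke : ∀ z : C.FixedGraph H, (¬ ∃ i c, ∃ v : Disk 1,
        ‖(v : EuclideanSpace ℝ (Fin 1))‖ ≤ 1 / 2 ∧ C.char 1 i c v = z.1) →
        C.Spoke ((FundamentalGroupoidFunctor.homotopicMapsNatIso F).app (.mk z)) := by
      intro z hz
      by_cases hz1 : (z.1 : X) ∈ C.filt 1
      · have h1 : r z = z := by rw [← F.apply_one, hF1 z 1 hz1]
        refine ⟨?_, Or.inl ⟨?_, ?_⟩⟩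
        · change ((r z).1 : X) ∈ _
          rw [h1]
          exact hz1
        · exact congrArg FundamentalGroupoid.mk h1.symm
        · exact mk_path_const (F.evalAt z) (fun t => hF1 z t hz1)
            (congrArg FundamentalGroupoid.mk h1.symm)
      · obtain ⟨i, c, v, hv, hx⟩ := C.exists_char z.2 hz1
        have hc : CosetFixed H c := cosetFixed_of_char_mem hv (by rw [hx]; exact z.1.2)
        have hzv : z = C.edge hc v := Subtype.ext (Subtype.ext hx.symm)
        have hv2 : 1 / 2 ≤ ‖(v : EuclideanSpace ℝ (Fin 1))‖ := by
          by_contra h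
          exact hz ⟨i, c, v, (not_le.1 h).le, hx⟩
        have hn := norm_radial_one one_half_pos hv2
        have h1 : r z = C.edge hc (radial 1 one_half_pos (v, 1)) := by
          rw [← F.apply_one, hzv, hF2]
        refine ⟨?_, Or.inr ⟨i, c, hc, v, _, hn, congrArg FundamentalGroupoid.mk hzv,
          congrArg FundamentalGroupoid.mk h1.symm, ?_⟩⟩
        · change ((r z).1 : X) ∈ _
          rw [h1]
          exact C.char_boundary 1 i c _ hn
        · let ℓ : Path v (radial 1 one_half_pos (v, 1)) :=
            ⟨⟨fun t => radial 1 one_half_pos (v, t), by fun_prop⟩, radial_zero one_half_pos v, rfl⟩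
          refine (mk_path_eq (F.evalAt z) (ℓ.map (C.edge hc).continuous) (fun t => ?_)
            (congrArg FundamentalGroupoid.mk hzv)
            (congrArg FundamentalGroupoid.mk h1.symm)).trans ?_
          · exact (congrArg (fun x => F (t, x)) hzv).trans (hF2 i c hc v t)
          · congr 2
            have : simplePath v (radial 1 one_half_pos (v, 1)) = FundamentalGroupoid.fromPath
              (Path.Homotopic.Quotient.mk ℓ) := Subsingleton.elim _ _
            rw [edgeClass, this]
            rfl
    have hO : IsOpen {t : I | ¬ ∃ i c, ∃ v : Disk 1,
        ‖(v : EuclideanSpace ℝ (Fin 1))‖ ≤ 1 / 2 ∧ C.char 1 i c v = (γ t).1} :=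
      ((C.isClosed_iUnion_char_closedBall (n := 1) (r := 1 / 2) (by norm_num)).preimage
        γ'.continuous).isOpen_compl
    have hsO : s ∈ {t : I | ¬ ∃ i c, ∃ v : Disk 1,
        ‖(v : EuclideanSpace ℝ (Fin 1))‖ ≤ 1 / 2 ∧ C.char 1 i c v = (γ t).1} := by
      rintro ⟨i, c, v, hv, hx⟩
      refine (C.char_mem_of_lt (i := i) (c := c) (v := v) (by linarith)).2 ?_
      rw [hx]
      exact hs
    filter_upwards [eventually_straight_mem hO hsO] with t ht
    have hs0 := hspoke _ (by simpa using ht 0)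
    have ht1 := hspoke _ (by simpa using ht 1)
    refine ⟨_, _, _, _, hs0, ht1, ?_⟩
    -- Naturality of the homotopy compares the short path with its image under r, a constant path;
    -- the tracks of the two end points are the spokes.
    have hnat := (FundamentalGroupoidFunctor.homotopicMapsNatIso F).naturality
      (FundamentalGroupoid.fromPath (Path.Homotopic.Quotient.mk
        ((straight s t).map γ.continuous)))
    have hvert : ∀ x, ((r (γ (straight s t x))).1 : X) ∈ C.filt 1 := by
      intro x
      exact (hspoke _ (ht x)).1
    have hconst : ∀ x y, r (γ (straight s t x)) = r (γ (straight s t y)) := by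
      intro x y
      apply Subtype.ext
      apply Subtype.ext
      exact C.constant_of_forall_mem (f := ⟨fun x => ((r (γ (straight s t x))).1 : X),
        by fun_prop⟩) hvert x y
    have hst : r (γ t) = r (γ s) := by simpa using hconst 1 0
    have hmap : (FundamentalGroupoid.map r).map (FundamentalGroupoid.fromPath
        (Path.Homotopic.Quotient.mk ((straight s t).map γ.continuous))) =
        eqToHom (congrArg FundamentalGroupoid.mk hst.symm) := by
      refine mk_path_const (((straight s t).map γ.continuous).map r.continuous) (fun x => ?_)
        (congrArg FundamentalGroupoid.mk hst.symm)
      simpa using hconst x 0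
    rw [hmap] at hnat
    have hnat' : (FundamentalGroupoid.fromPath (Path.Homotopic.Quotient.mk
        ((straight s t).map γ.continuous)) : FundamentalGroupoid.mk (γ s) ⟶ .mk (γ t)) ≫
        (FundamentalGroupoidFunctor.homotopicMapsNatIso F).app (.mk (γ t)) =
        (FundamentalGroupoidFunctor.homotopicMapsNatIso F).app (.mk (γ s)) ≫
          eqToHom (congrArg FundamentalGroupoid.mk hst.symm) := hnat
    rw [hstr]
    have e := inv_comp_eq_of_comp_eq hnat'
    have hQe : ∀ {x y : FundamentalGroupoid (C.FixedGraph H)} (h : x = y), C.IsVertex x →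
        Q (eqToHom h) := by
      rintro x _ rfl hx
      exact hQ.id x hx
    refine Eq.mpr (congrArg Q e) (hQe _ ?_)
    exact hs0.1
  · obtain ⟨i, c, v, hv, hx⟩ := C.exists_char (γ s).2 hs
    have hc : CosetFixed H c := cosetFixed_of_char_mem hv (by rw [hx]; exact (γ s).1.2)
    obtain ⟨hU, W, hW, hWv⟩ := C.exists_coordinate γ' i c
    filter_upwards [eventually_straight_mem hU (s := s) ⟨v, hv, hx⟩] with t ht
    have hγ : ∀ x, γ (straight s t x) = C.edge hc (W (straight s t x)) := by
      intro x
      obtain ⟨w, hw, hwx⟩ := ht x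
      rw [hWv _ w hw hwx]
      exact Subtype.ext (Subtype.ext hwx.symm)
    let ℓ : Path (W (straight s t 0)) (W (straight s t 1)) :=
      ⟨⟨fun x => W (straight s t x), hW.comp_continuous (straight s t).continuous ht⟩, rfl, rfl⟩
    have h0 : γ s = C.edge hc (W (straight s t 0)) := by simpa using hγ 0
    have h1 : γ t = C.edge hc (W (straight s t 1)) := by simpa using hγ 1
    rw [hstr]
    refine hQ.spoked_cell hc _ (congrArg FundamentalGroupoid.mk h0)
      (congrArg FundamentalGroupoid.mk h1.symm)
      (FundamentalGroupoid.fromPath (Path.Homotopic.Quotient.mk ℓ)) ?_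
    exact mk_path_eq ((straight s t).map γ.continuous) (ℓ.map (C.edge hc).continuous) hγ _ _

/-- A set of morphisms between the vertices which is closed under the groupoid operations and
contains the edges contains all morphisms. -/
theorem EdgeClosed.all (hQ : C.EdgeClosed Q) {x y : FundamentalGroupoid (C.FixedGraph H)}
    (hx : C.IsVertex x) (hy : C.IsVertex y) (p : x ⟶ y) : Q p := by
  obtain ⟨γ, rfl⟩ := Path.Homotopic.Quotient.mk_surjective p
  have key : ∀ s t : I, Spoked Q ((FundamentalGroupoid.map (γ : C(I, C.FixedGraph H))).map
      (simplePath s t)) := by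
    have hinv : ∀ a b, Spoked Q ((FundamentalGroupoid.map (γ : C(I, C.FixedGraph H))).map
        (simplePath a b)) → Spoked Q ((FundamentalGroupoid.map (γ : C(I, C.FixedGraph H))).map
        (simplePath b a)) := by
      intro a b hab
      have e : simplePath b a = Groupoid.inv (simplePath a b) := Subsingleton.elim _ _
      rw [e, Groupoid.inv_eq_inv, Functor.map_inv, ← Groupoid.inv_eq_inv]
      exact hQ.spoked_inv hab
    -- Connectedness of the interval replaces a subdivision of the path: a transitive, symmetric
    -- relation that holds locally holds for all pairs of parameters.
    refine PreconnectedSpace.induction₂' _ (fun s => ?_) ⟨fun a b c hab hbc => ?_⟩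
    · filter_upwards [hQ.spoked_local γ s] with t ht
      exact ⟨ht, hinv _ _ ht⟩
    · have e : simplePath a c = simplePath a b ≫ simplePath b c := Subsingleton.elim _ _
      rw [e, Functor.map_comp]
      exact hQ.spoked_comp hab hbc
  have h01 := key 0 1
  have e : simplePath (0 : I) 1 = FundamentalGroupoid.fromPath
    (Path.Homotopic.Quotient.mk (straight 0 1)) := Subsingleton.elim _ _
  rw [e] at h01
  have hmain : ∀ {z w : FundamentalGroupoid (C.FixedGraph H)} (hz : z = x) (hw : y = w)
      (p' : z ⟶ w) (q : x ⟶ y), p' = eqToHom hz ≫ q ≫ eqToHom hw → Spoked Q p' → Q q := by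
    rintro z w rfl rfl p' q rfl h
    simp only [eqToHom_refl, Category.id_comp, Category.comp_id] at h
    exact hQ.of_spoked hx hy h
  refine hmain (congrArg FundamentalGroupoid.mk γ.source)
    (congrArg FundamentalGroupoid.mk γ.target.symm) _ _ ?_ h01
  refine mk_path_eq ((straight 0 1).map γ.continuous) γ (fun t => ?_) _ _
  change γ _ = γ t
  congr 1
  ext
  simp [straight]

end Generation

end GCWComplex

/-! ### Functors of restricted fundamental groupoids -/

theorem InducedCategory_eqToHom_hom {C D : Type*} [Category D] {F : C → D}
    {x y : InducedCategory D F} (h : x = y) : (eqToHom h).hom = eqToHom (congrArg F h) := by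
  subst h
  rfl

/-- A point of `S` as an object of the fundamental groupoid based at `S`. -/
def basePoint {Z : Type*} [TopologicalSpace Z] {S : Set Z} (x : Z) (hx : x ∈ S) :
    RestrictedGroupoid Z S := (⟨x, hx⟩ : S)

/-- A path class between points of `S` as a morphism of the fundamental groupoid based at `S`. -/
def basedClass {Z : Type*} [TopologicalSpace Z] {S : Set Z} {x y : Z} (hx : x ∈ S) (hy : y ∈ S)
    (p : FundamentalGroupoid.mk x ⟶ FundamentalGroupoid.mk y) : basePoint x hx ⟶ basePoint y hy :=
  InducedCategory.homMk p

section BasedMap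

variable {Z W V : Type*} [TopologicalSpace Z] [TopologicalSpace W] [TopologicalSpace V]

/-- `restrictedMap` for spaces in different universes. -/
def basedMap {S : Set Z} {T : Set W} (f : C(Z, W)) (hf : Set.MapsTo f S T) :
    RestrictedGroupoid Z S ⥤ RestrictedGroupoid W T where
  obj s := (⟨f s.1, hf s.2⟩ : T)
  map p := InducedCategory.homMk ((FundamentalGroupoid.map f).map p.hom)
  map_id s := by
    apply InducedCategory.hom_ext
    exact (FundamentalGroupoid.map f).map_id _
  map_comp p q := by
    apply InducedCategory.hom_ext
    exact (FundamentalGroupoid.map f).map_comp _ _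

theorem basedMap_congr {S : Set Z} {T : Set W} {f g : C(Z, W)} (h : f = g)
    (hf : Set.MapsTo f S T) (hg : Set.MapsTo g S T) : basedMap f hf = basedMap g hg := by
  subst h
  rfl

theorem basedMap_comp {S : Set Z} {T : Set W} {U : Set V} (f : C(Z, W)) (g : C(W, V))
    (hf : Set.MapsTo f S T) (hg : Set.MapsTo g T U) :
    basedMap f hf ⋙ basedMap g hg = basedMap (g.comp f) (fun _ hx => hg (hf hx)) := by
  refine CategoryTheory.Functor.hext (fun _ => rfl) ?_
  rintro s t ⟨⟨p⟩⟩
  exact heq_of_eq rfl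

end BasedMap

/-- Two functors agree on a morphism. -/
def AgreeOn {A B : Type*} [Category A] [Category B] {E F : A ⥤ B} (h : ∀ x, E.obj x = F.obj x)
    {x y : A} (p : x ⟶ y) : Prop :=
  E.map p = eqToHom (h x) ≫ F.map p ≫ eqToHom (h y).symm

section AgreeOn

variable {A B : Type*} [Groupoid A] [Groupoid B] {E F : A ⥤ B} (h : ∀ x, E.obj x = F.obj x)

theorem agreeOn_id (x : A) : AgreeOn h (𝟙 x) := by simp [AgreeOn]

variable {h}

theorem AgreeOn.comp {x y z : A} {p : x ⟶ y} {q : y ⟶ z} (hp : AgreeOn h p)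
    (hq : AgreeOn h q) : AgreeOn h (p ≫ q) := by
  unfold AgreeOn at *
  simp [hp, hq]

theorem AgreeOn.inv {x y : A} {p : x ⟶ y} (hp : AgreeOn h p) :
    AgreeOn h (Groupoid.inv p) := by
  unfold AgreeOn at *
  simp [Groupoid.inv_eq_inv, hp]

theorem AgreeOn.of_comp_eq {A' : Type*} [Category A'] {J : A' ⥤ A} (hJ : J ⋙ E = J ⋙ F)
    {x y : A'} (p : x ⟶ y) : AgreeOn h (J.map p) :=
  Functor.congr_hom hJ p

/-- Used for the passage from the 1-skeleton to the whole fixed point set, which is bijective on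
vertices and surjective on path classes. -/
theorem functor_eq_of_comp_eq {A' : Type*} [Category A'] {J : A' ⥤ A} {E F : A ⥤ B}
    (hJ : J ⋙ E = J ⋙ F) (hobj : ∀ x, ∃ a, J.obj a = x)
    (hmap : ∀ (a b : A') (p : J.obj a ⟶ J.obj b), ∃ q, J.map q = p) : E = F := by
  have h : ∀ x, E.obj x = F.obj x := by
    intro x
    obtain ⟨a, rfl⟩ := hobj x
    exact Functor.congr_obj hJ a
  refine CategoryTheory.Functor.ext h fun x y p => ?_
  obtain ⟨a, rfl⟩ := hobj x
  obtain ⟨b, rfl⟩ := hobj y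
  obtain ⟨q, rfl⟩ := hmap a b p
  exact Functor.congr_hom hJ q

end AgreeOn

/-- Two functors on the fundamental groupoid of the interval based at the end points agree if they
agree on the path class from one end to the other. -/
theorem functor_eq_of_interval {B : Type*} [Groupoid B]
    {E F : RestrictedGroupoid (Disk 1) (diskBoundary 1) ⥤ B} {e : I ≃ₜ Disk 1}
    (he : ∀ x, e x ∈ diskBoundary 1 ↔ x ∈ ({0, 1} : Set I)) (h : ∀ x, E.obj x = F.obj x)
    (h0 : e 0 ∈ diskBoundary 1) (h1 : e 1 ∈ diskBoundary 1)
    (hp : AgreeOn h (basedClass h0 h1 (simplePath (e 0) (e 1)))) : E = F := by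
  have hsub : ∀ x y : RestrictedGroupoid (Disk 1) (diskBoundary 1), Subsingleton (x ⟶ y) :=
    fun x y => ⟨fun p q => InducedCategory.hom_ext (Subsingleton.elim _ _)⟩
  have hcases : ∀ x : RestrictedGroupoid (Disk 1) (diskBoundary 1),
      x = basePoint (e 0) h0 ∨ x = basePoint (e 1) h1 := by
    rintro ⟨x, hx⟩
    have := (he (e.symm x)).1 (by simpa using hx)
    rcases this with h | h
    · left
      exact Subtype.ext ((e.symm_apply_eq).1 h)
    · right
      exact Subtype.ext ((e.symm_apply_eq).1 h)
  refine CategoryTheory.Functor.ext h fun x y p => ?_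
  change AgreeOn h p
  rcases hcases x with rfl | rfl <;> rcases hcases y with rfl | rfl
  · rw [Subsingleton.elim p (𝟙 _)]
    exact agreeOn_id h _
  · rw [Subsingleton.elim p (basedClass h0 h1 (simplePath (e 0) (e 1)))]
    exact hp
  · rw [Subsingleton.elim p (Groupoid.inv (basedClass h0 h1 (simplePath (e 0) (e 1))))]
    exact hp.inv
  · rw [Subsingleton.elim p (𝟙 _)]
    exact agreeOn_id h _

/-! ### Maps of orbits and cells -/

section Orbits

variable {G : Type u} [Group G] {X : Type u} [MulAction G X]

/-- The map of orbits `G/H → G/K` given by an `H`-fixed coset. -/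
def orbHom {H K : Subgroup G} {c : G ⧸ K} (hc : GCWComplex.CosetFixed H c) :
    (⟨H⟩ : Orb G) ⟶ ⟨K⟩ where
  toFun d := Quotient.liftOn' d (fun g => g • c) (by
    intro a b hab
    rw [QuotientGroup.leftRel_apply] at hab
    have := hc _ hab
    rw [mul_smul, inv_smul_eq_iff] at this
    exact this.symm)
  map_smul' g d := by
    induction d using QuotientGroup.induction_on with
    | H a => exact mul_smul g a c

theorem orbHom_baseCoset {H K : Subgroup G} {c : G ⧸ K} (hc : GCWComplex.CosetFixed H c) :
    MulActionHom.toFun (orbHom hc) (baseCoset H) = c :=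
  one_smul G c

theorem coe_translate_orbHom {H K : Subgroup G} {c : G ⧸ K} (hc : GCWComplex.CosetFixed H c)
    (x : fixedPoints K X) : (translate (orbHom hc) x : X) = cosetSMul c x := by
  change cosetSMul (MulActionHom.toFun (orbHom hc) (baseCoset H)) x = _
  rw [orbHom_baseCoset]

theorem mk_eq_smul_baseCoset {K : Subgroup G} (a : G) : (a : G ⧸ K) = a • baseCoset K := by
  change _ = ((a * 1 : G) : G ⧸ K)
  rw [mul_one]

end Orbits

namespace GCWComplex

variable {G : Type u} [Group G] {Y : Type u} [TopologicalSpace Y] [MulAction G Y]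
  {B : Type u} [TopologicalSpace B] [MulAction G B]
  (D : GCWComplex G Y) {K : GCWComplex G B}

/-- The characteristic map of a cell as a map to the fixed point set. -/
def charFixed {n : ℕ} {i : D.cell n} {c : G ⧸ D.stab n i} {H : Subgroup G} (hc : CosetFixed H c) :
    C(Disk n, fixedPoints H Y) :=
  ⟨fun v => ⟨D.char n i c v, char_mem_fixedPoints hc v⟩,
    (D.char_continuous n i c).subtype_mk _⟩

variable {D} in
theorem charFixed_mem_zeroSkel {i : D.cell 0} {c : G ⧸ D.stab 0 i} {H : Subgroup G}
    (hc : CosetFixed H c) (v : Disk 0) : D.charFixed hc v ∈ D.zeroSkel H :=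
  D.char_mem i c v

variable {D} in
theorem charFixed_mapsTo_zeroSkel {i : D.cell 1} {c : G ⧸ D.stab 1 i} {H : Subgroup G}
    (hc : CosetFixed H c) : Set.MapsTo (D.charFixed hc) (diskBoundary 1) (D.zeroSkel H) :=
  fun v hv => D.char_boundary 1 i c v hv

/-- Each copy of a cell inside Y^H comes from the base copy by the orbit map G/H → G/Hᵢ that its
coset defines. Naturality in the orbit category thus reduces everything to base copies. -/
theorem translate_charFixed {n : ℕ} {i : D.cell n} {c : G ⧸ D.stab n i} {H : Subgroup G}
    (hc : CosetFixed H c) (v : Disk n) :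
    translate (orbHom hc) (D.charFixed (cosetFixed_baseCoset (D.stab n i)) v) =
      D.charFixed hc v := by
  apply Subtype.ext
  rw [coe_translate_orbHom]
  induction c using QuotientGroup.induction_on with
  | H a =>
    refine (cosetSMul_mk _ _).trans ?_
    change a • D.char n i (baseCoset _) v = D.char n i (a : G ⧸ D.stab n i) v
    rw [mk_eq_smul_baseCoset, D.char_smul]

theorem translate_mem_filt {n : ℕ} {H K : Orb G} (α : H ⟶ K) (x : fixedPoints K.sub Y)
    (hx : (x : Y) ∈ D.filt n) : (translate α x : Y) ∈ D.filt n := by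
  change cosetSMul (MulActionHom.toFun α (baseCoset H.sub)) x ∈ D.filt n
  generalize MulActionHom.toFun α (baseCoset H.sub) = c
  induction c using QuotientGroup.induction_on with
  | H a => exact D.filt_smul n a _ hx

variable {D}

/-- The restriction of an equivariant map to the fixed points. -/
def FiltEquivariant.onFixed {n : ℕ} {f : C(D.filt n, B)} (hf : D.FiltEquivariant f)
    (H : Subgroup G) : C({z : fixedPoints H Y // (z : Y) ∈ D.filt n}, fixedPoints H B) where
  toFun z := ⟨f ⟨z.1, z.2⟩, fun h => by
    change (h : G) • f ⟨z.1, z.2⟩ = f ⟨z.1, z.2⟩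
    rw [← hf]
    congr 2
    exact z.1.2 h⟩
  continuous_toFun := by fun_prop

theorem FiltEquivariant.onFixed_translate {n : ℕ} {f : C(D.filt n, B)} (hf : D.FiltEquivariant f)
    {H K : Orb G} (α : H ⟶ K) (x : fixedPoints K.sub Y) (hx : (x : Y) ∈ D.filt n) :
    hf.onFixed H.sub ⟨translate α x, D.translate_mem_filt α x hx⟩ =
      translate α (hf.onFixed K.sub ⟨x, hx⟩) := by
  have key : ∀ (c : G ⧸ K.sub) (h : cosetSMul c x ∈ D.filt n),
      f ⟨cosetSMul c x, h⟩ = cosetSMul c (hf.onFixed K.sub ⟨x, hx⟩) := by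
    intro c
    induction c using QuotientGroup.induction_on with
    | H a => exact fun h => hf a ⟨x, hx⟩
  exact Subtype.ext (key _ _)

section Components

variable [ContinuousConstSMul G Y] [ContinuousConstSMul G B]
  (Ψ : D.fundamentalGroupoidFunctor ⟶ K.fundamentalGroupoidFunctor)

/-- The component of a natural transformation as a functor. -/
def component (H : Subgroup G) :
    RestrictedGroupoid (fixedPoints H Y) (D.zeroSkel H) ⥤
      RestrictedGroupoid (fixedPoints H B) (K.zeroSkel H) :=
  Ψ.app (Opposite.op ⟨H⟩)

theorem component_naturality {H L : Orb G} (α : H ⟶ L) :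
    basedMap (translateMap α) (D.translate_mapsTo α) ⋙ component Ψ H.sub =
      component Ψ L.sub ⋙ basedMap (translateMap α) (K.translate_mapsTo α) :=
  Ψ.naturality α.op

/-- The image of a vertex. -/
def vertexImage {H : Subgroup G} (z : fixedPoints H Y) (hz : z ∈ D.zeroSkel H) : fixedPoints H B :=
  Subtype.val (p := fun x => x ∈ K.zeroSkel H) ((component Ψ H).obj (basePoint z hz))

theorem vertexImage_mem {H : Subgroup G} (z : fixedPoints H Y) (hz : z ∈ D.zeroSkel H) :
    vertexImage Ψ z hz ∈ K.zeroSkel H :=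
  Subtype.property (p := fun x => x ∈ K.zeroSkel H) ((component Ψ H).obj (basePoint z hz))

theorem vertexImage_translate {H L : Orb G} (α : H ⟶ L) (z : fixedPoints L.sub Y)
    (hz : z ∈ D.zeroSkel L.sub) :
    vertexImage Ψ (translate α z) (D.translate_mapsTo α hz) =
      translate α (vertexImage Ψ z hz) :=
  congrArg (Subtype.val (p := fun x => x ∈ K.zeroSkel H.sub))
    (Functor.congr_obj (component_naturality Ψ α) (basePoint z hz))

/-- The condition on a map on a cell to be compatible with a transformation of fundamental
groupoids. -/
def CellCompatible : ∀ n, D.cell n → C(Disk n, B) → Prop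
  | 0, i, e => ∀ v, e v = vertexImage Ψ (D.charFixed (cosetFixed_baseCoset (D.stab 0 i)) v)
      (charFixed_mem_zeroSkel _ v)
  | 1, i, e => (∀ v, e v ∈ K.filt 2) ∧
      ∃ (e' : C(Disk 1, fixedPoints (D.stab 1 i) B)) (_ : ∀ v, (e' v : B) = e v)
      (hm : Set.MapsTo e' (diskBoundary 1) (K.zeroSkel (D.stab 1 i))),
      basedMap e' hm = basedMap (D.charFixed (cosetFixed_baseCoset (D.stab 1 i)))
        (charFixed_mapsTo_zeroSkel _) ⋙ component Ψ (D.stab 1 i)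
  | n + 2, _, e => ∀ v, e v ∈ K.filt (n + 3)

variable {Ψ}

theorem CellCompatible.mem_filt : ∀ {n : ℕ} {i : D.cell n} {e : C(Disk n, B)}
    (_ : CellCompatible Ψ n i e) (v : Disk n), e v ∈ K.filt (n + 1)
  | 0, _, _, h, v => by
    rw [h v]
    exact vertexImage_mem _ _ _
  | 1, _, _, h, v => h.1 v
  | _ + 2, _, _, h, v => h v

variable {n : ℕ} {f : C(D.filt n, B)}

theorem mem_filt_of_cellCompatible (hf : D.FiltEquivariant f)
    (hok : ∀ m (hm : m < n) i, CellCompatible Ψ m i (f.comp (D.charFilt hm i (baseCoset _))))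
    (x : D.filt n) : f x ∈ K.filt n := by
  obtain ⟨m, hm, i, c, v, hv, hx⟩ := D.exists_char_of_mem x.2
  refine K.filt_mono hm ?_
  have h := (hok m hm i).mem_filt v
  induction c using QuotientGroup.induction_on with
  | H a =>
    have hx' : x = ⟨a • D.char m i (baseCoset _) v, D.filt_smul n a _
        (D.charFilt hm i (baseCoset _) v).2⟩ := by
      apply Subtype.ext
      rw [← hx, mk_eq_smul_baseCoset, D.char_smul]
    rw [hx']
    have := hf a (D.charFilt hm i (baseCoset _) v)
    exact this ▸ K.filt_smul _ a _ h

/-- Compatibility is required on base copies only. For the other vertices in Y^H, equivariance of f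
and naturality of Ψ along the same orbit map give the same translate. -/
theorem eq_vertexImage (hf : D.FiltEquivariant f)
    (hok : ∀ m (hm : m < n) i, CellCompatible Ψ m i (f.comp (D.charFilt hm i (baseCoset _))))
    (hn : 0 < n) {H : Subgroup G} (z : fixedPoints H Y)
    (hz : z ∈ D.zeroSkel H) : f ⟨z, D.filt_mono hn hz⟩ = vertexImage Ψ z hz := by
  obtain ⟨m, hm, i, c, v, hv, hx⟩ := D.exists_char_of_mem hz
  obtain rfl : m = 0 := by omega
  have hc : CosetFixed H c := cosetFixed_of_char_mem hv (by rw [hx]; exact z.2)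
  obtain rfl : z = translate (orbHom hc) (D.charFixed (cosetFixed_baseCoset (D.stab 0 i)) v) := by
    rw [translate_charFixed]
    exact Subtype.ext hx.symm
  have h1 := vertexImage_translate Ψ (orbHom hc) _
    (charFixed_mem_zeroSkel (cosetFixed_baseCoset (D.stab 0 i)) v)
  have h2 := hf.onFixed_translate (orbHom hc)
    (D.charFixed (cosetFixed_baseCoset (D.stab 0 i)) v) (D.filt_mono hn (D.char_mem i _ v))
  refine (congrArg Subtype.val h2).trans ((congrArg Subtype.val ?_).trans
    (congrArg Subtype.val h1.symm))
  refine congrArg (translate (orbHom hc)) (Subtype.ext ?_)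
  exact hok 0 hn i v

end Components

/-- The path classes on which the two functors agree are closed under the groupoid operations. They
contain the edges by compatibility on base copies and naturality of Ψ. Since edges generate, the
functors agree. -/
theorem basedMap_graph_eq [ContinuousConstSMul G Y] [ContinuousConstSMul G B]
    {Ψ : D.fundamentalGroupoidFunctor ⟶ K.fundamentalGroupoidFunctor}
    {f : C(D.filt 2, B)} (hf : D.FiltEquivariant f)
    (hok : ∀ m (hm : m < 2) i, CellCompatible Ψ m i (f.comp (D.charFilt hm i (baseCoset _))))
    (H : Subgroup G) :
    ∃ (hm : Set.MapsTo (hf.onFixed H) {z : D.FixedGraph H | (z.1 : Y) ∈ D.filt 1} (K.zeroSkel H))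
      (hm' : Set.MapsTo (⟨Subtype.val, continuous_subtype_val⟩ : C(D.FixedGraph H, fixedPoints H Y))
        {z : D.FixedGraph H | (z.1 : Y) ∈ D.filt 1} (D.zeroSkel H)),
      basedMap (hf.onFixed H) hm = basedMap _ hm' ⋙ component Ψ H := by
  have hv : ∀ (H : Subgroup G) (z : D.FixedGraph H) (hz : (z.1 : Y) ∈ D.filt 1),
      hf.onFixed H z = vertexImage Ψ z.1 hz := fun H z hz =>
    Subtype.ext (eq_vertexImage hf hok Nat.zero_lt_two z.1 hz)
  have hm : ∀ H : Subgroup G, Set.MapsTo (hf.onFixed H)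
      {z : D.FixedGraph H | (z.1 : Y) ∈ D.filt 1} (K.zeroSkel H) := by
    intro H z hz
    rw [hv H z hz]
    exact vertexImage_mem _ _ _
  have hm' : Set.MapsTo (⟨Subtype.val, continuous_subtype_val⟩ :
      C(D.FixedGraph H, fixedPoints H Y)) {z : D.FixedGraph H | (z.1 : Y) ∈ D.filt 1}
      (D.zeroSkel H) := fun z hz => hz
  refine ⟨hm H, hm', ?_⟩
  have hobj : ∀ x, (basedMap (hf.onFixed H) (hm H)).obj x =
      (basedMap _ hm' ⋙ component Ψ H).obj x := fun x => Subtype.ext (hv H x.1 x.2)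
  have hQ : D.EdgeClosed (H := H) (fun {x y} p => ∀ (hx : D.IsVertex x) (hy : D.IsVertex y),
      AgreeOn hobj (basedClass (S := {z : D.FixedGraph H | (z.1 : Y) ∈ D.filt 1}) hx hy p)) := by
    refine ⟨fun x _ hx hy => agreeOn_id hobj _, fun p q _ hy _ hp hq hx hz =>
      (hp hx hy).comp (hq hy hz), fun p _ _ hp hy hx => ?_, fun i c hc v w hv' hw' hx hy => ?_⟩
    · exact (hp hx hy).inv
    · have hmt : Set.MapsTo (D.edge hc) (diskBoundary 1)
          {z : D.FixedGraph H | (z.1 : Y) ∈ D.filt 1} := fun v hv => D.char_boundary 1 i c v hv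
      refine AgreeOn.of_comp_eq (J := basedMap (D.edge hc) hmt) ?_ (basedClass hv' hw' (simplePath v w))
      obtain ⟨-, e, he, hem, hee⟩ := hok 1 Nat.one_lt_two i
      have h1 : (hf.onFixed H).comp (D.edge hc) = (translateMap (orbHom hc)).comp e := by
        ext v
        have h := hf.onFixed_translate (orbHom hc)
          (D.charFixed (cosetFixed_baseCoset (D.stab 1 i)) v) (D.char_mem i _ v)
        have h' : D.edge hc v = ⟨translate (orbHom hc) (D.charFixed
            (cosetFixed_baseCoset (D.stab 1 i)) v),
            D.translate_mem_filt _ _ (D.char_mem i _ v)⟩ :=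
          Subtype.ext (translate_charFixed D hc v).symm
        change ((hf.onFixed H (D.edge hc v) : fixedPoints H B) : B) = _
        rw [h', h]
        change ((translate (orbHom hc) _ : fixedPoints H B) : B) = (translate (orbHom hc) _ :
          fixedPoints H B)
        congr 2
        exact Subtype.ext (he v).symm
      have h2 := basedMap_comp e (translateMap (orbHom hc)) hem (K.translate_mapsTo _)
      refine (basedMap_comp _ _ hmt (hm H)).trans ((basedMap_congr h1 _
        (fun v hv => K.translate_mapsTo (orbHom hc) (hem hv))).trans (h2.symm.trans ?_))
      rw [hee]
      refine (congrArg (fun T => basedMap (D.charFixed (cosetFixed_baseCoset (D.stab 1 i)))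
        (charFixed_mapsTo_zeroSkel _) ⋙ T) (component_naturality Ψ (orbHom hc)).symm).trans ?_
      refine congrArg (fun T => T ⋙ component Ψ H) (?_ :
        basedMap (D.charFixed (cosetFixed_baseCoset (D.stab 1 i))) (charFixed_mapsTo_zeroSkel _) ⋙
          basedMap (translateMap (orbHom hc)) (D.translate_mapsTo (orbHom hc)) =
        basedMap (D.edge hc) hmt ⋙ basedMap ⟨Subtype.val, continuous_subtype_val⟩ hm')
      refine (basedMap_comp _ _ _ _).trans (Eq.trans ?_ (basedMap_comp _ _ _ _).symm)
      exact basedMap_congr (ContinuousMap.ext fun v => translate_charFixed D hc v) _ _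
  refine CategoryTheory.Functor.ext hobj fun x y p => ?_
  exact hQ.all (x := .mk x.1) (y := .mk y.1) x.2 y.2 p.hom x.2 y.2

end GCWComplex

/-! ### Existence of maps to aspherical `G`-CW-complexes -/

/-- Allows a loop to be moved to a vertex, where Ψ is defined, without affecting whether its image
is trivial. -/
theorem map_eq_id_of_conj {A B : Type*} [Groupoid A] [Groupoid B] (F : A ⥤ B) {x y : A}
    (d : x ⟶ y) (p : y ⟶ y) : F.map (d ≫ p ≫ Groupoid.inv d) = 𝟙 _ ↔ F.map p = 𝟙 _ := by
  rw [Groupoid.inv_eq_inv]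
  constructor
  · intro h
    have e : p = inv d ≫ (d ≫ p ≫ inv d) ≫ d := by simp
    rw [e, F.map_comp, F.map_comp, h]
    simp
  · intro h
    simp [h]

theorem map_eq_id_of_comp_eq {A A' B : Type*} [Category A] [Category A'] [Category B]
    {E : A ⥤ B} {J : A ⥤ A'} {F : A' ⥤ B} (hE : E = J ⋙ F) {x : A} (p : x ⟶ x)
    (h : J.map p = 𝟙 _) : E.map p = 𝟙 _ := by
  subst hE
  simp [h]

namespace GCWComplex

variable {G : Type u} [Group G] {Y : Type u} [TopologicalSpace Y] [MulAction G Y]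
  {B : Type u} [TopologicalSpace B] [MulAction G B]
  {D : GCWComplex G Y} {K : GCWComplex G B}

/-- The higher homotopy groups of the fixed point sets vanish. -/
def Aspherical (_ : GCWComplex G B) : Prop :=
  ∀ (H : Subgroup G) (m : ℕ) (f : C(UnitSphere (m + 3), fixedPoints H B)), ExtendsToDisk f

theorem exists_homotopicRel_mem_filt (K : GCWComplex G B) {H : Subgroup G} {n : ℕ}
    (e : C(Disk n, fixedPoints H B))
    (he : ∀ v ∈ diskBoundary n, (e v : B) ∈ K.filt (n + 1)) :
    ∃ g : C(Disk n, fixedPoints H B), e.HomotopicRel g (diskBoundary n) ∧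
      ∀ v, (g v : B) ∈ K.filt (n + 1) := by
  obtain ⟨g, ⟨F⟩, hg⟩ := K.exists_cellular_approx_fixedPoints
    (isCompact_closedBall (0 : EuclideanSpace ℝ (Fin n)) 1) (dimH_disk_lt n) e
  exact ⟨g, ⟨F.toHomotopy, fun t v hv => F.prop' t v (he v hv)⟩, hg⟩

theorem exists_path_mem_filt (K : GCWComplex G B) {H : Subgroup G} {x y : fixedPoints H B}
    (γ : Path x y) (hx : (x : B) ∈ K.filt 2) (hy : (y : B) ∈ K.filt 2) :
    ∃ γ' : Path x y, γ.Homotopic γ' ∧ ∀ t, (γ' t : B) ∈ K.filt 2 := by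
  obtain ⟨e, he⟩ := exists_interval_homeomorph
  obtain ⟨g, hg, hg2⟩ := K.exists_homotopicRel_mem_filt
    (γ.toContinuousMap.comp (e.symm : C(Disk 1, I))) (by
      intro v hv
      rw [← e.apply_symm_apply v, he] at hv
      change (γ (e.symm v) : B) ∈ _
      rcases hv with h | h
      · rw [h, γ.source]
        exact hx
      · rw [Set.mem_singleton_iff.1 h, γ.target]
        exact hy)
  have h2 := (homotopicRel_comp_homeomorph e he).2 hg
  have h3 : (γ.toContinuousMap.comp (e.symm : C(Disk 1, I))).comp (e : C(I, Disk 1)) =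
      γ.toContinuousMap := ContinuousMap.ext fun t => congrArg γ (e.symm_apply_apply t)
  rw [h3] at h2
  obtain ⟨F⟩ := h2
  refine ⟨⟨g.comp (e : C(I, Disk 1)), ?_, ?_⟩, ⟨F⟩, fun t => hg2 _⟩
  · exact (F.fst_eq_snd (Set.mem_insert _ _)).symm.trans γ.source
  · exact (F.fst_eq_snd (Set.mem_insert_of_mem _ rfl)).symm.trans γ.target

/-- The attaching map of a cell as a map to the fixed points. -/
def attach {n : ℕ} {i : D.cell n} {c : G ⧸ D.stab n i} {H : Subgroup G} (hc : CosetFixed H c) :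
    C(UnitSphere n, {z : fixedPoints H Y // (z : Y) ∈ D.filt n}) where
  toFun v := ⟨D.charFixed hc (sphereIncl n v), D.char_boundary n i c _ (norm_sphereIncl v)⟩
  continuous_toFun := by fun_prop

/-- The base point of an attaching circle may lie in the interior of an edge; one then runs along
the edge to its end. -/
theorem exists_vertex_path {H : Subgroup G} (z : D.FixedGraph H) :
    ∃ b, D.IsVertex b ∧ Nonempty (b ⟶ FundamentalGroupoid.mk z) := by
  by_cases hz : (z.1 : Y) ∈ D.filt 1
  · exact ⟨.mk z, hz, ⟨𝟙 _⟩⟩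
  · obtain ⟨i, c, v, hv, hx⟩ := D.exists_char z.2 hz
    have hc : CosetFixed H c := cosetFixed_of_char_mem hv (by rw [hx]; exact z.1.2)
    obtain rfl : z = D.edge hc v := Subtype.ext (Subtype.ext hx.symm)
    exact ⟨.mk (D.edge hc (diskPole 0)), D.char_boundary 1 i c _ (diskPole_mem 0),
      ⟨D.edgeClass hc (diskPole 0) v⟩⟩

variable [ContinuousConstSMul G Y] [ContinuousConstSMul G B]
  {Ψ : D.fundamentalGroupoidFunctor ⟶ K.fundamentalGroupoidFunctor}

/-- The 2-cell itself fills the attaching loop in Y^H, so after conjugation to a vertex its class is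
trivial there. The functor Ψ(H) sends it to an identity, and by `basedMap_graph_eq` this is the
class of the image of the conjugated loop under f. -/
theorem extendsToDisk_attach_two {f : C(D.filt 2, B)} (hf : D.FiltEquivariant f)
    (hok : ∀ m (hm : m < 2) i, CellCompatible Ψ m i (f.comp (D.charFilt hm i (baseCoset _))))
    (i : D.cell 2) :
    ExtendsToDisk ((hf.onFixed _).comp (attach (cosetFixed_baseCoset (D.stab 2 i)))) := by
  obtain ⟨p, c, hc, -⟩ := exists_circle_param.{u}
  rw [hc]
  let h : C(UnitSphere 2, D.FixedGraph (D.stab 2 i)) :=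
    attach (cosetFixed_baseCoset (D.stab 2 i))
  let incl : C(D.FixedGraph (D.stab 2 i), fixedPoints (D.stab 2 i) Y) :=
    ⟨Subtype.val, continuous_subtype_val⟩
  have h1 := (hc _ (incl.comp h)).1 ⟨D.charFixed (cosetFixed_baseCoset (D.stab 2 i)),
    fun v => rfl⟩
  let L : FundamentalGroupoid.mk (h p) ⟶ .mk (h p) :=
    FundamentalGroupoid.fromPath (Path.Homotopic.Quotient.mk (c.map h.continuous))
  have hL : (FundamentalGroupoid.map incl).map L = 𝟙 _ := Quotient.sound h1
  obtain ⟨b, hb, ⟨d⟩⟩ := exists_vertex_path (h p)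
  obtain ⟨hm, hm', hE⟩ := basedMap_graph_eq hf hok (D.stab 2 i)
  have h3 : (basedMap incl hm').map (basedClass
    (S := {z : D.FixedGraph (D.stab 2 i) | (z.1 : Y) ∈ D.filt 1}) hb hb (d ≫ L ≫ Groupoid.inv d)) = 𝟙 _ :=
    InducedCategory.hom_ext ((map_eq_id_of_conj (FundamentalGroupoid.map incl) d L).2 hL)
  have h4 : (FundamentalGroupoid.map (hf.onFixed (D.stab 2 i))).map (d ≫ L ≫ Groupoid.inv d) =
      𝟙 _ := by
    have h := map_eq_id_of_comp_eq hE _ h3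
    have h' := congrArg InducedCategory.Hom.hom h
    exact h'
  have h5 := (map_eq_id_of_conj _ d L).1 h4
  exact Quotient.exact h5

/-- The filling disk may leave the skeleton; cellular approximation relative to the boundary, inside
the fixed points, corrects this. -/
theorem exists_compatible_of_extendsToDisk {n : ℕ} {f : C(D.filt (n + 2), B)}
    (hf : D.FiltEquivariant f)
    (hok : ∀ m (hm : m < n + 2) i,
      CellCompatible Ψ m i (f.comp (D.charFilt hm i (baseCoset _))))
    (i : D.cell (n + 2))
    (h : ExtendsToDisk ((hf.onFixed _).comp (attach (cosetFixed_baseCoset (D.stab (n + 2) i))))) :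
    ∃ e : C(Disk (n + 2), B), (∀ v, e v ∈ fixedPoints (D.stab (n + 2) i) B) ∧
      (∀ (v : Disk (n + 2)) (hv : ‖(v : EuclideanSpace ℝ (Fin (n + 2)))‖ = 1),
        e v = f ⟨D.char (n + 2) i (baseCoset _) v, D.char_boundary (n + 2) i _ v hv⟩) ∧
      CellCompatible Ψ (n + 2) i e := by
  obtain ⟨F, hF⟩ := h
  have hb : ∀ (v : Disk (n + 2)) (hv : ‖(v : EuclideanSpace ℝ (Fin (n + 2)))‖ = 1),
      (F v : B) = f ⟨D.char (n + 2) i (baseCoset _) v, D.char_boundary (n + 2) i _ v hv⟩ := by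
    intro v hv
    obtain ⟨w, rfl⟩ := exists_sphereIncl hv
    exact congrArg Subtype.val (hF w)
  obtain ⟨g, ⟨T⟩, hg⟩ := K.exists_homotopicRel_mem_filt F (fun v hv => by
    rw [hb v hv]
    exact K.filt_mono (Nat.le_succ _) (mem_filt_of_cellCompatible hf hok _))
  refine ⟨⟨fun v => g v, by fun_prop⟩, fun v => (g v).2, fun v hv => ?_, fun v => hg v⟩
  rw [← hb v hv]
  exact congrArg Subtype.val (T.fst_eq_snd hv).symm

/-- A path that represents Ψ of the edge class is pushed into the 1-skeleton relative to its end
points and reparametrised by the edge. -/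
theorem exists_compatible_edge {f : C(D.filt 1, B)} (hf : D.FiltEquivariant f)
    (hok : ∀ m (hm : m < 1) i, CellCompatible Ψ m i (f.comp (D.charFilt hm i (baseCoset _))))
    (i : D.cell 1) :
    ∃ e : C(Disk 1, B), (∀ v, e v ∈ fixedPoints (D.stab 1 i) B) ∧
      (∀ (v : Disk 1) (hv : ‖(v : EuclideanSpace ℝ (Fin 1))‖ = 1),
        e v = f ⟨D.char 1 i (baseCoset _) v, D.char_boundary 1 i _ v hv⟩) ∧
      CellCompatible Ψ 1 i e := by
  obtain ⟨e, he⟩ := exists_interval_homeomorph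
  have h0 : e 0 ∈ diskBoundary 1 := (he 0).2 (by simp)
  have h1 : e 1 ∈ diskBoundary 1 := (he 1).2 (by simp)
  let E := basedMap (D.charFixed (cosetFixed_baseCoset (D.stab 1 i)))
    (charFixed_mapsTo_zeroSkel _) ⋙ component Ψ (D.stab 1 i)
  obtain ⟨γ, hγ⟩ := Path.Homotopic.Quotient.mk_surjective
    (E.map (basedClass h0 h1 (simplePath (e 0) (e 1)))).hom
  have hmem : ∀ x : RestrictedGroupoid (Disk 1) (diskBoundary 1),
      (((E.obj x).1 : fixedPoints (D.stab 1 i) B) : B) ∈ K.filt 1 := fun x => (E.obj x).2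
  obtain ⟨γ', hγ', hγ2⟩ := K.exists_path_mem_filt γ (K.filt_mono one_le_two (hmem _))
    (K.filt_mono one_le_two (hmem _))
  let g : C(Disk 1, fixedPoints (D.stab 1 i) B) :=
    γ'.toContinuousMap.comp (e.symm : C(Disk 1, I))
  have hg : ∀ (v : Disk 1) (hv : v ∈ diskBoundary 1), g v = (E.obj (basePoint v hv)).1 := by
    intro v hv
    have h := hv
    rw [← e.apply_symm_apply v, he] at h
    rcases h with h | h
    · obtain rfl : v = e 0 := (e.symm_apply_eq).1 h
      change γ' (e.symm (e 0)) = _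
      rw [e.symm_apply_apply, γ'.source]
    · obtain rfl : v = e 1 := (e.symm_apply_eq).1 h
      change γ' (e.symm (e 1)) = _
      rw [e.symm_apply_apply, γ'.target]
  have hm : Set.MapsTo g (diskBoundary 1) (K.zeroSkel (D.stab 1 i)) := by
    intro v hv
    rw [hg v hv]
    exact hmem _
  refine ⟨⟨fun v => g v, by fun_prop⟩, fun v => (g v).2, fun v hv => ?_, fun v => hγ2 _,
    g, fun v => rfl, hm, ?_⟩
  · refine (congrArg Subtype.val (hg v hv)).trans ?_
    exact (eq_vertexImage hf hok Nat.zero_lt_one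
      (D.charFixed (cosetFixed_baseCoset (D.stab 1 i)) v) (charFixed_mapsTo_zeroSkel _ hv)).symm
  · refine functor_eq_of_interval he (fun x => Subtype.ext (hg x.1 x.2)) h0 h1 ?_
    apply InducedCategory.hom_ext
    rw [InducedCategory.comp_hom, InducedCategory.comp_hom, InducedCategory_eqToHom_hom,
      InducedCategory_eqToHom_hom]
    have hs : simplePath (e 0) (e 1) = FundamentalGroupoid.fromPath (Path.Homotopic.Quotient.mk
      ⟨(e : C(I, Disk 1)), rfl, rfl⟩) := Subsingleton.elim _ _
    have hγ3 : (E.map (basedClass h0 h1 (simplePath (e 0) (e 1)))).hom =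
        FundamentalGroupoid.fromPath (Path.Homotopic.Quotient.mk γ') :=
      hγ.symm.trans (Quotient.sound hγ')
    refine Eq.trans ?_ (congrArg (fun q => eqToHom _ ≫ q ≫ eqToHom _) hγ3.symm)
    change (FundamentalGroupoid.map g).map (simplePath (e 0) (e 1)) = _
    rw [hs]
    exact mk_path_eq ((⟨(e : C(I, Disk 1)), rfl, rfl⟩ : Path (e 0) (e 1)).map g.continuous) γ'
      (fun t => congrArg γ' (e.symm_apply_apply t)) _ _

end GCWComplex

/-! ### Construction of cellular maps and of homotopies between them -/

namespace GCWComplex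

variable {G : Type u} [Group G] {Y : Type u} [TopologicalSpace Y] [MulAction G Y]
  {B : Type u} [TopologicalSpace B] [MulAction G B]
  {D : GCWComplex G Y} {K : GCWComplex G B} [ContinuousConstSMul G B]

/-- The condition on a map of a cell to the path space to be a homotopy between two maps, which
is constant on the vertices. -/
def CellHomotopy (φ φ' : CellularGMap D K) (n : ℕ) (i : D.cell n) (e : C(Disk n, C(I, B))) :
    Prop :=
  (∀ v, e v 0 = φ.toMap (D.char n i (baseCoset _) v) ∧
    e v 1 = φ'.toMap (D.char n i (baseCoset _) v)) ∧
  (n = 0 → ∀ v t, e v t = φ.toMap (D.char n i (baseCoset _) v))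

theorem cellHomotopy_apply {φ φ' : CellularGMap D K} {n : ℕ} {f : C(D.filt n, C(I, B))}
    (hf : D.FiltEquivariant f)
    (hok : ∀ m (hm : m < n) i, CellHomotopy φ φ' m i (f.comp (D.charFilt hm i (baseCoset _))))
    (x : D.filt n) : f x 0 = φ.toMap x ∧ f x 1 = φ'.toMap x ∧
      ((x : Y) ∈ D.filt 1 → ∀ t, f x t = φ.toMap x) := by
  obtain ⟨m, hm, i, c, v, hv, hx⟩ := D.exists_char_of_mem x.2
  have h1 := hok m hm i
  induction c using QuotientGroup.induction_on with
  | H a =>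
    have hxa : (x : Y) = a • D.char m i (baseCoset _) v := by
      rw [← hx, mk_eq_smul_baseCoset, D.char_smul]
    have hx' : x = ⟨a • D.char m i (baseCoset _) v, D.filt_smul n a _
        (D.charFilt hm i (baseCoset _) v).2⟩ := Subtype.ext hxa
    have h2 := hf a (D.charFilt hm i (baseCoset _) v)
    have h3 : ∀ t, f x t = a • f (D.charFilt hm i (baseCoset _) v) t := by
      intro t
      rw [hx']
      exact congrArg (fun (p : C(I, B)) => p t) h2
    refine ⟨?_, ?_, fun hx1 t => ?_⟩
    · rw [h3, hxa, φ.equivariant]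
      exact congrArg (a • ·) (h1.1 v).1
    · rw [h3, hxa, φ'.equivariant]
      exact congrArg (a • ·) (h1.1 v).2
    · have hm0 : m = 0 := by
        by_contra hm0
        refine (D.char_mem_of_lt (i := i) (c := a) hv).2 ?_
        rw [hx]
        exact D.filt_mono (Nat.one_le_iff_ne_zero.2 hm0) hx1
      rw [h3, hxa, φ.equivariant]
      exact congrArg (a • ·) (h1.2 hm0 v t)

theorem exists_cellHomotopy {φ φ' : CellularGMap D K} {n : ℕ} {i : D.cell (n + 1)}
    {f : C(D.filt (n + 1), C(I, B))}
    (F : C(I × Disk (n + 1), fixedPoints (D.stab (n + 1) i) B))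
    (hF0 : ∀ v, F (0, v) = φ.onFixedPoints _ (D.charFixed (cosetFixed_baseCoset _) v))
    (hF1 : ∀ v, F (1, v) = φ'.onFixedPoints _ (D.charFixed (cosetFixed_baseCoset _) v))
    (hFb : ∀ t (v : Disk (n + 1)) (hv : ‖(v : EuclideanSpace ℝ (Fin (n + 1)))‖ = 1),
      (F (t, v) : B) =
        f ⟨D.char (n + 1) i (baseCoset _) v, D.char_boundary (n + 1) i _ v hv⟩ t) :
    ∃ e : C(Disk (n + 1), C(I, B)), (∀ v, e v ∈ fixedPoints (D.stab (n + 1) i) C(I, B)) ∧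
      (∀ (v : Disk (n + 1)) (hv : ‖(v : EuclideanSpace ℝ (Fin (n + 1)))‖ = 1),
        e v = f ⟨D.char (n + 1) i (baseCoset _) v, D.char_boundary (n + 1) i _ v hv⟩) ∧
      CellHomotopy φ φ' (n + 1) i e := by
  let E : C(Disk (n + 1) × I, B) := ⟨fun p => F (p.2, p.1), by fun_prop⟩
  refine ⟨E.curry, fun v g => ContinuousMap.ext fun t => (F (t, v)).2 g,
    fun v hv => ContinuousMap.ext fun t => hFb t v hv, fun v => ⟨?_, ?_⟩, by simp⟩
  · exact congrArg Subtype.val (hF0 v)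
  · exact congrArg Subtype.val (hF1 v)

/-- On the cylinder over an (n+2)-cell the two ends and the side are given. Their union is a sphere
of dimension n + 2 ≥ 2 in the fixed points, which asphericity fills. -/
theorem exists_cellHomotopy_add_two (hK : K.Aspherical) {φ φ' : CellularGMap D K} {n : ℕ}
    (i : D.cell (n + 2)) {f : C(D.filt (n + 2), C(I, B))} (hf : D.FiltEquivariant f)
    (hok : ∀ m (hm : m < n + 2) i,
      CellHomotopy φ φ' m i (f.comp (D.charFilt hm i (baseCoset _)))) :
    ∃ e : C(Disk (n + 2), C(I, B)), (∀ v, e v ∈ fixedPoints (D.stab (n + 2) i) C(I, B)) ∧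
      (∀ (v : Disk (n + 2)) (hv : ‖(v : EuclideanSpace ℝ (Fin (n + 2)))‖ = 1),
        e v = f ⟨D.char (n + 2) i (baseCoset _) v, D.char_boundary (n + 2) i _ v hv⟩) ∧
      CellHomotopy φ φ' (n + 2) i e := by
  let q : C(UnitSphere (n + 2), fixedPoints (D.stab (n + 2) i) C(I, B)) :=
    (hf.onFixed _).comp (attach (cosetFixed_baseCoset (D.stab (n + 2) i)))
  let k : C(I × UnitSphere (n + 2), fixedPoints (D.stab (n + 2) i) B) :=
    ⟨fun p => ⟨(q p.2).1 p.1, fun g => congrArg (fun r : C(I, B) => r p.1) ((q p.2).2 g)⟩,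
      by fun_prop⟩
  obtain ⟨F, hF0, hF1, hFb⟩ := exists_cylinder_extension (hK (D.stab (n + 2) i) n)
    ((φ.onFixedPoints _).comp (D.charFixed (cosetFixed_baseCoset (D.stab (n + 2) i))))
    ((φ'.onFixedPoints _).comp (D.charFixed (cosetFixed_baseCoset (D.stab (n + 2) i)))) k
    (fun v => Subtype.ext (cellHomotopy_apply hf hok _).1)
    (fun v => Subtype.ext (cellHomotopy_apply hf hok _).2.1)
  refine exists_cellHomotopy F hF0 hF1 fun t v hv => ?_
  obtain ⟨w, rfl⟩ := exists_sphereIncl hv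
  exact congrArg Subtype.val (hFb t w)

variable [ContinuousConstSMul G Y]

theorem exists_compatible_map (hK : K.Aspherical)
    (Ψ : D.fundamentalGroupoidFunctor ⟶ K.fundamentalGroupoidFunctor) :
    ∃ F : C(Y, B), (∀ (g : G) (y : Y), F (g • y) = g • F y) ∧
      ∀ n i, CellCompatible Ψ n i
        (F.comp ⟨D.char n i (baseCoset _), D.char_continuous n i _⟩) := by
  refine D.exists_of_cells (CellCompatible Ψ) ?_
  rintro (_ | _ | _ | n) f hf hok i
  · have hs : Subsingleton (Disk 0) := ⟨fun a b => Subtype.ext (Subsingleton.elim _ _)⟩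
    let v₀ : Disk 0 := ⟨0, by simp⟩
    refine ⟨.const _ (vertexImage Ψ (D.charFixed (cosetFixed_baseCoset (D.stab 0 i)) v₀)
      (charFixed_mem_zeroSkel _ v₀)), fun v => Subtype.property _, fun v hv => ?_, fun v => ?_⟩
    · exact absurd (D.char_boundary 0 i (baseCoset _) v hv) (by simp [D.filt_zero])
    · rw [Subsingleton.elim v v₀]
      rfl
  · exact exists_compatible_edge hf hok i
  · exact exists_compatible_of_extendsToDisk hf hok i (extendsToDisk_attach_two hf hok i)
  · exact exists_compatible_of_extendsToDisk hf hok i (hK _ n _)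

/-- The transformation induced by the constructed map and Ψ agree on the graph of fixed points in
the 1-skeleton. Each path class between vertices of Y^H is represented there, so they agree
everywhere. -/
theorem exists_cellularGMap (hK : K.Aspherical)
    (Ψ : D.fundamentalGroupoidFunctor ⟶ K.fundamentalGroupoidFunctor) :
    ∃ φ : CellularGMap D K, φ.sharp = Ψ := by
  obtain ⟨F, hF, hok⟩ := exists_compatible_map hK Ψ
  let f : ∀ n, C(D.filt n, B) := fun n => F.comp ⟨Subtype.val, continuous_subtype_val⟩
  have hf : ∀ n, D.FiltEquivariant (f n) := fun n g x => hF g x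
  have hfok : ∀ n, ∀ m (hm : m < n) i,
      CellCompatible Ψ m i ((f n).comp (D.charFilt hm i (baseCoset _))) := fun n m _ i => hok m i
  let φ : CellularGMap D K := ⟨F, hF, fun n y hy =>
    mem_filt_of_cellCompatible (hf (n + 1)) (hfok (n + 1)) ⟨y, hy⟩⟩
  refine ⟨φ, NatTrans.ext (funext ?_)⟩
  rintro ⟨⟨H⟩⟩
  change basedMap (φ.onFixedPoints H) (φ.onFixedPoints_mapsTo H) = component Ψ H
  obtain ⟨hm, hm', hE⟩ := basedMap_graph_eq (hf 2) (hfok 2) H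
  have h1 : basedMap _ hm' ⋙ basedMap (φ.onFixedPoints H) (φ.onFixedPoints_mapsTo H) =
      basedMap _ hm' ⋙ component Ψ H :=
    (basedMap_comp _ _ hm' _).trans ((basedMap_congr rfl _ hm).trans hE)
  refine functor_eq_of_comp_eq h1 (fun x => ⟨basePoint ⟨x.1, D.filt_mono one_le_two x.2⟩ x.2, rfl⟩)
    fun a b p => ?_
  obtain ⟨γ, hγ⟩ := Path.Homotopic.Quotient.mk_surjective p.hom
  obtain ⟨γ', hγ', hmem⟩ := D.exists_path_mem_filt γ a.1.2 b.1.2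
  refine ⟨basedClass (S := {z : D.FixedGraph H | (z.1 : Y) ∈ D.filt 1}) a.2 b.2
    (FundamentalGroupoid.fromPath (Path.Homotopic.Quotient.mk
      (⟨⟨fun t => ⟨γ' t, hmem t⟩, by fun_prop⟩, Subtype.ext γ'.source,
        Subtype.ext γ'.target⟩ : Path a.1 b.1))), InducedCategory.hom_ext ?_⟩
  refine Eq.trans ?_ hγ
  exact (Quotient.sound hγ').symm

/-- A path in the fixed points, given on the boundary of the cylinder on a cell. -/
theorem exists_homotopicRel_edge {φ φ' : CellularGMap D K} (h : φ.sharp = φ'.sharp)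
    (i : D.cell 1) :
    ((φ.onFixedPoints _).comp (D.charFixed (cosetFixed_baseCoset (D.stab 1 i)))).HomotopicRel
      ((φ'.onFixedPoints _).comp (D.charFixed (cosetFixed_baseCoset (D.stab 1 i))))
      (diskBoundary 1) := by
  obtain ⟨e, he⟩ := exists_interval_homeomorph
  have h0 : e 0 ∈ diskBoundary 1 := (he 0).2 (by simp)
  have h1 : e 1 ∈ diskBoundary 1 := (he 1).2 (by simp)
  rw [← homotopicRel_comp_homeomorph e he]
  have hcomp : basedMap (φ.onFixedPoints (D.stab 1 i)) (φ.onFixedPoints_mapsTo _) =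
      basedMap (φ'.onFixedPoints (D.stab 1 i)) (φ'.onFixedPoints_mapsTo _) :=
    congrArg (fun Ψ => component Ψ (D.stab 1 i)) h
  have hobj : ∀ v ∈ diskBoundary 1,
      φ.onFixedPoints _ (D.charFixed (cosetFixed_baseCoset (D.stab 1 i)) v) =
      φ'.onFixedPoints _ (D.charFixed (cosetFixed_baseCoset (D.stab 1 i)) v) := fun v hv =>
    congrArg (Subtype.val (p := fun x => x ∈ K.zeroSkel _)) (Functor.congr_obj hcomp
      (basePoint _ (charFixed_mapsTo_zeroSkel (cosetFixed_baseCoset (D.stab 1 i)) hv)))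
  let ℓ : Path (D.charFixed (cosetFixed_baseCoset (D.stab 1 i)) (e 0))
    (D.charFixed (cosetFixed_baseCoset (D.stab 1 i)) (e 1)) :=
    ⟨(D.charFixed (cosetFixed_baseCoset (D.stab 1 i))).comp (e : C(I, Disk 1)), rfl, rfl⟩
  have h2 := Functor.congr_hom hcomp (basedClass (charFixed_mapsTo_zeroSkel _ h0)
    (charFixed_mapsTo_zeroSkel _ h1) (FundamentalGroupoid.fromPath (.mk ℓ)))
  have h3 := congrArg InducedCategory.Hom.hom h2
  rw [InducedCategory.comp_hom, InducedCategory.comp_hom, InducedCategory_eqToHom_hom,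
      InducedCategory_eqToHom_hom] at h3
  -- Equality of functors compares path classes with different end point terms; casting the second
  -- path absorbs the `eqToHom`s and leaves an honest homotopy of paths.
  have h4 := mk_path_eq ((ℓ.map (φ'.onFixedPoints _).continuous).cast (hobj _ h0) (hobj _ h1))
    (ℓ.map (φ'.onFixedPoints _).continuous) (fun t => rfl)
    (congrArg FundamentalGroupoid.mk (hobj _ h0))
    (congrArg FundamentalGroupoid.mk (hobj _ h1).symm)
  have h5 : FundamentalGroupoid.fromPath (Path.Homotopic.Quotient.mk
      (ℓ.map (φ.onFixedPoints _).continuous)) = FundamentalGroupoid.fromPath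
      (Path.Homotopic.Quotient.mk ((ℓ.map (φ'.onFixedPoints _).continuous).cast
        (hobj _ h0) (hobj _ h1))) := h3.trans h4.symm
  exact Quotient.exact h5

theorem exists_cellHomotopy_zero {φ φ' : CellularGMap D K} (h : φ.sharp = φ'.sharp) (i : D.cell 0)
    (f : C(D.filt 0, C(I, B))) :
    ∃ e : C(Disk 0, C(I, B)), (∀ v, e v ∈ fixedPoints (D.stab 0 i) C(I, B)) ∧
      (∀ (v : Disk 0) (hv : ‖(v : EuclideanSpace ℝ (Fin 0))‖ = 1),
        e v = f ⟨D.char 0 i (baseCoset _) v, D.char_boundary 0 i _ v hv⟩) ∧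
      CellHomotopy φ φ' 0 i e := by
  have hs : Subsingleton (Disk 0) := ⟨fun a b => Subtype.ext (Subsingleton.elim _ _)⟩
  refine ⟨⟨fun v => .const _ (φ.toMap (D.char 0 i (baseCoset _) v)),
    continuous_of_discreteTopology⟩, fun v g => ContinuousMap.ext fun t =>
    (φ.onFixedPoints _ (D.charFixed (cosetFixed_baseCoset (D.stab 0 i)) v)).2 g, fun v hv => ?_,
    fun v => ⟨rfl, ?_⟩, fun _ v t => rfl⟩
  · exact absurd (D.char_boundary 0 i (baseCoset _) v hv) (by simp [D.filt_zero])
  · exact congrArg (Subtype.val (p := fun x => x ∈ fixedPoints (D.stab 0 i) B))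
      (congrArg (Subtype.val (p := fun x => x ∈ K.zeroSkel _)) (Functor.congr_obj
        (congrArg (fun Ψ => component Ψ (D.stab 0 i)) h)
        (basePoint (D.charFixed (cosetFixed_baseCoset (D.stab 0 i)) v)
          (charFixed_mem_zeroSkel _ v))))

theorem exists_cellHomotopy_one {φ φ' : CellularGMap D K} (h : φ.sharp = φ'.sharp) (i : D.cell 1)
    {f : C(D.filt 1, C(I, B))} (hf : D.FiltEquivariant f)
    (hok : ∀ m (hm : m < 1) i, CellHomotopy φ φ' m i (f.comp (D.charFilt hm i (baseCoset _)))) :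
    ∃ e : C(Disk 1, C(I, B)), (∀ v, e v ∈ fixedPoints (D.stab 1 i) C(I, B)) ∧
      (∀ (v : Disk 1) (hv : ‖(v : EuclideanSpace ℝ (Fin 1))‖ = 1),
        e v = f ⟨D.char 1 i (baseCoset _) v, D.char_boundary 1 i _ v hv⟩) ∧
      CellHomotopy φ φ' 1 i e := by
  obtain ⟨F⟩ := exists_homotopicRel_edge h i
  refine exists_cellHomotopy F.toContinuousMap F.apply_zero F.apply_one fun t v hv => ?_
  have hmem := D.char_boundary 1 i (baseCoset _) v hv
  rw [(cellHomotopy_apply hf hok ⟨D.char 1 i (baseCoset _) v, hmem⟩).2.2 hmem t]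
  exact congrArg Subtype.val (F.eq_fst t hv)

/-- With the pointwise action on C(I, B), a G-homotopy is an equivariant map Y → C(I, B), so the
cell-by-cell construction of maps applies verbatim. -/
theorem gHomotopic_of_sharp_eq (hK : K.Aspherical) {φ φ' : CellularGMap D K}
    (h : φ.sharp = φ'.sharp) : GHomotopic G φ.toMap φ'.toMap := by
  obtain ⟨F, hF, hFok⟩ := D.exists_of_cells (Z := C(I, B)) (CellHomotopy φ φ') (by
    rintro (_ | _ | n) f hf hok i
    · exact exists_cellHomotopy_zero h i f
    · exact exists_cellHomotopy_one h i hf hok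
    · exact exists_cellHomotopy_add_two hK i hf hok)
  have hall : ∀ y, F y 0 = φ.toMap y ∧ F y 1 = φ'.toMap y := by
    intro y
    obtain ⟨n, hn⟩ := D.exists_mem_filt y
    have := cellHomotopy_apply (n := n) (f := F.comp ⟨Subtype.val, continuous_subtype_val⟩)
      (fun g x => hF g x) (fun m _ i => hFok m i) ⟨y, hn⟩
    exact ⟨this.1, this.2.1⟩
  refine ⟨⟨⟨fun p => F p.2 p.1, by fun_prop⟩, fun y => (hall y).1, fun y => (hall y).2⟩,
    fun t g y => ?_⟩
  exact congrArg (fun q : C(I, B) => q t) (hF g y)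

end GCWComplex

/-! ### The universal property of universal spaces -/

variable {G : Type u} [Group G] {P : (Orb G)ᵒᵖ ⥤ Grpd.{u, u}}
  {B : Type u} [TopologicalSpace B] [MulAction G B] [ContinuousConstSMul G B]

theorem UniversalSpace.aspherical_cw (BP : UniversalSpace P B) : BP.cw.Aspherical := fun H m =>
  (forall_subsingleton_pi_iff (m + 1)).1 (BP.aspherical H (m + 2) (by omega))

theorem UniversalSpace.exists_sharp_comp_eq (BP : UniversalSpace P B) {Y : Type u}
    [TopologicalSpace Y] [MulAction G Y] [ContinuousConstSMul G Y] {D : GCWComplex G Y}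
    (Φ : D.fundamentalGroupoidFunctor ⟶ P) :
    ∃ φ : CellularGMap D BP.cw, φ.sharp ≫ BP.ident.hom = Φ := by
  obtain ⟨φ, hφ⟩ := GCWComplex.exists_cellularGMap BP.aspherical_cw (Φ ≫ BP.ident.inv)
  exact ⟨φ, by rw [hφ]; simp⟩

theorem UniversalSpace.gHomotopic (BP : UniversalSpace P B) {Y : Type u}
    [TopologicalSpace Y] [MulAction G Y] [ContinuousConstSMul G Y] {D : GCWComplex G Y}
    {Φ : D.fundamentalGroupoidFunctor ⟶ P} {φ φ' : CellularGMap D BP.cw}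
    (h : φ.sharp ≫ BP.ident.hom = Φ) (h' : φ'.sharp ≫ BP.ident.hom = Φ) :
    GHomotopic G φ.toMap φ'.toMap := by
  refine GCWComplex.gHomotopic_of_sharp_eq BP.aspherical_cw ?_
  rw [← cancel_mono BP.ident.hom, h, h']

/-! ### The objects of the fundamental groupoid functor -/

namespace GCWComplex

variable {G : Type u} [Group G] {X : Type u} [TopologicalSpace X] [MulAction G X]
  (C : GCWComplex G X)

/-- The action of `G` on the vertices. -/
instance vertexAction : MulAction G (C.skel 0) where
  smul g x := ⟨g • (x : X), C.filt_smul 1 g x x.2⟩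
  one_smul x := Subtype.ext (one_smul G (x : X))
  mul_smul g h x := Subtype.ext (mul_smul g h (x : X))

/-- The vertices of the fixed point sets are the fixed points of the `G`-set of vertices. -/
def zeroSkelEquiv (H : Subgroup G) : C.zeroSkel H ≃ fixedPoints H (C.skel 0) where
  toFun x := ⟨⟨x.1, x.2⟩, fun h => Subtype.ext (x.1.2 h)⟩
  invFun x := ⟨⟨x.1, fun h => congrArg Subtype.val (x.2 h)⟩, x.1.2⟩

/-- The objects of the fundamental groupoid functor are the fixed points of a `G`-set. -/
def objectsIso [ContinuousConstSMul G X] :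
    C.fundamentalGroupoidFunctor ⋙ Grpd.objects ≅ fixedPointFunctor G (C.skel 0) :=
  NatIso.ofComponents (fun H => (C.zeroSkelEquiv H.unop.sub).toIso) (by
    intro H K α
    ext x
    have key : ∀ c : G ⧸ H.unop.sub, cosetSMul c x.1 =
        (cosetSMul c (C.zeroSkelEquiv H.unop.sub x) : C.skel 0) := by
      intro c
      induction c using QuotientGroup.induction_on with
      | H a => rfl
    exact Subtype.ext (Subtype.ext (key _)))

end GCWComplex

theorem UniversalSpace.objectsAreFixedPoints {G : Type u} [Group G] {P : (Orb G)ᵒᵖ ⥤ Grpd.{u, u}}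
    {B : Type u} [TopologicalSpace B] [MulAction G B] [ContinuousConstSMul G B]
    (BP : UniversalSpace P B) : ObjectsAreFixedPoints P :=
  ⟨BP.cw.skel 0, inferInstance,
    ⟨(Functor.isoWhiskerRight BP.ident Grpd.objects).symm ≪≫ BP.cw.objectsIso⟩⟩

/-! ### The space of functions with the distance in measure -/

section StepSpace

open MeasureTheory

/-- The functions from `[0, 1)` to a set; the distance of two functions is the outer measure of the
set where they differ. -/
def StepSpace (A : Type*) : Type _ := Set.Ico (0 : ℝ) 1 → A

namespace StepSpace

variable {A B : Type*}

/-- The set where two functions differ. -/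
def diff (f g : StepSpace A) : Set ℝ := Subtype.val '' {s | f s ≠ g s}

theorem diff_subset (f g : StepSpace A) : diff f g ⊆ Set.Ico 0 1 :=
  Subtype.coe_image_subset _ _

theorem volume_ne_top {s : Set ℝ} (hs : s ⊆ Set.Ico 0 1) : volume s ≠ ⊤ :=
  ((measure_mono hs).trans_lt (by simp)).ne

instance : PseudoMetricSpace (StepSpace A) where
  dist f g := (volume (diff f g)).toReal
  dist_self f := by simp [diff]
  dist_comm f g := by simp only [diff, ne_comm]
  dist_triangle f g h := by
    rw [← ENNReal.toReal_add (volume_ne_top (diff_subset f g)) (volume_ne_top (diff_subset g h))]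
    refine ENNReal.toReal_mono (ENNReal.add_ne_top.2 ⟨volume_ne_top (diff_subset f g),
      volume_ne_top (diff_subset g h)⟩) ((measure_mono ?_).trans (measure_union_le _ _))
    rintro _ ⟨s, hs, rfl⟩
    by_cases h1 : f s = g s
    · exact Or.inr ⟨s, fun h2 => hs (h1.trans h2), rfl⟩
    · exact Or.inl ⟨s, h1, rfl⟩

theorem dist_def (f g : StepSpace A) : dist f g = (volume (diff f g)).toReal := rfl

theorem dist_le_of_diff_subset {f g : StepSpace A} {f' g' : StepSpace B}
    (h : ∀ s, f s = g s → f' s = g' s) : dist f' g' ≤ dist f g := by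
  refine ENNReal.toReal_mono (volume_ne_top (diff_subset f g)) (measure_mono ?_)
  rintro _ ⟨s, hs, rfl⟩
  exact ⟨s, fun h1 => hs (h s h1), rfl⟩

/-- Functions that differ everywhere have distance 1, the length of [0,1). Nearby functions
therefore share a value, which is what separates the sheets of the covering below. -/
theorem exists_eq_of_dist_lt {f g : StepSpace A} (h : dist f g < 1) : ∃ s, f s = g s := by
  by_contra! h'
  have : diff f g = Set.Ico 0 1 := by
    rw [diff, Set.eq_univ_of_forall (s := {s | f s ≠ g s}) h']
    rw [Set.image_univ, Subtype.range_coe]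
  rw [dist_def, this] at h
  simp at h

/-- The map induced by a map of sets. -/
def map (φ : A → B) : C(StepSpace A, StepSpace B) where
  toFun f s := φ (f s)
  continuous_toFun := LipschitzWith.continuous (K := 1) (LipschitzWith.of_dist_le_mul fun f g => by
    rw [NNReal.coe_one, one_mul]
    exact dist_le_of_diff_subset fun s h => congrArg φ h)

/-- The constant function. -/
def const (x : A) : StepSpace A := fun _ => x

open Classical in
/-- Replace the values on `[0, t)` by a constant. -/
def shrink (x : A) (t : I) (f : StepSpace A) : StepSpace A :=
  fun s => if (s : ℝ) < t then x else f s

/-- Moving t to t' changes values only on the interval between them. This is the joint continuity of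
the contraction, and it needs no measurability of the functions since the distance is an outer
measure. -/
theorem dist_shrink_le (x : A) (t t' : I) (f f' : StepSpace A) :
    dist (shrink x t f) (shrink x t' f') ≤ dist t t' + dist f f' := by
  refine (dist_triangle _ (shrink x t' f) _).trans (add_le_add ?_
    (dist_le_of_diff_subset fun s h => by simp [shrink, h]))
  have h1 : diff (shrink x t f) (shrink x t' f) ⊆ Set.uIcc (t : ℝ) t' := by
    rintro _ ⟨s, hs, rfl⟩
    rw [Set.mem_uIcc]
    by_contra! h
    refine hs ?_
    unfold shrink
    by_cases h1 : (s : ℝ) < t <;> by_cases h2 : (s : ℝ) < t' <;> simp only [h1, h2, if_true, if_false]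
    · exact absurd (h.2 (not_lt.1 h2)) (not_lt.2 h1.le)
    · exact absurd (h.1 (not_lt.1 h1)) (not_lt.2 h2.le)
  refine (ENNReal.toReal_mono (by simp) (measure_mono h1)).trans ?_
  rw [Real.volume_interval, ENNReal.toReal_ofReal (abs_nonneg _), Subtype.dist_eq, Real.dist_eq,
    abs_sub_comm]

/-- The contraction to a constant function. -/
def contraction (x : A) : C(I × StepSpace A, StepSpace A) where
  toFun p := shrink x p.1 p.2
  continuous_toFun := LipschitzWith.continuous (K := 2) (LipschitzWith.of_dist_le_mul fun p q => by
    refine (dist_shrink_le _ _ _ _ _).trans ?_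
    rw [NNReal.coe_ofNat, two_mul]
    exact add_le_add (le_max_left _ _) (le_max_right _ _))

instance [Nonempty A] : ContractibleSpace (StepSpace A) := by
  obtain ⟨x⟩ := ‹Nonempty A›
  rw [contractible_iff_id_nullhomotopic]
  refine ⟨const x, ⟨⟨contraction x, fun f => funext fun s => ?_, fun f => funext fun s => ?_⟩⟩⟩
  · change (if (s : ℝ) < ((0 : I) : ℝ) then x else f s) = f s
    rw [if_neg (by simpa using s.2.1)]
  · change (if (s : ℝ) < ((1 : I) : ℝ) then x else f s) = x
    rw [if_pos (by simpa using s.2.2)]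

end StepSpace

end StepSpace

/-! ### The classifying space of a groupoid -/

section Classifying

variable (A : Type u) [Groupoid.{u} A]

/-- The contractible space of functions from `[0, 1)` to the morphisms out of an object. -/
abbrev StarSpace {A : Type u} [Groupoid.{u} A] (a : A) : Type u := StepSpace (Σ b, (a ⟶ b))

instance {A : Type u} [Groupoid.{u} A] (a : A) : Nonempty (Σ b, (a ⟶ b)) := ⟨⟨a, 𝟙 a⟩⟩

variable {A}

/-- Composition with a morphism. -/
def starComp {a b : A} (h : a ⟶ b) : C(StarSpace b, StarSpace a) :=
  StepSpace.map fun p => ⟨p.1, h ≫ p.2⟩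

theorem starComp_id {a : A} (f : StarSpace a) : starComp (𝟙 a) f = f := by
  funext s
  exact Sigma.ext rfl (heq_of_eq (Category.id_comp _))

theorem starComp_comp {a b c : A} (h : a ⟶ b) (k : b ⟶ c) (f : StarSpace c) :
    starComp (h ≫ k) f = starComp h (starComp k f) := by
  funext s
  exact Sigma.ext rfl (heq_of_eq (Category.assoc _ _ _))

theorem starComp_inv_comp {a b : A} (h : a ⟶ b) (f : StarSpace b) :
    starComp (Groupoid.inv h) (starComp h f) = f := by
  rw [← starComp_comp, Groupoid.inv_comp, starComp_id]

theorem starComp_comp_inv {a b : A} (h : a ⟶ b) (f : StarSpace a) :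
    starComp h (starComp (Groupoid.inv h) f) = f := by
  rw [← starComp_comp, Groupoid.comp_inv, starComp_id]

/-- The value at a constant function. -/
theorem starComp_const {a b c : A} (h : a ⟶ b) (k : b ⟶ c) :
    starComp h (StepSpace.const ⟨c, k⟩) = StepSpace.const ⟨c, h ≫ k⟩ := rfl

/-- Morphisms of a groupoid cancel, so the action by composition is free already at each single
parameter s. -/
theorem eq_of_starComp_apply_eq {a b : A} {h h' : a ⟶ b} {f : StarSpace b}
    {s : Set.Ico (0 : ℝ) 1} (e : starComp h f s = starComp h' f s) : h = h' := by
  have e1 : (⟨(f s).1, h ≫ (f s).2⟩ : Σ c, (a ⟶ c)) = ⟨(f s).1, h' ≫ (f s).2⟩ := e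
  have e2 := eq_of_heq (Sigma.mk.inj e1).2
  exact (cancel_mono _).1 e2

variable (A) in
/-- Functions are identified if they differ by composition with a morphism. -/
def classifyingSetoid : Setoid (Σ a : A, StarSpace a) where
  r x y := ∃ h : x.1 ⟶ y.1, x.2 = starComp h y.2
  iseqv :=
    { refl x := ⟨𝟙 _, (starComp_id _).symm⟩
      symm := by
        rintro x y ⟨h, e⟩
        exact ⟨Groupoid.inv h, by rw [e, starComp_inv_comp]⟩
      trans := by
        rintro x y z ⟨h, e⟩ ⟨k, e'⟩
        exact ⟨h ≫ k, by rw [e, e', starComp_comp]⟩ }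

variable (A) in
/-- The classifying space of a groupoid. -/
def ClassifyingSpace : Type u := Quotient (classifyingSetoid A)

namespace ClassifyingSpace

instance : TopologicalSpace (ClassifyingSpace A) :=
  inferInstanceAs (TopologicalSpace (Quotient (classifyingSetoid A)))

variable (A) in
/-- The projection. -/
def proj : C(Σ a : A, StarSpace a, ClassifyingSpace A) :=
  ⟨Quotient.mk (classifyingSetoid A), continuous_quotient_mk'⟩

theorem proj_eq_iff {x y : Σ a : A, StarSpace a} :
    proj A x = proj A y ↔ ∃ h : x.1 ⟶ y.1, x.2 = starComp h y.2 :=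
  Quotient.eq (r := classifyingSetoid A)

theorem proj_surjective : Function.Surjective (proj A) := Quotient.mk_surjective

/-- The projection from one of the contractible spaces. -/
def starProj (a : A) : C(StarSpace a, ClassifyingSpace A) := (proj A).comp (.sigmaMk a)

theorem starProj_starComp {a b : A} (h : a ⟶ b) (f : StarSpace b) :
    starProj a (starComp h f) = starProj b f := proj_eq_iff.2 ⟨h, rfl⟩

/-- The saturation of an open set is a union of preimages under the continuous maps `starComp h`. -/
theorem isOpenMap_proj : IsOpenMap (proj A) := by
  intro U hU
  change IsOpen (Quotient.mk (classifyingSetoid A) '' U)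
  rw [← isQuotientMap_quotient_mk'.isOpen_preimage, isOpen_sigma_iff]
  intro b
  have : Sigma.mk b ⁻¹' (Quotient.mk (classifyingSetoid A) ⁻¹'
      (Quotient.mk (classifyingSetoid A) '' U)) =
      ⋃ a, ⋃ h : a ⟶ b, starComp h ⁻¹' (Sigma.mk a ⁻¹' U) := by
    ext f
    simp only [Set.mem_preimage, Set.mem_image, Set.mem_iUnion]
    constructor
    · rintro ⟨⟨a, g⟩, hg, e⟩
      obtain ⟨h, e'⟩ := Quotient.exact e
      refine ⟨a, h, ?_⟩
      rwa [← e']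
    · rintro ⟨a, h, hf⟩
      exact ⟨⟨a, starComp h f⟩, hf, Quotient.sound ⟨h, rfl⟩⟩
  refine (congrArg IsOpen this).mpr ?_
  exact isOpen_iUnion fun a => isOpen_iUnion fun h =>
    ((isOpen_sigma_iff.1 hU a).preimage (starComp h).continuous)

/-- Around a point take the image of a ball of radius 1/2; its sheets are the translates of the ball
by the morphisms h : b ⟶ a. Two functions in the ball have distance less than 1 and share a value,
so by freeness different translates are disjoint and each maps injectively. -/
theorem isCoveringMap_proj : IsCoveringMap (proj A) := by
  have key : ∀ w : ClassifyingSpace A, ∃ (a : A) (f : StarSpace a), starProj a f = w := by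
    intro w
    obtain ⟨⟨a, f⟩, e⟩ := proj_surjective w
    exact ⟨a, f, e⟩
  choose a f hf using key
  let ι (w : ClassifyingSpace A) : Type u := Σ b, (b ⟶ a w)
  let (w : ClassifyingSpace A) : TopologicalSpace (ι w) := ⊥
  have (w : ClassifyingSpace A) : DiscreteTopology (ι w) := ⟨rfl⟩
  have (w : ClassifyingSpace A) : Nonempty (ι w) := ⟨⟨a w, 𝟙 _⟩⟩
  let ball (w : ClassifyingSpace A) : Set (StarSpace (a w)) := Metric.ball (f w) (1 / 2)
  let U (w : ClassifyingSpace A) (i : ι w) : Set (Σ a : A, StarSpace a) :=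
    Sigma.mk i.1 '' (starComp i.2 '' ball w)
  let V (w : ClassifyingSpace A) : Set (ClassifyingSpace A) := starProj (a w) '' ball w
  have hdist : ∀ w, ∀ x ∈ ball w, ∀ y ∈ ball w, dist x y < 1 := by
    intro w x hx y hy
    have := dist_triangle_right x y (f w)
    rw [Metric.mem_ball] at hx hy
    linarith
  have hUo : ∀ w i, IsOpen (U w i) := by
    intro w i
    refine isOpenMap_sigmaMk _ ?_
    have : starComp i.2 '' ball w = starComp (Groupoid.inv i.2) ⁻¹' ball w := by
      ext y
      constructor
      · rintro ⟨x, hx, rfl⟩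
        rwa [Set.mem_preimage, starComp_inv_comp]
      · intro hy
        exact ⟨_, hy, starComp_comp_inv _ _⟩
    rw [this]
    exact Metric.isOpen_ball.preimage (starComp _).continuous
  have hVo : ∀ w, IsOpen (V w) := by
    intro w
    have : V w = proj A '' (Sigma.mk (a w) '' ball w) := by
      rw [Set.image_image]
      rfl
    rw [this]
    exact isOpenMap_proj _ (isOpenMap_sigmaMk _ Metric.isOpen_ball)
  have hsurj : ∀ w i, (U w i).SurjOn (proj A) (V w) := by
    rintro w i _ ⟨x, hx, rfl⟩
    exact ⟨⟨i.1, starComp i.2 x⟩, ⟨_, ⟨x, hx, rfl⟩, rfl⟩, starProj_starComp _ _⟩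
  have hinj : ∀ w i, (U w i).InjOn (proj A) := by
    rintro w i _ ⟨_, ⟨x, hx, rfl⟩, rfl⟩ _ ⟨_, ⟨y, hy, rfl⟩, rfl⟩ e
    have e' : proj A ⟨a w, x⟩ = proj A ⟨a w, y⟩ :=
      (starProj_starComp i.2 x).symm.trans (Eq.trans e (starProj_starComp i.2 y))
    obtain ⟨k, hk⟩ := proj_eq_iff.1 e'
    obtain ⟨s, hs⟩ := StepSpace.exists_eq_of_dist_lt (hdist w x hx y hy)
    -- At the common parameter s both k and the identity send y(s) to the same value, so freeness
    -- gives k = 𝟙.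
    have hk1 : k = 𝟙 _ := by
      refine eq_of_starComp_apply_eq (f := y) (s := s) ?_
      rw [starComp_id, ← hs]
      exact (congrFun hk s).symm
    have hxy : x = y := by
      have hk' : x = starComp k y := hk
      rw [hk', hk1, starComp_id]
    rw [hxy]
  have hdisj : ∀ w, Pairwise (Function.onFun Disjoint (U w)) := by
    rintro w ⟨b, h⟩ ⟨b', h'⟩ hne
    refine Set.disjoint_left.2 ?_
    rintro _ ⟨_, ⟨x, hx, rfl⟩, rfl⟩ ⟨_, ⟨y, hy, rfl⟩, e⟩
    refine hne ?_
    obtain ⟨rfl, e⟩ := Sigma.mk.inj e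
    have e' := eq_of_heq e
    obtain ⟨s, hs⟩ := StepSpace.exists_eq_of_dist_lt (hdist w x hx y hy)
    congr 1
    refine eq_of_starComp_apply_eq (f := x) (s := s) ?_
    rw [← congrFun e' s]
    change (⟨(y s).1, h' ≫ (y s).2⟩ : Σ c, (_ ⟶ c)) = ⟨(x s).1, h' ≫ (x s).2⟩
    rw [hs]
  have hexh : ∀ w, proj A ⁻¹' (V w) ⊆ ⋃ i, U w i := by
    rintro w ⟨b, y⟩ ⟨x, hx, e⟩
    obtain ⟨h, hh⟩ := proj_eq_iff.1 e.symm
    exact Set.mem_iUnion.2 ⟨⟨b, h⟩, _, ⟨x, hx, hh.symm⟩, rfl⟩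
  have hW : ∀ w i {W : Set (ClassifyingSpace A)}, W ⊆ V w →
      (IsOpen W ↔ IsOpen (proj A ⁻¹' W ∩ U w i)) := by
    intro w i W hWV
    refine ⟨fun h => (h.preimage (proj A).continuous).inter (hUo w i), fun h => ?_⟩
    have : W = proj A '' (proj A ⁻¹' W ∩ U w i) := by
      ext x
      constructor
      · intro hx
        obtain ⟨y, hy, rfl⟩ := hsurj w i (hWV hx)
        exact ⟨y, ⟨hx, hy⟩, rfl⟩
      · rintro ⟨y, ⟨hy, -⟩, rfl⟩
        exact hy
    rw [this]
    exact isOpenMap_proj _ h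
  refine IsCoveringMap.mk _ ι (fun w => ?_) (fun w => ?_)
  · haveI : Nonempty (ClassifyingSpace A → Σ a : A, StarSpace a) := ⟨fun w => ⟨a w, f w⟩⟩
    exact IsOpen.trivializationDiscrete (U w) (V w) (hVo w) (hW w) (hinj w) (hsurj w) (hdisj w)
      (hexh w)
  · exact ⟨f w, by simp [ball], hf w⟩

/-- Lifting of maps along the projections. -/
theorem exists_lift {K : Type*} [TopologicalSpace K] [SimplyConnectedSpace K]
    [LocallyPathConnectedSpace K] (g : C(K, ClassifyingSpace A)) (k₀ : K) {a : A}
    (f₀ : StarSpace a) (h₀ : starProj a f₀ = g k₀) :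
    ∃ F : C(K, StarSpace a), F k₀ = f₀ ∧ ∀ k, starProj a (F k) = g k := by
  obtain ⟨F, ⟨hF0, hF⟩, -⟩ := isCoveringMap_proj.existsUnique_continuousMap_lifts g k₀
    (⟨a, f₀⟩ : Σ a : A, StarSpace a) h₀
  obtain ⟨b, F', rfl⟩ := F.exists_lift_sigma
  obtain ⟨rfl, e⟩ := Sigma.mk.inj hF0
  exact ⟨F', eq_of_heq e, fun k => congrFun hF k⟩

/-- Precompose the sphere with the collapse of a disk and lift to the covering. The boundary of the
disk lies over one point, so its lift is constant and the lift descends to the sphere. The lifted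
sphere is null in a contractible space. -/
theorem extendsToDisk (m : ℕ) (f : C(UnitSphere (m + 3), ClassifyingSpace A)) :
    ExtendsToDisk f := by
  obtain ⟨⟨a, x⟩, hx⟩ := proj_surjective (f (collapse (m + 2) (diskPole (m + 1))))
  have : LocallyPathConnectedSpace (Disk (m + 2)) :=
    (convex_closedBall _ _).locallyPathConnectedSpace
  obtain ⟨F, -, hF⟩ := exists_lift (f.comp (collapse (m + 2))) (diskPole (m + 1)) x hx
  -- Only spheres of dimension at least 2 are covered by the argument: the boundary of the collapsed
  -- disk must be connected for its lift to be constant.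
  have hS : IsPreconnected (diskBoundary (m + 2)) := by
    have h1 : IsPreconnected (Set.univ : Set (UnitSphere (m + 2))) := by
      have := isPreconnected_sphere (E := EuclideanSpace ℝ (Fin (m + 2)))
        (by
          rw [← Module.finrank_eq_rank, finrank_euclideanSpace_fin]
          exact_mod_cast (by omega : 1 < m + 2)) 0 1
      exact Subtype.preconnectedSpace this |>.isPreconnected_univ
    have h2 := h1.image (sphereIncl (m + 2)) (sphereIncl (m + 2)).continuous.continuousOn
    convert h2
    ext v
    constructor
    · intro hv
      obtain ⟨w, rfl⟩ := exists_sphereIncl hv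
      exact ⟨w, trivial, rfl⟩
    · rintro ⟨w, -, rfl⟩
      exact norm_sphereIncl w
  obtain ⟨g, hg⟩ := exists_comp_collapse F (by
    intro v hv w hw
    have := isCoveringMap_proj.constOn_of_comp hS
      (g := fun v => (⟨a, F v⟩ : Σ a : A, StarSpace a)) (by fun_prop) (by
        intro v hv w hw
        have e1 := hF v
        have e2 := hF w
        refine e1.trans (Eq.trans ?_ e2.symm)
        exact congrArg f (collapse_boundary hv hw)) hv hw
    exact eq_of_heq (Sigma.mk.inj this).2)
  have hgn : g.Nullhomotopic := by
    have := (id_nullhomotopic (StarSpace a)).comp_left g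
    simpa using this
  obtain ⟨E, hE⟩ := (extendsToDisk_iff_nullhomotopic (f := g)).2 hgn
  refine ⟨(starProj a).comp E, fun v => ?_⟩
  obtain ⟨w, rfl⟩ := collapse_surjective (m + 1) v
  change starProj a (E _) = _
  rw [hE, hg, hF]
  rfl

end ClassifyingSpace

end Classifying

/-! ### Recognising isomorphisms of groupoids -/

theorem exists_inverse_functor {A B : Type*} [Category* A] [Category* B] (F : A ⥤ B)
    (hobj : Function.Bijective F.obj) (hfull : F.Full) (hfaith : F.Faithful) :
    ∃ R : B ⥤ A, F ⋙ R = 𝟭 A ∧ R ⋙ F = 𝟭 B := by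
  let e := Equiv.ofBijective F.obj hobj
  have he : ∀ b, F.obj (e.symm b) = b := e.apply_symm_apply
  refine ⟨{ obj := e.symm
            map := fun {b b'} g => F.preimage (eqToHom (he b) ≫ g ≫ eqToHom (he b').symm)
            map_id := fun b => F.map_injective (by simp)
            map_comp := fun g g' => F.map_injective (by simp) },
    CategoryTheory.Functor.ext (fun a => e.symm_apply_apply a) fun a a' p => F.map_injective ?_,
    CategoryTheory.Functor.ext he fun b b' g => ?_⟩
  · rw [Functor.comp_map, F.map_preimage, F.map_comp, F.map_comp]
    have h1 : ∀ {x y : A} (h : x = y) (h' : F.obj x = F.obj y), eqToHom h' = F.map (eqToHom h) := by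
      rintro x _ rfl _
      simp
    exact congrArg₂ (fun p q => p ≫ _ ≫ q) (h1 _ _) (h1 _ _)
  · simp

theorem isIso_of_bijective {A B : Grpd.{u, u}} (F : A ⥤ B) (hobj : Function.Bijective F.obj)
    (hfull : F.Full) (hfaith : F.Faithful) : IsIso (show A ⟶ B from F) := by
  obtain ⟨R, h, h'⟩ := exists_inverse_functor F hobj hfull hfaith
  exact ⟨(show B ⟶ A from R), h, h'⟩

/-! ### Functoriality and fundamental groupoid of the classifying space -/

namespace ClassifyingSpace

variable {A A' A'' : Type u} [Groupoid.{u} A] [Groupoid.{u} A'] [Groupoid.{u} A'']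

/-- The map of contractible spaces induced by a functor. -/
def starMap (φ : A ⥤ A') (a : A) : C(StarSpace a, StarSpace (φ.obj a)) :=
  StepSpace.map fun p => ⟨φ.obj p.1, φ.map p.2⟩

theorem starMap_starComp (φ : A ⥤ A') {a b : A} (h : a ⟶ b) (f : StarSpace b) :
    starMap φ a (starComp h f) = starComp (φ.map h) (starMap φ b f) := by
  funext s
  exact Sigma.ext rfl (heq_of_eq (φ.map_comp _ _))

/-- The map of classifying spaces induced by a functor. -/
def map (φ : A ⥤ A') : C(ClassifyingSpace A, ClassifyingSpace A') where
  toFun := Quotient.map (fun x => ⟨φ.obj x.1, starMap φ x.1 x.2⟩) (by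
    rintro ⟨a, x⟩ ⟨b, y⟩ ⟨h, e⟩
    refine ⟨φ.map h, ?_⟩
    change starMap φ a x = _
    rw [show x = starComp h y from e, starMap_starComp])
  continuous_toFun := by
    refine continuous_quot_lift _ ?_
    refine continuous_quotient_mk'.comp (continuous_sigma fun a => ?_)
    exact continuous_sigmaMk.comp (starMap φ a).continuous

theorem map_starProj (φ : A ⥤ A') (a : A) (f : StarSpace a) :
    map φ (starProj a f) = starProj (φ.obj a) (starMap φ a f) := rfl

theorem map_id (w : ClassifyingSpace A) : map (𝟭 A) w = w := by
  induction w using Quotient.inductionOn with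
  | h x => rfl

theorem map_comp (φ : A ⥤ A') (ψ : A' ⥤ A'') (w : ClassifyingSpace A) :
    map (φ ⋙ ψ) w = map ψ (map φ w) := by
  induction w using Quotient.inductionOn with
  | h x => rfl

/-- The base point given by an object. -/
def pt (a : A) : ClassifyingSpace A := starProj a (StepSpace.const ⟨a, 𝟙 a⟩)

/-- The values of a function remember the target object, which composition on the left does not
change. Isomorphic but distinct objects thus have distinct base points. -/
theorem pt_injective : Function.Injective (pt : A → ClassifyingSpace A) := by
  intro a b h
  obtain ⟨k, hk⟩ := proj_eq_iff.1 h
  exact congrArg Sigma.fst (congrFun hk ⟨0, by simp⟩)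

theorem starProj_const {a b : A} (h : a ⟶ b) : starProj a (StepSpace.const ⟨b, h⟩) = pt b := by
  rw [pt, ← starProj_starComp h, starComp_const, Category.comp_id]

theorem starMap_const_id (φ : A ⥤ A') (a : A) :
    starMap φ a (StepSpace.const ⟨a, 𝟙 a⟩) = StepSpace.const ⟨φ.obj a, 𝟙 _⟩ :=
  congrArg (fun k : φ.obj a ⟶ φ.obj a => (StepSpace.const ⟨φ.obj a, k⟩ : StarSpace (φ.obj a)))
    (φ.map_id a)

theorem map_pt (φ : A ⥤ A') (a : A) : map φ (pt a) = pt (φ.obj a) := by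
  rw [pt, map_starProj, starMap_const_id, pt]

/-- The class of the image of a path. -/
def starClass {a : A} (x y : StarSpace a) {p q : ClassifyingSpace A} (hp : starProj a x = p)
    (hq : starProj a y = q) : FundamentalGroupoid.mk p ⟶ FundamentalGroupoid.mk q :=
  FundamentalGroupoid.fromPath (.mk (((PathConnectedSpace.somePath x y).map
    (starProj a).continuous).cast hp.symm hq.symm))

/-- The star space is simply connected, so the class depends only on the end points upstairs. -/
theorem starClass_eq_of_path {a : A} {x y : StarSpace a} (γ : Path x y) {p q : ClassifyingSpace A}
    (hp : starProj a x = p) (hq : starProj a y = q) (δ : Path p q)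
    (h : ∀ t, δ t = starProj a (γ t)) :
    starClass x y hp hq = FundamentalGroupoid.fromPath (.mk δ) := by
  subst hp hq
  have e : δ = γ.map (starProj a).continuous := Path.ext (funext h)
  rw [e]
  exact Quotient.sound ((SimplyConnectedSpace.paths_homotopic (PathConnectedSpace.somePath x y)
    γ).map (starProj a))

theorem starClass_self {a : A} (x : StarSpace a) {p : ClassifyingSpace A}
    (hp : starProj a x = p) : starClass x x hp hp = 𝟙 _ :=
  starClass_eq_of_path (Path.refl x) hp hp (Path.refl p) fun _ => hp.symm

theorem starClass_comp {a : A} (x y z : StarSpace a) {p q r : ClassifyingSpace A}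
    (hp : starProj a x = p) (hq : starProj a y = q) (hr : starProj a z = r) :
    starClass x y hp hq ≫ starClass y z hq hr = starClass x z hp hr := by
  subst hp hq hr
  symm
  refine starClass_eq_of_path ((PathConnectedSpace.somePath x y).trans
    (PathConnectedSpace.somePath y z)) rfl rfl _ fun t => ?_
  exact congrArg (fun p : Path (starProj a x) (starProj a z) => p t)
    (Path.map_trans _ _ (starProj a).continuous).symm

/-- The class is also independent of the sheet in which the path is lifted; this turns composition
of morphisms into composition of path classes. -/
theorem starClass_starComp {a b : A} (h : a ⟶ b) {x y : StarSpace b} {x' y' : StarSpace a}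
    (hx : starComp h x = x') (hy : starComp h y = y') {p q : ClassifyingSpace A}
    (hp : starProj b x = p) (hq : starProj b y = q) (hp' : starProj a x' = p)
    (hq' : starProj a y' = q) : starClass x y hp hq = starClass x' y' hp' hq' := by
  subst hx hy hp hq
  refine (starClass_eq_of_path ((PathConnectedSpace.somePath x y).map (starComp h).continuous)
    _ _ _ fun t => ?_).symm
  exact (starProj_starComp h _).symm

theorem map_starClass (φ : A ⥤ A') {a : A} {x y : StarSpace a} {x' y' : StarSpace (φ.obj a)}
    (hx : starMap φ a x = x') (hy : starMap φ a y = y') {p q : ClassifyingSpace A}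
    {p' q' : ClassifyingSpace A'} (hp : starProj a x = p) (hq : starProj a y = q)
    (hp' : starProj _ x' = p') (hq' : starProj _ y' = q')
    (ep : FundamentalGroupoid.mk (map φ p) = .mk p')
    (eq : FundamentalGroupoid.mk q' = .mk (map φ q)) :
    (FundamentalGroupoid.map (map φ)).map (starClass x y hp hq) =
      eqToHom ep ≫ starClass x' y' hp' hq' ≫ eqToHom eq := by
  subst hx hy hp hq hp' hq'
  rw [starClass_eq_of_path ((PathConnectedSpace.somePath x y).map (starMap φ a).continuous)
    rfl rfl (((PathConnectedSpace.somePath x y).map (starMap φ a).continuous).map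
      (starProj _).continuous) fun _ => rfl]
  refine Eq.trans ?_ ((Category.id_comp _).trans (Category.comp_id _)).symm
  rfl

theorem starComp_const_id {a b : A} (h : a ⟶ b) :
    starComp h (StepSpace.const ⟨b, 𝟙 b⟩) = StepSpace.const ⟨b, h⟩ := by
  rw [starComp_const, Category.comp_id]

/-- The morphism given by an element of the fiber. -/
def ptClass {a b : A} (h : a ⟶ b) : FundamentalGroupoid.mk (pt a) ⟶ .mk (pt b) :=
  starClass (StepSpace.const ⟨a, 𝟙 a⟩) (StepSpace.const ⟨b, h⟩) rfl (starProj_const h)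

theorem ptClass_id (a : A) : ptClass (𝟙 a) = 𝟙 _ := starClass_self _ _

theorem ptClass_comp {a b c : A} (h : a ⟶ b) (k : b ⟶ c) :
    ptClass (h ≫ k) = ptClass h ≫ ptClass k := by
  have e := starClass_starComp h (x := StepSpace.const ⟨b, 𝟙 b⟩) (y := StepSpace.const ⟨c, k⟩)
    (y' := StepSpace.const ⟨c, h ≫ k⟩) (starComp_const_id h) (by rw [starComp_const]) rfl (starProj_const k) (starProj_const h)
    (starProj_const (h ≫ k))
  refine Eq.trans ?_ (congrArg (ptClass h ≫ ·) e.symm)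
  exact (starClass_comp _ _ _ _ _ _).symm

variable (A) in
/-- The functor from a groupoid to the fundamental groupoid of its classifying space. -/
def toFundamentalGroupoid : A ⥤ RestrictedGroupoid (ClassifyingSpace A) (Set.range pt) where
  obj a := basePoint (pt a) ⟨a, rfl⟩
  map h := basedClass (Set.mem_range_self _) (Set.mem_range_self _) (ptClass h)
  map_id a := InducedCategory.hom_ext (ptClass_id a)
  map_comp h k := InducedCategory.hom_ext (ptClass_comp h k)

theorem map_mapsTo (φ : A ⥤ A') : Set.MapsTo (map φ) (Set.range pt) (Set.range pt) := by
  rintro _ ⟨a, rfl⟩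
  exact ⟨φ.obj a, (map_pt φ a).symm⟩

theorem toFundamentalGroupoid_naturality (φ : A ⥤ A') :
    toFundamentalGroupoid A ⋙ basedMap (map φ) (map_mapsTo φ) =
      φ ⋙ toFundamentalGroupoid A' := by
  refine CategoryTheory.Functor.ext (fun a => Subtype.ext (map_pt φ a)) fun a b h => ?_
  apply InducedCategory.hom_ext
  rw [InducedCategory.comp_hom, InducedCategory.comp_hom, InducedCategory_eqToHom_hom,
    InducedCategory_eqToHom_hom]
  exact map_starClass φ (x := StepSpace.const ⟨a, 𝟙 a⟩) (y := StepSpace.const ⟨b, h⟩)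
    (x' := StepSpace.const ⟨φ.obj a, 𝟙 _⟩) (y' := StepSpace.const ⟨φ.obj b, φ.map h⟩)
    (starMap_const_id φ a) rfl rfl (starProj_const h) rfl (starProj_const (φ.map h))
    (congrArg FundamentalGroupoid.mk (map_pt φ a))
    (congrArg FundamentalGroupoid.mk (map_pt φ b).symm)

/-- Lift a path from the constant function at the identity of a. Its end lies over the base point of
b, hence is the translate of the constant at 𝟙 b by some h, and the path represents the class of h.
-/
theorem full_toFundamentalGroupoid : (toFundamentalGroupoid A).Full where
  map_surjective := by
    intro a b p
    obtain ⟨γ, hγ⟩ := Path.Homotopic.Quotient.mk_surjective p.hom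
    have : LocallyPathConnectedSpace I := (convex_Icc (0 : ℝ) 1).locallyPathConnectedSpace
    obtain ⟨F, hF0, hF⟩ := exists_lift γ.toContinuousMap 0
      (StepSpace.const ⟨a, 𝟙 a⟩ : StarSpace a) γ.source.symm
    have hx : starProj a (F 1) = starProj b (StepSpace.const ⟨b, 𝟙 b⟩) := (hF 1).trans γ.target
    have hh : ∃ h : a ⟶ b, F 1 = starComp h (StepSpace.const ⟨b, 𝟙 b⟩) := proj_eq_iff.1 hx
    obtain ⟨h, hh⟩ := hh
    refine ⟨h, InducedCategory.hom_ext (Eq.trans ?_ hγ)⟩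
    exact starClass_eq_of_path ⟨F, hF0, hh.trans (starComp_const_id h)⟩ rfl
      (starProj_const h) γ
      fun t => (hF t).symm

/-- Homotopic paths have lifts with the same end point, and the end point of the lift for h is the
constant function with value h. -/
theorem faithful_toFundamentalGroupoid : (toFundamentalGroupoid A).Faithful where
  map_injective := by
    intro a b h h' e
    have e1 := congrArg InducedCategory.Hom.hom e
    have e1' : ptClass h = ptClass h' := e1
    let γ := PathConnectedSpace.somePath (StepSpace.const ⟨a, 𝟙 a⟩ : StarSpace a)
      (StepSpace.const ⟨b, h⟩)
    let γ' := PathConnectedSpace.somePath (StepSpace.const ⟨a, 𝟙 a⟩ : StarSpace a)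
      (StepSpace.const ⟨b, h'⟩)
    have e2 := (starClass_eq_of_path γ rfl (starProj_const h) ((γ.map
      (starProj a).continuous).cast rfl (starProj_const h).symm) fun _ => rfl).symm.trans
      (e1'.trans (starClass_eq_of_path γ' rfl (starProj_const h') ((γ'.map
      (starProj a).continuous).cast rfl (starProj_const h').symm) fun _ => rfl))
    have e3 := Path.Homotopic.Quotient.exact e2
    have e4 := isCoveringMap_proj.liftPath_apply_one_eq_of_homotopicRel e3
      (⟨a, StepSpace.const ⟨a, 𝟙 a⟩⟩ : Σ a : A, StarSpace a) (Path.source _) (Path.source _)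
    have e5 : ∀ (k : a ⟶ b) (δ : Path (StepSpace.const ⟨a, 𝟙 a⟩ : StarSpace a)
        (StepSpace.const ⟨b, k⟩)) (h0), isCoveringMap_proj.liftPath (((δ.map
          (starProj a).continuous).cast rfl (starProj_const k).symm)).toContinuousMap
          (⟨a, StepSpace.const ⟨a, 𝟙 a⟩⟩ : Σ a : A, StarSpace a) h0 1 =
          ⟨a, StepSpace.const ⟨b, k⟩⟩ := by
      intro k δ h0
      have := (isCoveringMap_proj.eq_liftPath_iff' (γ_0 := h0)
        (Γ := (ContinuousMap.sigmaMk a).comp δ.toContinuousMap)).2 ⟨rfl, by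
          change (⟨a, δ 0⟩ : Σ a : A, StarSpace a) = _
          rw [δ.source]⟩
      rw [← this]
      change (⟨a, δ 1⟩ : Σ a : A, StarSpace a) = _
      rw [δ.target]
    have e4 := (e5 h γ _).symm.trans (e4.trans (e5 h' γ' _))
    have e6 := congrFun (eq_of_heq (Sigma.mk.inj e4).2) ⟨0, by simp⟩
    exact eq_of_heq (Sigma.mk.inj e6).2

theorem bijective_obj_toFundamentalGroupoid :
    Function.Bijective (toFundamentalGroupoid A).obj := by
  refine ⟨fun a b h => pt_injective (congrArg Subtype.val h), ?_⟩
  rintro ⟨_, a, rfl⟩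
  exact ⟨a, rfl⟩

end ClassifyingSpace

/-! ### `G`-spaces over a diagram of spaces and attaching of cells -/

/-- A contravariant diagram of spaces on the orbit category. -/
structure OrbSpace (G : Type u) [Group G] where
  /-- the space assigned to an orbit -/
  obj : Orb G → Type u
  [top : ∀ H, TopologicalSpace (obj H)]
  /-- the map induced by a map of orbits -/
  map : ∀ {H K : Orb G}, (H ⟶ K) → C(obj K, obj H)
  map_comp : ∀ {H K L : Orb G} (α : H ⟶ K) (β : K ⟶ L) (w : obj L),
    map (α ≫ β) w = map α (map β w)
  map_id : ∀ (H : Orb G) (w : obj H), map (𝟙 H) w = w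

attribute [instance] OrbSpace.top

/-- A `G`-space with a natural transformation from its fixed point sets to a diagram of spaces. -/
structure OverSpace {G : Type u} [Group G] (W : OrbSpace G) where
  /-- the underlying space -/
  X : Type u
  [top : TopologicalSpace X]
  [act : MulAction G X]
  [cont : ContinuousConstSMul G X]
  /-- the components of the natural transformation -/
  eps : ∀ H : Orb G, fixedPoints H.sub X → W.obj H
  eps_translate : ∀ {H K : Orb G} (α : H ⟶ K) (x : fixedPoints K.sub X),
    eps H (translate α x) = W.map α (eps K x)
  -- Closedness is asked in X itself, not only in the fixed points: with B the whole space it says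
  -- that X^H is closed. In this form it implies continuity of the component and passes to attached
  -- cells and to unions.
  isClosed_eps : ∀ (H : Orb G) (B : Set (W.obj H)), IsClosed B →
    IsClosed {x : X | ∃ hx : x ∈ fixedPoints H.sub X, eps H ⟨x, hx⟩ ∈ B}

attribute [instance] OverSpace.top OverSpace.act OverSpace.cont

namespace OverSpace

variable {G : Type u} [Group G] {W : OrbSpace G}

/-- The component at `H` is continuous. -/
def epsMap (T : OverSpace W) (H : Orb G) : C(fixedPoints H.sub T.X, W.obj H) where
  toFun := T.eps H
  continuous_toFun := by
    refine continuous_iff_isClosed.2 fun B hB => ?_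
    have h := (T.isClosed_eps H B hB).preimage
      (continuous_subtype_val : Continuous (Subtype.val : fixedPoints H.sub T.X → T.X))
    convert h using 1
    ext x
    exact ⟨fun hx => ⟨x.2, hx⟩, fun ⟨_, hx⟩ => hx⟩

theorem eps_cosetSMul (T : OverSpace W) {H K : Subgroup G} {c : G ⧸ K}
    (hc : GCWComplex.CosetFixed H c) (x : fixedPoints K T.X)
    (hx : cosetSMul c x ∈ fixedPoints H T.X) :
    T.eps ⟨H⟩ ⟨cosetSMul c x, hx⟩ = W.map (orbHom hc) (T.eps ⟨K⟩ x) := by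
  rw [← T.eps_translate]
  exact congrArg (T.eps ⟨H⟩) (Subtype.ext (coe_translate_orbHom hc x).symm)

/-- A family of equivariant `n`-cells to be attached to a space over a diagram. -/
structure CellFamily (T : OverSpace W) (n : ℕ) where
  /-- the index set of the cells -/
  ι : Type u
  /-- the isotropy group of a cell -/
  stab : ι → Subgroup G
  /-- the attaching map of a cell -/
  att : ∀ i, C(UnitSphere n, fixedPoints (stab i) T.X)
  /-- the map of a cell to the diagram -/
  lab : ∀ i, C(Disk n, W.obj ⟨stab i⟩)
  lab_boundary : ∀ i s, lab i (sphereIncl n s) = T.eps ⟨stab i⟩ (att i s)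

namespace CellFamily

variable {T : OverSpace W} {n : ℕ} (E : CellFamily T n)

/-- The points in the interiors of the cells. -/
abbrev Interior : Type u :=
  Σ i : E.ι, (G ⧸ E.stab i) × {v : Disk n // ‖(v : EuclideanSpace ℝ (Fin n))‖ < 1}

/-- The space obtained by attaching the cells. -/
def Attached (E : CellFamily T n) : Type u := T.X ⊕ E.Interior

instance : MulAction G E.Attached where
  smul g x := Sum.map (g • ·) (fun p => ⟨p.1, g • p.2.1, p.2.2⟩) x
  one_smul x := by
    rcases x with x | ⟨i, c, v⟩
    · exact congrArg Sum.inl (one_smul G x)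
    · exact congrArg (fun c : G ⧸ E.stab i => (Sum.inr ⟨i, c, v⟩ : T.X ⊕ E.Interior)) (one_smul G c)
  mul_smul g h x := by
    rcases x with x | ⟨i, c, v⟩
    · exact congrArg Sum.inl (mul_smul g h x)
    · exact congrArg (fun c : G ⧸ E.stab i => (Sum.inr ⟨i, c, v⟩ : T.X ⊕ E.Interior)) (mul_smul g h c)

/-- The inclusion of the original space. -/
def incl (x : T.X) : E.Attached := Sum.inl x

/-- The inclusion of the interiors of the cells. -/
def interior (p : E.Interior) : E.Attached := Sum.inr p

theorem incl_smul (g : G) (x : T.X) : E.incl (g • x) = g • E.incl x := rfl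

theorem incl_injective : Function.Injective E.incl := Sum.inl_injective

theorem interior_smul (g : G) (i : E.ι) (c : G ⧸ E.stab i) (v) :
    E.interior ⟨i, g • c, v⟩ = g • E.interior ⟨i, c, v⟩ := rfl

open Classical in
/-- The characteristic maps. -/
def char (i : E.ι) (c : G ⧸ E.stab i) (v : Disk n) : E.Attached :=
  if h : ‖(v : EuclideanSpace ℝ (Fin n))‖ < 1 then E.interior ⟨i, c, ⟨v, h⟩⟩
  else E.incl (cosetSMul c (E.att i ⟨v, mem_sphere_zero_iff_norm.2
    (le_antisymm (norm_disk_le v) (not_lt.1 h))⟩))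

theorem char_of_lt (i : E.ι) (c : G ⧸ E.stab i) {v : Disk n}
    (h : ‖(v : EuclideanSpace ℝ (Fin n))‖ < 1) : E.char i c v = E.interior ⟨i, c, ⟨v, h⟩⟩ :=
  dif_pos h

theorem char_sphereIncl (i : E.ι) (c : G ⧸ E.stab i) (s : UnitSphere n) :
    E.char i c (sphereIncl n s) = E.incl (cosetSMul c (E.att i s)) :=
  dif_neg (norm_sphereIncl s).not_lt

theorem char_smul (i : E.ι) (g : G) (c : G ⧸ E.stab i) (v : Disk n) :
    E.char i (g • c) v = g • E.char i c v := by
  by_cases h : ‖(v : EuclideanSpace ℝ (Fin n))‖ < 1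
  · rw [char_of_lt _ _ _ h, char_of_lt _ _ _ h, interior_smul]
  · obtain ⟨s, rfl⟩ := exists_sphereIncl (le_antisymm (norm_disk_le v) (not_lt.1 h))
    rw [char_sphereIncl, char_sphereIncl, cosetSMul_smul, incl_smul]

instance : TopologicalSpace E.Attached where
  IsOpen U := IsOpen (E.incl ⁻¹' U) ∧ ∀ i c, IsOpen (E.char i c ⁻¹' U)
  isOpen_univ := ⟨isOpen_univ, fun _ _ => isOpen_univ⟩
  isOpen_inter U V hU hV := ⟨hU.1.inter hV.1, fun i c => (hU.2 i c).inter (hV.2 i c)⟩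
  isOpen_sUnion 𝒰 h := by
    simp only [Set.preimage_sUnion]
    exact ⟨isOpen_biUnion fun U hU => (h U hU).1,
      fun i c => isOpen_biUnion fun U hU => (h U hU).2 i c⟩

theorem isOpen_iff {U : Set E.Attached} :
    IsOpen U ↔ IsOpen (E.incl ⁻¹' U) ∧ ∀ i c, IsOpen (E.char i c ⁻¹' U) := Iff.rfl

theorem isClosed_iff {A : Set E.Attached} :
    IsClosed A ↔ IsClosed (E.incl ⁻¹' A) ∧ ∀ i c, IsClosed (E.char i c ⁻¹' A) := by
  simp only [← isOpen_compl_iff, isOpen_iff, Set.preimage_compl]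

theorem continuous_incl : Continuous E.incl := ⟨fun _ hU => hU.1⟩

theorem continuous_char (i : E.ι) (c : G ⧸ E.stab i) : Continuous (E.char i c) :=
  ⟨fun _ hU => hU.2 i c⟩

instance : ContinuousConstSMul G E.Attached where
  continuous_const_smul g := ⟨fun U hU => by
    refine (isOpen_iff E).2 ⟨hU.1.preimage (continuous_const_smul g), fun i c => ?_⟩
    convert hU.2 i (g • c) using 1
    ext v
    change g • E.char i c v ∈ U ↔ E.char i (g • c) v ∈ U
    rw [char_smul]⟩

theorem isClosed_image_sphereIncl {n : ℕ} {A : Set (UnitSphere n)} (hA : IsClosed A) :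
    IsClosed (sphereIncl n '' A) := by
  have : CompactSpace (UnitSphere n) := isCompact_iff_compactSpace.1 (isCompact_sphere _ _)
  exact (hA.isCompact.image (sphereIncl n).continuous).isClosed

theorem continuous_cosetSMul_att (i : E.ι) (c : G ⧸ E.stab i) :
    Continuous fun s => cosetSMul c (E.att i s) := by
  induction c using QuotientGroup.induction_on with
  | H a => exact (continuous_subtype_val.comp (E.att i).continuous).const_smul a

/-- In a closed cell the preimage of the image of A is the part of the boundary sphere that is
attached to A, which is compact. -/
theorem isClosedMap_incl : IsClosedMap E.incl := by
  intro A hA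
  refine E.isClosed_iff.2 ⟨?_, fun i c => ?_⟩
  · rwa [Set.preimage_image_eq _ E.incl_injective]
  · convert isClosed_image_sphereIncl (hA.preimage (E.continuous_cosetSMul_att i c)) using 1
    ext v
    constructor
    · rintro ⟨x, hx, e⟩
      by_cases h : ‖(v : EuclideanSpace ℝ (Fin n))‖ < 1
      · rw [char_of_lt _ _ _ h] at e
        exact absurd e Sum.inl_ne_inr
      · obtain ⟨s, rfl⟩ := exists_sphereIncl (le_antisymm (norm_disk_le v) (not_lt.1 h))
        rw [char_sphereIncl] at e
        obtain rfl := E.incl_injective e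
        exact ⟨s, hx, rfl⟩
    · rintro ⟨s, hs, rfl⟩
      exact ⟨_, hs, (E.char_sphereIncl i c s).symm⟩

variable {E}

theorem incl_mem_fixedPoints {H : Subgroup G} {x : T.X} :
    E.incl x ∈ fixedPoints H E.Attached ↔ x ∈ fixedPoints H T.X :=
  ⟨fun h g => E.incl_injective (h g), fun h g => congrArg E.incl (h g)⟩

theorem cosetFixed_of_interior {H : Subgroup G} {p : E.Interior}
    (h : E.interior p ∈ fixedPoints H E.Attached) : GCWComplex.CosetFixed H p.2.1 := by
  intro g hg
  have h1 : E.interior ⟨p.1, g • p.2.1, p.2.2⟩ = E.interior p := h ⟨g, hg⟩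
  have h2 := eq_of_heq (Sigma.mk.inj (Sum.inr_injective h1)).2
  exact congrArg Prod.fst h2

theorem char_mem_fixedPoints {H : Subgroup G} {i : E.ι} {c : G ⧸ E.stab i}
    (hc : GCWComplex.CosetFixed H c) (v : Disk n) :
    E.char i c v ∈ fixedPoints H E.Attached := by
  intro g
  change (g : G) • E.char i c v = _
  rw [← char_smul, hc g g.2]

variable (E) in
/-- The extension of the natural transformation to the cells. -/
def eps (H : Orb G) : fixedPoints H.sub E.Attached → W.obj H
  | ⟨Sum.inl x, hx⟩ => T.eps H ⟨x, incl_mem_fixedPoints.1 hx⟩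
  | ⟨Sum.inr p, hp⟩ => W.map (orbHom (cosetFixed_of_interior hp)) (E.lab p.1 p.2.2.1)

theorem eps_incl {H : Orb G} {x : T.X} (hx : E.incl x ∈ fixedPoints H.sub E.Attached) :
    E.eps H ⟨E.incl x, hx⟩ = T.eps H ⟨x, incl_mem_fixedPoints.1 hx⟩ := rfl

theorem eps_interior {H : Orb G} {p : E.Interior}
    (hp : E.interior p ∈ fixedPoints H.sub E.Attached) :
    E.eps H ⟨E.interior p, hp⟩ =
      W.map (orbHom (cosetFixed_of_interior hp)) (E.lab p.1 p.2.2.1) := rfl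

/-- Inside the cell this is the definition; on the boundary it is the compatibility of the label
with the attaching map. -/
theorem eps_char {H : Orb G} {i : E.ι} {c : G ⧸ E.stab i}
    (hc : GCWComplex.CosetFixed H.sub c) (v : Disk n) :
    E.eps H ⟨E.char i c v, char_mem_fixedPoints hc v⟩ = W.map (orbHom hc) (E.lab i v) := by
  by_cases h : ‖(v : EuclideanSpace ℝ (Fin n))‖ < 1
  · have key : ∀ x (hx : x ∈ fixedPoints H.sub E.Attached),
        x = E.interior ⟨i, c, ⟨v, h⟩⟩ →
        E.eps H ⟨x, hx⟩ = W.map (orbHom hc) (E.lab i v) := by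
      rintro _ hx rfl
      exact eps_interior hx
    exact key _ _ (E.char_of_lt i c h)
  · obtain ⟨s, rfl⟩ := exists_sphereIncl (le_antisymm (norm_disk_le v) (not_lt.1 h))
    have key : ∀ x (hx : x ∈ fixedPoints H.sub E.Attached),
        x = E.incl (cosetSMul c (E.att i s)) →
        E.eps H ⟨x, hx⟩ = W.map (orbHom hc) (E.lab i (sphereIncl n s)) := by
      rintro _ hx rfl
      rw [eps_incl, E.lab_boundary]
      exact T.eps_cosetSMul hc _ _
    exact key _ _ (E.char_sphereIncl i c s)

/-- A map of orbits is determined by the image of the base coset. -/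
theorem orbHom_comp {H K : Orb G} {L : Subgroup G} (α : H ⟶ K) {c : G ⧸ L}
    (hc : GCWComplex.CosetFixed K.sub c) {d : G ⧸ L} (hd : GCWComplex.CosetFixed H.sub d)
    (h : MulActionHom.toFun (orbHom hc) (MulActionHom.toFun α (baseCoset H.sub)) = d) :
    (orbHom hd : H ⟶ ⟨L⟩) = α ≫ orbHom hc := by
  apply MulActionHom.ext
  intro x
  induction x using QuotientGroup.induction_on with
  | H a =>
    subst h
    rw [mk_eq_smul_baseCoset]
    refine (MulActionHom.map_smul' (orbHom hd) a (baseCoset H.sub)).trans ?_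
    refine Eq.trans ?_ (MulActionHom.map_smul' (α ≫ orbHom hc) a (baseCoset H.sub)).symm
    exact congrArg (a • ·) (orbHom_baseCoset hd)

theorem eps_translate {H K : Orb G} (α : H ⟶ K) (x : fixedPoints K.sub E.Attached) :
    E.eps H (translate α x) = W.map α (E.eps K x) := by
  obtain ⟨x | p, hx⟩ := x
  · have hx' := incl_mem_fixedPoints.1 hx
    refine Eq.trans ?_ (T.eps_translate α ⟨x, hx'⟩)
    have key : ∀ c : G ⧸ K.sub, cosetSMul c (⟨E.incl x, hx⟩ : fixedPoints K.sub E.Attached) =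
        E.incl (cosetSMul c ⟨x, hx'⟩) := by
      intro c
      induction c using QuotientGroup.induction_on with
      | H a => rfl
    have : translate α (⟨E.incl x, hx⟩ : fixedPoints K.sub E.Attached) =
        ⟨E.incl (translate α (⟨x, hx'⟩ : fixedPoints K.sub T.X) : T.X),
          incl_mem_fixedPoints.2 (Subtype.prop _)⟩ := Subtype.ext (key _)
    exact congrArg (E.eps H) this
  · obtain ⟨i, c, v⟩ := p
    have hc : GCWComplex.CosetFixed K.sub c := cosetFixed_of_interior hx
    have key : ∀ b : G ⧸ K.sub,
        cosetSMul b (⟨E.interior ⟨i, c, v⟩, hx⟩ : fixedPoints K.sub E.Attached) =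
        E.interior ⟨i, MulActionHom.toFun (orbHom hc) b, v⟩ := by
      intro b
      induction b using QuotientGroup.induction_on with
      | H a => rfl
    have h2 := (translate α (⟨E.interior ⟨i, c, v⟩, hx⟩ : fixedPoints K.sub E.Attached)).2
    have h3 : translate α (⟨E.interior ⟨i, c, v⟩, hx⟩ : fixedPoints K.sub E.Attached) =
        ⟨E.interior ⟨i, MulActionHom.toFun (orbHom hc)
          (MulActionHom.toFun α (baseCoset H.sub)), v⟩, by rw [← key]; exact h2⟩ :=
      Subtype.ext (key _)
    refine (congrArg (E.eps H) h3).trans ?_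
    refine (eps_interior _).trans ?_
    refine Eq.trans ?_ (W.map_comp α (orbHom hc) _)
    exact congrArg (fun β : H ⟶ ⟨E.stab i⟩ => W.map β (E.lab i v.1)) (orbHom_comp α hc _ rfl)

/-- If the coset is H-fixed, the whole closed cell lies in the fixed points and the label decides.
If not, no interior point is H-fixed and only a closed part of the boundary sphere matters. -/
theorem isClosed_eps (H : Orb G) (B : Set (W.obj H)) (hB : IsClosed B) :
    IsClosed {x : E.Attached | ∃ hx : x ∈ fixedPoints H.sub E.Attached, E.eps H ⟨x, hx⟩ ∈ B} := by
  have h0 : E.incl ⁻¹' {x | ∃ hx : x ∈ fixedPoints H.sub E.Attached, E.eps H ⟨x, hx⟩ ∈ B} =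
      {x : T.X | ∃ hx : x ∈ fixedPoints H.sub T.X, T.eps H ⟨x, hx⟩ ∈ B} := by
    ext x
    exact ⟨fun ⟨hx, h⟩ => ⟨incl_mem_fixedPoints.1 hx, h⟩,
      fun ⟨hx, h⟩ => ⟨incl_mem_fixedPoints.2 hx, h⟩⟩
  refine E.isClosed_iff.2 ⟨by rw [h0]; exact T.isClosed_eps H B hB, fun i c => ?_⟩
  by_cases hc : GCWComplex.CosetFixed H.sub c
  · convert hB.preimage ((W.map (orbHom hc)).continuous.comp (E.lab i).continuous) using 1
    ext v
    refine ⟨fun ⟨hx, h⟩ => ?_, fun h => ⟨char_mem_fixedPoints hc v, ?_⟩⟩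
    · rw [eps_char hc] at h
      exact h
    · rw [eps_char hc]
      exact h
  · convert isClosed_image_sphereIncl ((T.isClosed_eps H B hB).preimage
      (E.continuous_cosetSMul_att i c)) using 1
    rw [← h0]
    ext v
    constructor
    · rintro hv
      by_cases h : ‖(v : EuclideanSpace ℝ (Fin n))‖ < 1
      · obtain ⟨hx, -⟩ := hv
        rw [char_of_lt _ _ _ h] at hx
        exact absurd (cosetFixed_of_interior hx) hc
      · obtain ⟨s, rfl⟩ := exists_sphereIncl (le_antisymm (norm_disk_le v) (not_lt.1 h))
        rw [Set.mem_preimage, char_sphereIncl] at hv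
        exact ⟨s, hv, rfl⟩
    · rintro ⟨s, hs, rfl⟩
      rw [Set.mem_preimage, char_sphereIncl]
      exact hs

variable (E) in
/-- The space over the diagram obtained by attaching the cells. -/
def attached : OverSpace W where
  X := E.Attached
  eps := E.eps
  eps_translate := eps_translate
  isClosed_eps := isClosed_eps

end CellFamily

end OverSpace

/-! ### The `G`-CW-complex obtained by successively attaching cells -/

namespace OverSpace

variable {G : Type u} [Group G] {W : OrbSpace G}

variable (W) in
/-- The empty space over a diagram. -/
def empty : OverSpace W :=
  letI : TopologicalSpace PEmpty.{u + 1} := ⊥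
  letI : MulAction G PEmpty.{u + 1} := 
    { smul := fun _ x => x, one_smul := fun _ => rfl, mul_smul := fun _ _ _ => rfl }
  letI : ContinuousConstSMul G PEmpty.{u + 1} := ⟨fun _ => continuous_of_discreteTopology⟩
  { X := PEmpty
    eps := fun _ x => x.1.elim
    eps_translate := fun _ x => x.1.elim
    isClosed_eps := fun _ _ _ => isClosed_discrete _ }

variable (𝓕 : ∀ (n : ℕ) (T : OverSpace W), CellFamily T n)

/-- The stages of the construction: the `n`-cells are attached in the step from `n` to `n + 1`. -/
def stage : ℕ → OverSpace W
  | 0 => empty W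
  | n + 1 => (𝓕 n (stage n)).attached

/-- The `n`-cells. -/
def cells (n : ℕ) : CellFamily (stage 𝓕 n) n := 𝓕 n (stage 𝓕 n)

/-- The union of the stages. -/
def Colim : Type u := Σ n, (cells 𝓕 n).Interior

/-- The inclusion of a stage into the union. -/
def ofStage : ∀ n, (stage 𝓕 n).X → Colim 𝓕
  | 0 => PEmpty.elim
  | n + 1 => Sum.elim (ofStage n) (fun p => ⟨n, p⟩)

theorem stage_succ_cases {n : ℕ} (x : (stage 𝓕 (n + 1)).X) :
    (∃ y, x = (cells 𝓕 n).incl y) ∨ ∃ p, x = (cells 𝓕 n).interior p := by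
  rcases x with y | p
  · exact Or.inl ⟨y, rfl⟩
  · exact Or.inr ⟨p, rfl⟩

theorem ofStage_fst_lt : ∀ (n : ℕ) (x : (stage 𝓕 n).X), (ofStage 𝓕 n x).1 < n
  | 0, x => x.elim
  | n + 1, x => by
    rcases stage_succ_cases 𝓕 x with ⟨y, rfl⟩ | ⟨p, rfl⟩
    · exact (ofStage_fst_lt n y).trans (Nat.lt_succ_self n)
    · exact Nat.lt_succ_self n

theorem ofStage_injective : ∀ n : ℕ, Function.Injective (ofStage 𝓕 n)
  | 0 => fun x => x.elim
  | n + 1 => by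
    intro x y h
    rcases stage_succ_cases 𝓕 x with ⟨x, rfl⟩ | ⟨p, rfl⟩ <;>
      rcases stage_succ_cases 𝓕 y with ⟨y, rfl⟩ | ⟨q, rfl⟩
    · exact congrArg _ (ofStage_injective n h)
    · exact absurd (congrArg Sigma.fst h) (ofStage_fst_lt 𝓕 n x).ne
    · exact absurd (congrArg Sigma.fst h) (ofStage_fst_lt 𝓕 n y).ne'
    · exact congrArg _ (eq_of_heq (Sigma.mk.inj h).2)

theorem exists_ofStage_eq {w : Colim 𝓕} {n : ℕ} (h : w.1 < n) : ∃ x, ofStage 𝓕 n x = w := by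
  induction n with
  | zero => exact absurd h (Nat.not_lt_zero _)
  | succ n ih =>
    rcases Nat.lt_succ_iff_lt_or_eq.1 h with h | h
    · obtain ⟨x, hx⟩ := ih h
      exact ⟨(cells 𝓕 n).incl x, hx⟩
    · obtain ⟨m, p⟩ := w
      obtain rfl : m = n := h
      exact ⟨(cells 𝓕 m).interior p, rfl⟩

instance : MulAction G (Colim 𝓕) where
  smul g w := ⟨w.1, w.2.1, g • w.2.2.1, w.2.2.2⟩
  one_smul w := by
    obtain ⟨n, i, c, v⟩ := w
    exact congrArg (fun c => (⟨n, i, c, v⟩ : Colim 𝓕)) (one_smul G c)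
  mul_smul g h w := by
    obtain ⟨n, i, c, v⟩ := w
    exact congrArg (fun c => (⟨n, i, c, v⟩ : Colim 𝓕)) (mul_smul g h c)

theorem ofStage_smul (g : G) : ∀ (n : ℕ) (x : (stage 𝓕 n).X),
    ofStage 𝓕 n (g • x) = g • ofStage 𝓕 n x
  | 0, x => x.elim
  | n + 1, x => by
    rcases stage_succ_cases 𝓕 x with ⟨y, rfl⟩ | ⟨p, rfl⟩
    · exact ofStage_smul g n y
    · rfl

instance : TopologicalSpace (Colim 𝓕) where
  IsOpen U := ∀ n, IsOpen (ofStage 𝓕 n ⁻¹' U)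
  isOpen_univ _ := isOpen_univ
  isOpen_inter _ _ hU hV n := (hU n).inter (hV n)
  isOpen_sUnion 𝒰 h n := by
    simp only [Set.preimage_sUnion]
    exact isOpen_biUnion fun U hU => h U hU n

theorem colim_isClosed_iff {A : Set (Colim 𝓕)} :
    IsClosed A ↔ ∀ n, IsClosed (ofStage 𝓕 n ⁻¹' A) := by
  simp only [← isOpen_compl_iff]
  exact Iff.rfl

theorem continuous_ofStage (n : ℕ) : Continuous (ofStage 𝓕 n) := ⟨fun _ hU => hU n⟩

instance : ContinuousConstSMul G (Colim 𝓕) where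
  continuous_const_smul g := ⟨fun U hU n => by
    convert (hU n).preimage (continuous_const_smul g) using 1
    ext x
    change g • ofStage 𝓕 n x ∈ U ↔ ofStage 𝓕 n (g • x) ∈ U
    rw [ofStage_smul]⟩

theorem isClosed_stage_succ {n : ℕ} {A : Set (stage 𝓕 (n + 1)).X} :
    IsClosed A ↔ IsClosed ((cells 𝓕 n).incl ⁻¹' A) ∧
      ∀ i c, IsClosed ((cells 𝓕 n).char i c ⁻¹' A) :=
  (cells 𝓕 n).isClosed_iff

/-- At stages beyond n the preimage is carried along by closed inclusions; at earlier ones it is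
pulled back from a later stage. -/
theorem isClosedMap_ofStage (n : ℕ) : IsClosedMap (ofStage 𝓕 n) := by
  intro A hA
  refine (colim_isClosed_iff 𝓕).2 fun m => ?_
  have hup : ∀ m, n ≤ m → IsClosed (ofStage 𝓕 m ⁻¹' (ofStage 𝓕 n '' A)) := by
    intro m hm
    induction m, hm using Nat.le_induction with
    | base => rwa [Set.preimage_image_eq _ (ofStage_injective 𝓕 n)]
    | succ m hm ih =>
      suffices h : ofStage 𝓕 (m + 1) ⁻¹' (ofStage 𝓕 n '' A) =
          (cells 𝓕 m).incl '' (ofStage 𝓕 m ⁻¹' (ofStage 𝓕 n '' A)) by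
        rw [h]
        exact (cells 𝓕 m).isClosedMap_incl _ ih
      ext x
      constructor
      · rintro ⟨a, ha, e⟩
        rcases stage_succ_cases 𝓕 x with ⟨y, rfl⟩ | ⟨p, rfl⟩
        · exact ⟨y, ⟨a, ha, e⟩, rfl⟩
        · exact absurd (congrArg Sigma.fst e) ((ofStage_fst_lt 𝓕 n a).trans_le hm).ne
      · rintro ⟨y, ⟨a, ha, e⟩, rfl⟩
        exact ⟨a, ha, e⟩
  have hdown : ∀ k m, IsClosed (ofStage 𝓕 (m + k) ⁻¹' (ofStage 𝓕 n '' A)) →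
      IsClosed (ofStage 𝓕 m ⁻¹' (ofStage 𝓕 n '' A)) := by
    intro k
    induction k with
    | zero => exact fun m h => h
    | succ k ih => exact fun m h => ih m (h.preimage (cells 𝓕 (m + k)).continuous_incl)
  -- The stage m + n lies above both n and m.
  exact hdown n m (hup (m + n) (Nat.le_add_left n m))

theorem isClosedEmbedding_ofStage (n : ℕ) : IsClosedEmbedding (ofStage 𝓕 n) :=
  .of_continuous_injective_isClosedMap (continuous_ofStage 𝓕 n) (ofStage_injective 𝓕 n)
    (isClosedMap_ofStage 𝓕 n)

variable {𝓕}

theorem ofStage_mem_fixedPoints {n : ℕ} {H : Subgroup G} {x : (stage 𝓕 n).X} :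
    ofStage 𝓕 n x ∈ fixedPoints H (Colim 𝓕) ↔ x ∈ fixedPoints H (stage 𝓕 n).X := by
  have h (g : H) : g • ofStage 𝓕 n x = ofStage 𝓕 n x ↔ g • x = x :=
    (Eq.congr_left (ofStage_smul 𝓕 (g : G) n x).symm).trans (ofStage_injective 𝓕 n).eq_iff
  exact forall_congr' h

variable (𝓕) in
/-- The natural transformation on the union of the stages. -/
def colimEps (H : Orb G) (w : fixedPoints H.sub (Colim 𝓕)) : W.obj H :=
  (stage 𝓕 (w.1.1 + 1)).eps H ⟨(cells 𝓕 w.1.1).interior w.1.2, ofStage_mem_fixedPoints.1 w.2⟩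

theorem colimEps_ofStage {H : Orb G} : ∀ (n : ℕ) (x : (stage 𝓕 n).X)
    (h : ofStage 𝓕 n x ∈ fixedPoints H.sub (Colim 𝓕)),
    colimEps 𝓕 H ⟨ofStage 𝓕 n x, h⟩ = (stage 𝓕 n).eps H ⟨x, ofStage_mem_fixedPoints.1 h⟩
  | 0, x, _ => x.elim
  | n + 1, x, h => by
    rcases stage_succ_cases 𝓕 x with ⟨y, rfl⟩ | ⟨p, rfl⟩
    · exact colimEps_ofStage n y h
    · rfl

theorem colimEps_translate {H K : Orb G} (α : H ⟶ K) (w : fixedPoints K.sub (Colim 𝓕)) :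
    colimEps 𝓕 H (translate α w) = W.map α (colimEps 𝓕 K w) := by
  obtain ⟨w, hw⟩ := w
  obtain ⟨n, x, rfl⟩ : ∃ n x, ofStage 𝓕 n x = w :=
    ⟨_, exists_ofStage_eq 𝓕 (Nat.lt_succ_self w.1)⟩
  have hx := ofStage_mem_fixedPoints.1 hw
  have key : ∀ b : G ⧸ K.sub,
      cosetSMul b (⟨ofStage 𝓕 n x, hw⟩ : fixedPoints K.sub (Colim 𝓕)) =
      ofStage 𝓕 n (cosetSMul b ⟨x, hx⟩) := by
    intro b
    induction b using QuotientGroup.induction_on with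
    | H a => exact (ofStage_smul 𝓕 a n x).symm
  have h3 : translate α (⟨ofStage 𝓕 n x, hw⟩ : fixedPoints K.sub (Colim 𝓕)) =
      ⟨ofStage 𝓕 n (translate α (⟨x, hx⟩ : fixedPoints K.sub (stage 𝓕 n).X)).1,
        ofStage_mem_fixedPoints.2 (Subtype.prop _)⟩ := Subtype.ext (key _)
  rw [h3, colimEps_ofStage, colimEps_ofStage]
  exact (stage 𝓕 n).eps_translate α ⟨x, hx⟩

variable (𝓕) in
/-- The union of the stages as a space over the diagram. -/
def colim : OverSpace W where
  X := Colim 𝓕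
  eps := colimEps 𝓕
  eps_translate := colimEps_translate
  isClosed_eps H B hB := (colim_isClosed_iff 𝓕).2 fun n => by
    convert (stage 𝓕 n).isClosed_eps H B hB using 1
    ext x
    refine ⟨fun ⟨hx, h⟩ => ⟨ofStage_mem_fixedPoints.1 hx, ?_⟩,
      fun ⟨hx, h⟩ => ⟨ofStage_mem_fixedPoints.2 hx, ?_⟩⟩
    · rwa [colimEps_ofStage] at h
    · rwa [colimEps_ofStage]

variable (𝓕) in
/-- A stage is a member of the filtration of the union. -/
def stageHomeomorph (n : ℕ) : (stage 𝓕 n).X ≃ₜ {w : Colim 𝓕 | w.1 < n} :=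
  (isClosedEmbedding_ofStage 𝓕 n).isEmbedding.toHomeomorph.trans (Homeomorph.setCongr (by
    ext w
    exact ⟨fun ⟨x, hx⟩ => hx ▸ ofStage_fst_lt 𝓕 n x, fun h => exists_ofStage_eq 𝓕 h⟩))

theorem isClosed_preimage_coe_iff {n : ℕ} {A : Set (Colim 𝓕)} :
    IsClosed ((↑) ⁻¹' A : Set {w : Colim 𝓕 | w.1 < n}) ↔ IsClosed (ofStage 𝓕 n ⁻¹' A) :=
  (stageHomeomorph 𝓕 n).isClosed_preimage.symm

variable (𝓕) in
/-- The characteristic maps of the union. -/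
def colimChar (n : ℕ) (i : (cells 𝓕 n).ι) (c : G ⧸ (cells 𝓕 n).stab i) (v : Disk n) : Colim 𝓕 :=
  ofStage 𝓕 (n + 1) ((cells 𝓕 n).char i c v)

theorem colimChar_sphereIncl {n : ℕ} (i : (cells 𝓕 n).ι) (c : G ⧸ (cells 𝓕 n).stab i)
    (s : UnitSphere n) : colimChar 𝓕 n i c (sphereIncl n s) =
      ofStage 𝓕 n (cosetSMul c ((cells 𝓕 n).att i s)) := by
  rw [colimChar, CellFamily.char_sphereIncl]
  rfl

theorem colimChar_of_lt {n : ℕ} (i : (cells 𝓕 n).ι) (c : G ⧸ (cells 𝓕 n).stab i) {v : Disk n}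
    (hv : ‖(v : EuclideanSpace ℝ (Fin n))‖ < 1) :
    colimChar 𝓕 n i c v = ⟨n, i, c, ⟨v, hv⟩⟩ := by
  rw [colimChar, CellFamily.char_of_lt _ _ _ hv]
  rfl

theorem bijOn_colimChar (n : ℕ) :
    Set.BijOn (fun p : (i : (cells 𝓕 n).ι) × ((G ⧸ (cells 𝓕 n).stab i) × Disk n) =>
      colimChar 𝓕 n p.1 p.2.1 p.2.2)
      {p | ‖(p.2.2 : EuclideanSpace ℝ (Fin n))‖ < 1}
      ({w : Colim 𝓕 | w.1 < n + 1} \ {w : Colim 𝓕 | w.1 < n}) := by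
  refine ⟨?_, ?_, ?_⟩
  · rintro ⟨i, c, v⟩ hv
    change colimChar 𝓕 n i c v ∈ _
    rw [colimChar_of_lt i c hv]
    exact ⟨Nat.lt_succ_self n, lt_irrefl n⟩
  · rintro ⟨i, c, v⟩ hv ⟨i', c', v'⟩ hv' h
    change colimChar 𝓕 n i c v = colimChar 𝓕 n i' c' v' at h
    rw [colimChar_of_lt i c hv, colimChar_of_lt i' c' hv'] at h
    have h1 := eq_of_heq (Sigma.mk.inj h).2
    obtain rfl : i = i' := congrArg Sigma.fst h1
    have h2 := eq_of_heq (Sigma.mk.inj h1).2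
    obtain rfl : c = c' := congrArg Prod.fst h2
    obtain rfl : v = v' := congrArg (fun p => p.2.1) h2
    rfl
  · rintro ⟨m, i, c, v, hv⟩ ⟨h1, h2⟩
    obtain rfl : m = n := le_antisymm (Nat.lt_succ_iff.1 h1) (not_lt.1 h2)
    exact ⟨⟨i, c, v⟩, hv, colimChar_of_lt i c hv⟩

variable (𝓕) in
/-- The structure of a `G`-CW-complex on the union of the stages. -/
def colimCW : GCWComplex G (colim 𝓕).X where
  filt n := {w : Colim 𝓕 | w.1 < n}
  filt_zero := Set.eq_empty_of_forall_notMem fun w h => Nat.not_lt_zero _ h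
  filt_mono m n h w (hw : w.1 < m) := lt_of_lt_of_le hw h
  filt_smul n g w hw := hw
  iUnion_filt := Set.eq_univ_of_forall fun w => Set.mem_iUnion.2 ⟨w.1 + 1, Nat.lt_succ_self _⟩
  isClosed_iff A := (colim_isClosed_iff 𝓕).trans
    (forall_congr' fun n => isClosed_preimage_coe_iff.symm)
  cell n := (cells 𝓕 n).ι
  stab n := (cells 𝓕 n).stab
  char := colimChar 𝓕
  char_smul n i g c v := (congrArg (ofStage 𝓕 (n + 1)) ((cells 𝓕 n).char_smul i g c v)).trans
    (ofStage_smul 𝓕 g (n + 1) _)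
  char_continuous n i c := (continuous_ofStage 𝓕 (n + 1)).comp ((cells 𝓕 n).continuous_char i c)
  char_boundary n i c v hv := by
    obtain ⟨s, rfl⟩ := exists_sphereIncl hv
    rw [colimChar_sphereIncl]
    exact ofStage_fst_lt 𝓕 n _
  char_interior := bijOn_colimChar
  isClosed_succ n A := by
    refine isClosed_preimage_coe_iff.trans ((isClosed_stage_succ 𝓕).trans ?_)
    exact and_congr isClosed_preimage_coe_iff.symm Iff.rfl

theorem colimEps_char {n : ℕ} {H : Orb G} {i : (cells 𝓕 n).ι} {c : G ⧸ (cells 𝓕 n).stab i}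
    (hc : GCWComplex.CosetFixed H.sub c) (v : Disk n) :
    (colim 𝓕).eps H ((colimCW 𝓕).charFixed (i := i) hc v) =
      W.map (orbHom hc) ((cells 𝓕 n).lab i v) :=
  (colimEps_ofStage (n + 1) ((cells 𝓕 n).char i c v) _).trans (CellFamily.eps_char hc v)

end OverSpace

/-! ### The cells of the universal space -/

namespace OverSpace

variable {G : Type u} [Group G] {W : OrbSpace G}

/-- All cells which can be attached to a space over a diagram. -/
def allCells (n : ℕ) (T : OverSpace W) : CellFamily T n where
  ι := Σ H : Subgroup G, {p : C(UnitSphere n, fixedPoints H T.X) × C(Disk n, W.obj ⟨H⟩) //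
    ∀ s, p.2 (sphereIncl n s) = T.eps ⟨H⟩ (p.1 s)}
  stab i := i.1
  att i := i.2.1.1
  lab i := i.2.1.2
  lab_boundary i := i.2.2

theorem isEmpty_unitSphere_zero : IsEmpty (UnitSphere 0) :=
  ⟨fun s => by
    have h := norm_sphereIncl s
    rw [Subsingleton.elim (sphereIncl 0 s : EuclideanSpace ℝ (Fin 0)) 0, norm_zero] at h
    exact zero_ne_one h⟩

variable {S : Type u} [MulAction G S] (o : ∀ H : Orb G, fixedPoints H.sub S → W.obj H)

/-- The representative of an orbit as a fixed point of its stabilizer. -/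
def orbitPoint (ω : orbitRel.Quotient G S) : fixedPoints (stabilizer G ω.out) S :=
  ⟨ω.out, fun g => g.2⟩

/-- The vertices given by a `G`-set. -/
def vertexCells (T : OverSpace W) : CellFamily T 0 where
  ι := orbitRel.Quotient G S
  stab ω := stabilizer G ω.out
  att _ := ⟨isEmpty_unitSphere_zero.elim, continuous_iff_continuousAt.2
    isEmpty_unitSphere_zero.elim⟩
  lab ω := ContinuousMap.const _ (o _ (orbitPoint ω))
  lab_boundary _ := isEmpty_unitSphere_zero.elim

/-- The vertices given by a `G`-set and all cells of positive dimension. -/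
def cellFamilies : ∀ (n : ℕ) (T : OverSpace W), CellFamily T n
  | 0 => vertexCells o
  | n + 1 => allCells (n + 1)

theorem orbHom_cosetFixed_baseCoset (H : Subgroup G) :
    orbHom (GCWComplex.cosetFixed_baseCoset H) = 𝟙 (⟨H⟩ : Orb G) := by
  apply MulActionHom.ext
  intro x
  induction x using QuotientGroup.induction_on with
  | H a =>
    change a • baseCoset H = _
    rw [← mk_eq_smul_baseCoset]
    rfl

/-- The pair of the boundary map and the disk F is itself one of the (n+1)-cells attached to the
stage, and its characteristic map at the base coset is the required lift. -/
theorem exists_disk_lift {n : ℕ} {H : Subgroup G}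
    (a : C(UnitSphere (n + 1), {z : fixedPoints H (colim (cellFamilies o)).X //
      (z : (colim (cellFamilies o)).X) ∈ (colimCW (cellFamilies o)).filt (n + 1)}))
    (F : C(Disk (n + 1), W.obj ⟨H⟩))
    (h : ∀ s, F (sphereIncl (n + 1) s) = (colim (cellFamilies o)).eps ⟨H⟩ (a s).1) :
    ∃ e : C(Disk (n + 1), fixedPoints H (colim (cellFamilies o)).X),
      (∀ s, e (sphereIncl (n + 1) s) = (a s).1) ∧
        ∀ v, (colim (cellFamilies o)).eps ⟨H⟩ (e v) = F v := by
  let φ := stageHomeomorph (cellFamilies o) (n + 1)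
  let b : UnitSphere (n + 1) → (stage (cellFamilies o) (n + 1)).X :=
    fun s => φ.symm ⟨(a s).1.1, (a s).2⟩
  have hb : Continuous b := by
    have h1 : Continuous fun s => (a s).1.1 := by fun_prop
    exact φ.symm.continuous.comp (h1.subtype_mk _)
  have hb' (s) : ofStage (cellFamilies o) (n + 1) (b s) = (a s).1.1 :=
    congrArg Subtype.val (φ.apply_symm_apply ⟨(a s).1.1, (a s).2⟩)
  have hbH (s) : b s ∈ fixedPoints H (stage (cellFamilies o) (n + 1)).X := by
    refine ofStage_mem_fixedPoints.1 ?_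
    rw [hb']
    exact (a s).1.2
  have hF (s) : F (sphereIncl (n + 1) s) =
      (stage (cellFamilies o) (n + 1)).eps ⟨H⟩ ⟨b s, hbH s⟩ := by
    refine (h s).trans ?_
    rw [← colimEps_ofStage (n + 1) (b s) (ofStage_mem_fixedPoints.2 (hbH s))]
    exact congrArg (colimEps (cellFamilies o) ⟨H⟩) (Subtype.ext (hb' s).symm)
  let i : (cells (cellFamilies o) (n + 1)).ι := (⟨H, (⟨_, hb.subtype_mk hbH⟩, F), hF⟩ :
    Σ H : Subgroup G, {p : C(UnitSphere (n + 1), fixedPoints H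
      (stage (cellFamilies o) (n + 1)).X) × C(Disk (n + 1), W.obj ⟨H⟩) //
    ∀ s, p.2 (sphereIncl (n + 1) s) = (stage (cellFamilies o) (n + 1)).eps ⟨H⟩ (p.1 s)})
  refine ⟨(colimCW (cellFamilies o)).charFixed (n := n + 1) (i := i)
    (GCWComplex.cosetFixed_baseCoset H),
    fun s => Subtype.ext ?_, fun v => ?_⟩
  · refine (colimChar_sphereIncl i (baseCoset H) s).trans (Eq.trans ?_ (hb' s))
    exact congrArg (ofStage (cellFamilies o) (n + 1)) (one_smul G (b s))
  · refine (colimEps_char (𝓕 := cellFamilies o) (n := n + 1) (H := ⟨H⟩) (i := i)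
      (GCWComplex.cosetFixed_baseCoset H) v).trans ?_
    refine (congrArg (fun β : (⟨H⟩ : Orb G) ⟶ ⟨H⟩ => W.map β (F v))
      (orbHom_cosetFixed_baseCoset H)).trans ?_
    exact W.map_id ⟨H⟩ (F v)

variable {o}

theorem eps_vertex (ho : ∀ {H K : Orb G} (α : H ⟶ K) (s : fixedPoints K.sub S),
      o H (translate α s) = W.map α (o K s)) {H : Orb G} {ω : orbitRel.Quotient G S}
    {c : G ⧸ stabilizer G ω.out} (hc : GCWComplex.CosetFixed H.sub c) (v : Disk 0) :
    (colim (cellFamilies o)).eps H ((colimCW (cellFamilies o)).charFixed (n := 0) (i := ω) hc v) =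
      o H (translate (orbHom hc) (orbitPoint ω)) :=
  (colimEps_char (𝓕 := cellFamilies o) (n := 0) (i := ω) hc v).trans (ho _ _).symm

/-- This and the next lemma are the decomposition of S into orbits, each identified with G modulo
the stabilizer of a representative. -/
theorem orbitPoint_cosetSMul_injective {ω ω' : orbitRel.Quotient G S}
    {c : G ⧸ stabilizer G ω.out} {c' : G ⧸ stabilizer G ω'.out}
    (h : cosetSMul c (orbitPoint ω) = cosetSMul c' (orbitPoint ω')) :
    (⟨ω, c⟩ : Σ ω : orbitRel.Quotient G S, G ⧸ stabilizer G ω.out) = ⟨ω', c'⟩ := by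
  induction c using QuotientGroup.induction_on with
  | H a =>
    induction c' using QuotientGroup.induction_on with
    | H b =>
      have h' : a • ω.out = b • ω'.out := h
      have e : ω = ω' := by
        rw [← Quotient.out_eq ω, ← Quotient.out_eq ω']
        refine Quotient.sound (s := orbitRel G S) ⟨a⁻¹ * b, ?_⟩
        change (a⁻¹ * b) • ω'.out = ω.out
        rw [mul_smul, ← h', inv_smul_smul]
      subst e
      refine congrArg _ (QuotientGroup.eq.2 ?_)
      rw [mem_stabilizer_iff, mul_smul, ← h', inv_smul_smul]

theorem exists_orbitPoint_eq {H : Subgroup G} (s : fixedPoints H S) :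
    ∃ (ω : orbitRel.Quotient G S) (c : G ⧸ stabilizer G ω.out) (hc : GCWComplex.CosetFixed H c),
      translate (orbHom hc) (orbitPoint ω) = s := by
  let ω : orbitRel.Quotient G S := Quotient.mk (orbitRel G S) s.1
  obtain ⟨g, hg⟩ : s.1 ∈ orbit G ω.out :=
    Setoid.symm' (orbitRel G S) (Quotient.exact (Quotient.out_eq ω))
  have hg' : g • ω.out = s.1 := hg
  have hc : GCWComplex.CosetFixed H (g : G ⧸ stabilizer G ω.out) := by
    intro h hh
    refine QuotientGroup.eq.2 ?_
    have h1 : h • s.1 = s.1 := s.2 ⟨h, hh⟩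
    change ((h * g)⁻¹ * g) • ω.out = ω.out
    rw [mul_smul, inv_smul_eq_iff, mul_smul, hg', h1]
  refine ⟨ω, g, hc, Subtype.ext ?_⟩
  rw [coe_translate_orbHom]
  exact hg'

/-- The 0-cells reproduce the orbits of S, so the H-fixed vertices correspond to the H-fixed points
of S, and under this correspondence the structure map is o. -/
theorem bijOn_eps_zeroSkel (ho : ∀ {H K : Orb G} (α : H ⟶ K) (s : fixedPoints K.sub S),
      o H (translate α s) = W.map α (o K s)) {H : Orb G} (hinj : Function.Injective (o H)) :
    Set.BijOn ((colim (cellFamilies o)).eps H) ((colimCW (cellFamilies o)).zeroSkel H.sub)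
      (Set.range (o H)) := by
  have key : ∀ x ∈ (colimCW (cellFamilies o)).zeroSkel H.sub,
      ∃ (ω : orbitRel.Quotient G S) (c : G ⧸ stabilizer G ω.out)
        (hc : GCWComplex.CosetFixed H.sub c),
        x = (colimCW (cellFamilies o)).charFixed (n := 0) (i := ω) hc 0 := by
    intro x hx
    obtain ⟨i, c, v, hv, h⟩ := (colimCW (cellFamilies o)).exists_char (n := 0) (x := x.1) hx (by
      rw [GCWComplex.filt_zero]
      exact Set.notMem_empty _)
    have hc : GCWComplex.CosetFixed H.sub c :=
      GCWComplex.cosetFixed_of_char_mem hv (by rw [h]; exact x.2)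
    obtain rfl : v = 0 := Subsingleton.elim _ _
    exact ⟨i, c, hc, Subtype.ext h.symm⟩
  refine ⟨?_, ?_, ?_⟩
  · intro x hx
    obtain ⟨ω, c, hc, rfl⟩ := key x hx
    rw [eps_vertex ho]
    exact Set.mem_range_self _
  · intro x hx y hy h
    obtain ⟨ω, c, hc, rfl⟩ := key x hx
    obtain ⟨ω', c', hc', rfl⟩ := key y hy
    rw [eps_vertex ho, eps_vertex ho] at h
    have h' := congrArg Subtype.val (hinj h)
    rw [coe_translate_orbHom, coe_translate_orbHom] at h'
    cases orbitPoint_cosetSMul_injective h'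
    rfl
  · rintro _ ⟨s, rfl⟩
    obtain ⟨ω, c, hc, hs⟩ := exists_orbitPoint_eq s
    refine ⟨(colimCW (cellFamilies o)).charFixed (n := 0) (i := ω) hc 0,
      GCWComplex.charFixed_mem_zeroSkel _ _, ?_⟩
    rw [eps_vertex ho, hs]

end OverSpace

/-! ### Maps of fixed point sets with the lifting property for disks -/

namespace GCWComplex

variable {G : Type u} [Group G] {X : Type u} [TopologicalSpace X] [MulAction G X]
  {Z : Type u} [TopologicalSpace Z] {C : GCWComplex G X} {H : Subgroup G}
  {ε : C(fixedPoints H X, Z)}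

variable (C) in
/-- Disks in the target lift, extending a given lift of the boundary sphere to the skeleton. -/
def HasDiskLifts (ε : C(fixedPoints H X, Z)) : Prop :=
  ∀ (n : ℕ) (a : C(UnitSphere (n + 1), {z : fixedPoints H X // (z : X) ∈ C.filt (n + 1)}))
    (F : C(Disk (n + 1), Z)), (∀ s, F (sphereIncl (n + 1) s) = ε (a s).1) →
      ∃ e : C(Disk (n + 1), fixedPoints H X),
        (∀ s, e (sphereIncl (n + 1) s) = (a s).1) ∧ ∀ v, ε (e v) = F v

/-- Deform the sphere S^n into the n-skeleton inside X^H. Its filling in Z changes by a homotopy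
only, and the lifting property then fills it in X^H. -/
theorem HasDiskLifts.extendsToDisk (hε : C.HasDiskLifts ε) {n : ℕ}
    (f : C(UnitSphere (n + 1), fixedPoints H X)) (h : ExtendsToDisk (ε.comp f)) :
    ExtendsToDisk f := by
  obtain ⟨g, ⟨T⟩, hg⟩ := C.exists_cellular_approx_fixedPoints
    (isCompact_sphere (0 : EuclideanSpace ℝ (Fin (n + 1))) 1) (dimH_sphere_lt n) f
  have hfg : f.Homotopic g := ⟨T.toHomotopy⟩
  obtain ⟨F, hF⟩ := h.of_homotopic ((ContinuousMap.Homotopic.refl ε).comp hfg.symm)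
  obtain ⟨e, he, -⟩ := hε n ⟨fun s => ⟨g s, hg s⟩, by fun_prop⟩ F hF
  exact ExtendsToDisk.of_homotopic ⟨e, he⟩ hfg

/-- It suffices that loops which become null in Z are null; such a loop is a map of the circle,
filled by `HasDiskLifts.extendsToDisk`. -/
theorem HasDiskLifts.faithful (hε : C.HasDiskLifts ε) : (FundamentalGroupoid.map ε).Faithful where
  map_injective := by
    intro x y p q h
    obtain ⟨b, c, hc, hc'⟩ := exists_circle_param.{u}
    have key : ∀ (x : fixedPoints H X) (p : FundamentalGroupoid.mk x ⟶ .mk x),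
        (FundamentalGroupoid.map ε).map p = 𝟙 _ → p = 𝟙 _ := by
      intro x p hp
      obtain ⟨γ, rfl⟩ := Path.Homotopic.Quotient.mk_surjective p
      obtain ⟨f, hf⟩ := hc' _ x γ
      have hx : f b = x := by
        rw [← c.source, hf, γ.source]
      subst hx
      obtain rfl : c.map f.continuous = γ := Path.ext (funext hf)
      have h1 : ExtendsToDisk (ε.comp f) := (hc _ _).2 (Quotient.exact hp)
      exact Quotient.sound ((hc _ f).1 (hε.extendsToDisk f h1))
    have h1 : p ≫ inv q = 𝟙 x := by
      refine key x.as _ ?_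
      refine ((FundamentalGroupoid.map ε).map_comp p (inv q)).trans ?_
      rw [h, ← Functor.map_comp, IsIso.hom_inv_id]
      exact CategoryTheory.Functor.map_id _ _
    exact ((IsIso.comp_inv_eq q).1 h1).trans (Category.id_comp q)

theorem finite_unitSphere_one : Finite (UnitSphere 1) := by
  obtain ⟨e, he⟩ := exists_interval_homeomorph
  refine Finite.of_injective (β := ({0, 1} : Set I))
    (fun s => ⟨e.symm (sphereIncl 1 s), (he _).1 ?_⟩) ?_
  · rw [e.apply_symm_apply]
    exact norm_sphereIncl s
  · intro s t h
    have h1 := e.symm.injective (congrArg Subtype.val h)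
    exact Subtype.ext (congrArg (fun v : Disk 1 => (v : EuclideanSpace ℝ (Fin 1))) h1)

/-- This is the lifting property for the 1-disk, whose boundary S^0 is sent to the two given
vertices. -/
theorem HasDiskLifts.exists_path_lift (hε : C.HasDiskLifts ε) {x y : fixedPoints H X}
    (hx : (x : X) ∈ C.filt 1) (hy : (y : X) ∈ C.filt 1) (δ : Path (ε x) (ε y)) :
    ∃ γ : Path x y, ∀ t, ε (γ t) = δ t := by
  classical
  obtain ⟨e, he⟩ := exists_interval_homeomorph
  have := finite_unitSphere_one
  have h0 := (he 0).2 (Set.mem_insert _ _)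
  have h1 := (he 1).2 (Set.mem_insert_of_mem _ rfl)
  obtain ⟨s0, hs0⟩ := exists_sphereIncl h0
  obtain ⟨s1, hs1⟩ := exists_sphereIncl h1
  let a : C(UnitSphere 1, {z : fixedPoints H X // (z : X) ∈ C.filt 1}) :=
    ⟨fun s => if e.symm (sphereIncl 1 s) = 0 then ⟨x, hx⟩ else ⟨y, hy⟩,
      continuous_of_discreteTopology⟩
  obtain ⟨E, hE, hE'⟩ := hε 0 a (δ.toContinuousMap.comp (e.symm : C(Disk 1, I))) (by
    intro s
    change δ (e.symm (sphereIncl 1 s)) = ε (if e.symm (sphereIncl 1 s) = 0 then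
      (⟨x, hx⟩ : {z : fixedPoints H X // (z : X) ∈ C.filt 1}) else ⟨y, hy⟩).1
    have hs : e.symm (sphereIncl 1 s) ∈ ({0, 1} : Set I) := by
      rw [← he, e.apply_symm_apply]
      exact norm_sphereIncl s
    rcases hs with h | h
    · rw [if_pos h, h, δ.source]
    · rw [Set.mem_singleton_iff.1 h, if_neg one_ne_zero, δ.target])
  refine ⟨⟨E.comp (e : C(I, Disk 1)), ?_, ?_⟩, fun t => ?_⟩
  · change E (e 0) = x
    rw [← hs0, hE]
    change (if e.symm (sphereIncl 1 s0) = 0 then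
      (⟨x, hx⟩ : {z : fixedPoints H X // (z : X) ∈ C.filt 1}) else ⟨y, hy⟩).1 = x
    rw [hs0, e.symm_apply_apply, if_pos rfl]
  · change E (e 1) = y
    rw [← hs1, hE]
    change (if e.symm (sphereIncl 1 s1) = 0 then
      (⟨x, hx⟩ : {z : fixedPoints H X // (z : X) ∈ C.filt 1}) else ⟨y, hy⟩).1 = y
    rw [hs1, e.symm_apply_apply, if_neg one_ne_zero]
  · change ε (E (e t)) = δ t
    rw [hE']
    exact congrArg δ (e.symm_apply_apply t)

/-- Path lifting between vertices gives fullness and filling of loops gives faithfulness, so with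
the bijection of base points the groupoids are isomorphic and not merely equivalent. -/
theorem HasDiskLifts.isIso_restrictedMap (hε : C.HasDiskLifts ε) {T : Set Z}
    (hT : Set.BijOn ε (C.zeroSkel H) T) :
    IsIso (show Grpd.of (RestrictedGroupoid (fixedPoints H X) (C.zeroSkel H)) ⟶
      Grpd.of (RestrictedGroupoid Z T) from restrictedMap ε hT.mapsTo) := by
  refine isIso_of_bijective (A := Grpd.of (RestrictedGroupoid (fixedPoints H X) (C.zeroSkel H)))
    (B := Grpd.of (RestrictedGroupoid Z T)) (restrictedMap ε hT.mapsTo) ⟨?_, ?_⟩ ⟨?_⟩ ⟨?_⟩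
  · intro x y h
    exact Subtype.ext (hT.injOn x.2 y.2 (congrArg Subtype.val h))
  · rintro ⟨z, hz⟩
    obtain ⟨x, hx, rfl⟩ := hT.surjOn hz
    exact ⟨⟨x, hx⟩, rfl⟩
  · intro x y p
    obtain ⟨δ, hδ⟩ := Path.Homotopic.Quotient.mk_surjective p.hom
    obtain ⟨γ, hγ⟩ := hε.exists_path_lift x.2 y.2 δ
    refine ⟨InducedCategory.homMk (FundamentalGroupoid.fromPath (.mk γ)),
      InducedCategory.hom_ext (Eq.trans ?_ hδ)⟩
    exact congrArg Path.Homotopic.Quotient.mk (Path.ext (funext hγ))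
  · intro x y p q h
    have h' := congrArg InducedCategory.Hom.hom h
    have := hε.faithful
    exact InducedCategory.hom_ext ((FundamentalGroupoid.map ε).map_injective h')

end GCWComplex

/-! ### Existence of universal spaces -/

section Existence

variable {G : Type u} [Group G] (P : (Orb G)ᵒᵖ ⥤ Grpd.{u, u})

open ClassifyingSpace Opposite

/-- The classifying spaces of a contravariant functor to groupoids. -/
def classifyingDiagram : OrbSpace G where
  obj H := ClassifyingSpace (P.obj (op H))
  map α := ClassifyingSpace.map (P.map α.op)
  map_comp α β w := by
    rw [op_comp, P.map_comp]
    exact ClassifyingSpace.map_comp (P.map β.op) (P.map α.op) w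
  map_id H w := by
    rw [op_id, P.map_id]
    exact ClassifyingSpace.map_id w

/-- The fundamental groupoids of the classifying spaces on the base points. -/
def classifyingGroupoid : (Orb G)ᵒᵖ ⥤ Grpd.{u, u} where
  obj H := Grpd.of (RestrictedGroupoid (ClassifyingSpace (P.obj H)) (Set.range pt))
  map α := restrictedMap (ClassifyingSpace.map (P.map α)) (map_mapsTo (P.map α))
  map_id H := by
    have e : ClassifyingSpace.map (P.map (𝟙 H)) = ContinuousMap.id _ := by
      rw [P.map_id]
      exact ContinuousMap.ext ClassifyingSpace.map_id
    exact (restrictedMap_congr (map_mapsTo _) (Set.mapsTo_id _) e).trans (restrictedMap_id _)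
  map_comp {H K L} α β := by
    have e : ClassifyingSpace.map (P.map (α ≫ β)) =
        (ClassifyingSpace.map (P.map β)).comp (ClassifyingSpace.map (P.map α)) := by
      rw [P.map_comp]
      exact ContinuousMap.ext (ClassifyingSpace.map_comp (P.map α) (P.map β))
    exact (restrictedMap_congr (map_mapsTo (P.map (α ≫ β)))
      (g := (ClassifyingSpace.map (P.map β)).comp (ClassifyingSpace.map (P.map α)))
      (fun _ hx => map_mapsTo (P.map β) (map_mapsTo (P.map α) hx)) e).trans
      (restrictedMap_comp _ _ (map_mapsTo (P.map α)) (map_mapsTo (P.map β)) _)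

/-- The groupoids are the fundamental groupoids of their classifying spaces. -/
def classifyingIso : P ≅ classifyingGroupoid P :=
  let τ : P ⟶ classifyingGroupoid P :=
    { app := fun H => toFundamentalGroupoid (P.obj H)
      naturality := fun _ _ α => (toFundamentalGroupoid_naturality (P.map α)).symm }
  have (H : (Orb G)ᵒᵖ) : IsIso (τ.app H) := isIso_of_bijective (A := P.obj H)
    (B := (classifyingGroupoid P).obj H) (toFundamentalGroupoid (P.obj H))
    bijective_obj_toFundamentalGroupoid full_toFundamentalGroupoid faithful_toFundamentalGroupoid
  have : IsIso τ := NatIso.isIso_of_isIso_app τ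
  asIso τ

variable {P} {X : OverSpace (classifyingDiagram P)} (C : GCWComplex G X.X)

/-- A space over the diagram of classifying spaces whose fixed point sets have the lifting property
for disks and the right vertices is a universal space. -/
def universalSpaceOfHasDiskLifts (hlift : ∀ H : Orb G, C.HasDiskLifts (X.epsMap H))
    (hbij : ∀ H : Orb G, Set.BijOn (X.epsMap H) (C.zeroSkel H.sub)
      (Set.range (pt : P.obj (op H) → ClassifyingSpace (P.obj (op H))))) :
    UniversalSpace P X.X where
  cw := C
  ident :=
    let τ : C.fundamentalGroupoidFunctor ⟶ classifyingGroupoid P :=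
      { app := fun H => restrictedMap (X.epsMap H.unop) (hbij H.unop).mapsTo
        naturality := fun K H α => by
          have e : (X.epsMap H.unop).comp (translateMap α.unop) =
              (ClassifyingSpace.map (P.map α)).comp (X.epsMap K.unop) :=
            ContinuousMap.ext (X.eps_translate α.unop)
          have h₁ : Set.MapsTo ((X.epsMap H.unop).comp (translateMap α.unop))
              (C.zeroSkel K.unop.sub) (Set.range pt) :=
            fun _ hx => (hbij H.unop).mapsTo (C.translate_mapsTo α.unop hx)
          have h₂ : Set.MapsTo ((ClassifyingSpace.map (P.map α)).comp (X.epsMap K.unop))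
              (C.zeroSkel K.unop.sub) (Set.range pt) :=
            fun _ hx => map_mapsTo (P.map α) ((hbij K.unop).mapsTo hx)
          exact (restrictedMap_comp _ _ (C.translate_mapsTo α.unop)
            (hbij H.unop).mapsTo h₁).symm.trans ((restrictedMap_congr h₁ h₂ e).trans
              (restrictedMap_comp _ _ (hbij K.unop).mapsTo (map_mapsTo (P.map α)) h₂)) }
    have (H : (Orb G)ᵒᵖ) : IsIso (τ.app H) := (hlift H.unop).isIso_restrictedMap (hbij H.unop)
    have : IsIso τ := NatIso.isIso_of_isIso_app τ
    asIso τ ≪≫ (classifyingIso P).symm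
  aspherical H j hj x := by
    obtain ⟨m, rfl⟩ := Nat.exists_eq_add_of_le' hj
    refine (forall_subsingleton_pi_iff (m + 1)).2 (fun f => ?_) x
    exact (hlift ⟨H⟩).extendsToDisk f (ClassifyingSpace.extendsToDisk m _)

theorem ObjectsAreFixedPoints.exists_universalSpace (h : ObjectsAreFixedPoints P) :
    ∃ (B : Type u) (_ : TopologicalSpace B) (_ : MulAction G B) (_ : ContinuousConstSMul G B),
      Nonempty (UniversalSpace P B) := by
  obtain ⟨S, _, ⟨ι⟩⟩ := h
  let o (H : Orb G) (s : fixedPoints H.sub S) : (classifyingDiagram P).obj H :=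
    pt (show P.obj (op H) from ι.inv.app (op H) s)
  have hι (H : Orb G) : Function.Bijective (ι.inv.app (op H)) :=
    (isIso_iff_bijective _).1 inferInstance
  have ho {H K : Orb G} (α : H ⟶ K) (s : fixedPoints K.sub S) :
      o H (translate α s) = (classifyingDiagram P).map α (o K s) := by
    have h1 := congrArg (fun f => f s) (ι.inv.naturality α.op)
    refine Eq.trans ?_ (map_pt (P.map α.op) _).symm
    exact congrArg pt h1
  have hinj (H : Orb G) : Function.Injective (o H) := pt_injective.comp (hι H).1
  -- The isomorphism with S^H reaches every object, so the vertices lie over all base points of the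
  -- classifying space.
  have hrange (H : Orb G) : Set.range (o H) =
      Set.range (pt : P.obj (op H) → ClassifyingSpace (P.obj (op H))) :=
    (hι H).2.range_comp (pt : P.obj (op H) → ClassifyingSpace (P.obj (op H)))
  refine ⟨_, _, _, _, ⟨universalSpaceOfHasDiskLifts
    (OverSpace.colimCW (OverSpace.cellFamilies o)) (fun H n a F hF => ?_) fun H => ?_⟩⟩
  · exact OverSpace.exists_disk_lift o a F hF
  · exact Eq.mp (congrArg (Set.BijOn _ _) (hrange H)) (OverSpace.bijOn_eps_zeroSkel ho (hinj H))

end Existence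

end EquivariantUniversalSpace

end

open EquivariantUniversalSpace in
theorem proposition4p5 {G : Type u} [Group G] (P : (Orb G)ᵒᵖ ⥤ Grpd.{u, u}) :
    -- a universal space `BΠ` exists iff `H ↦ Ob Π(H)` is `H ↦ S^H` for some `G`-set `S`
    ((∃ (B : Type u) (_ : TopologicalSpace B) (_ : MulAction G B) (_ : ContinuousConstSMul G B),
        Nonempty (UniversalSpace P B)) ↔ ObjectsAreFixedPoints P) ∧
    -- every universal space `BΠ` has the universal property
    ∀ (B : Type u) [TopologicalSpace B] [MulAction G B] [ContinuousConstSMul G B]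
      (BP : UniversalSpace P B)
      (Y : Type u) [TopologicalSpace Y] [MulAction G Y] [ContinuousConstSMul G Y]
      (D : GCWComplex G Y) (Φ : D.fundamentalGroupoidFunctor ⟶ P),
      (∃ φ : CellularGMap D BP.cw, φ.sharp ≫ BP.ident.hom = Φ) ∧
      ∀ φ φ' : CellularGMap D BP.cw,
        φ.sharp ≫ BP.ident.hom = Φ → φ'.sharp ≫ BP.ident.hom = Φ →
          GHomotopic G φ.toMap φ'.toMap := by
  refine ⟨⟨?_, ObjectsAreFixedPoints.exists_universalSpace⟩, ?_⟩
  · rintro ⟨B, _, _, _, ⟨BP⟩⟩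
    exact BP.objectsAreFixedPoints
  · intro B _ _ _ BP Y _ _ _ D Φ
    exact ⟨BP.exists_sharp_comp_eq Φ, fun φ φ' h h' => BP.gHomotopic h h'⟩
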